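/- Let $m\ge 3$ and $1\le k\le m-1$ be integers. Let $\Omega\subset\mathbb C^n\cong\mathbb R^{2n}$ be a domain with a uniformly $C^m$ defining function $\rho$: $\Omega=\{\rho<0\}$, $\mathrm b\Omega=\{\rho=0\}$, and there is an open neighborhood $U$ of $\mathrm b\Omega$ with $\operatorname{dist}(\mathrm b\Omega,\mathrm bU)>0$, $\|\rho\|_{C^m(U)}<\infty$ and $\inf_U|\nabla\rho|>0$. Suppose that $\Omega$ is asymptotically non-radial, i.e. $$\inf_{r>0}\ \sup_{x\in \mathrm b\Omega,\,|x|>r}\frac{|x\cdot\nabla\rho|}{|x|\,|\nabla\rho|}<1$$ (no condition if $\Omega$ is bounded). For $t\in\mathbb R$ let $\|f\|_t^2=\int_\Omega|f|^2e^{-t|z|^2}dV$, $X_j^t=\frac{\partial}{\partial x_j}-2tx_j$ ($1\le j\le 2n$), let $H^k(\Omega,e^{-t|z|^2},X^t)$ be the space of $f\in L^2(\Omega,e^{-t|z|^2})$ whose weak derivatives $(X^t)^\alpha f$, $|\alpha|\le k$, lie in $L^2(\Omega,e^{-t|z|^2})$, and let $\|f\|_{t,k,\Omega}^2=\sum_{|\alpha|\le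 k}\|(X^t)^\alpha f\|_t^2$. For $(0,q)$-forms $v=\sum_J v_J\,d\bar z_J$ the space $H^k_{0,q}(\Omega,e^{-t|z|^2},X^t)$ and the norms are defined coefficientwise, $\bar\partial v=\sum_{J,K}\sum_{j}\epsilon^{jJ}_K\frac{\partial v_J}{\partial\bar z_j}d\bar z_K$, and $\vartheta^t v=-\sum_I\sum_j\big(\frac{\partial}{\partial z_j}-t\bar z_j\big)v_{jI}\,d\bar z_I$ with $v_{jI}=\sum_J\epsilon^{jI}_Jv_J$ is the formal adjoint of $\bar\partial$ in $L^2(\Omega,e^{-t|z|^2})$ (no boundary condition is imposed on $v$). Here $\epsilon^{jI}_J$ is the sign of the permutation sorting $(j,I)$ into $J$ if $j\notin I$ and $\{j\}\cup I=J$, and $0$ otherwise. Let $\nabla_T=(T_i)_i$ be a finite family of real vector fields on $\Omega$ with coefficients in $C^{m-1}(\Omega)$ that are bounded together with their derivatives of order at most $m-1$, such that, for some $0<\varepsilon_1\le\varepsilon_2<r$ with $\{\operatorname{dist}(\cdot,\mathrm b\Omega)<r\}\subset U$ and some $c>0$: (i) $T_i\rho=0$ for all $i$ at the points of $\Omega$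 with $\operatorname{dist}(z,\mathrm b\Omega)<\varepsilon_1$; (ii) $\sum_i\langle T_i(z),\xi\rangle^2\ge c|\xi|^2$ for all $\xi\in\mathbb R^{2n}$ with $\xi\cdot\nabla\rho(z)=0$ at the points of $\Omega$ with $\operatorname{dist}(z,\mathrm b\Omega)<\varepsilon_2$; (iii) the same inequality holds for all $\xi\in\mathbb R^{2n}$ at all other points of $\Omega$. So $\nabla_T$ contains only tangential derivatives, and enough of them, on a uniform neighborhood of $\mathrm b\Omega$, and is comparable to the full gradient away from $\mathrm b\Omega$. Let $T_i^t=T_i-t\,T_i(|z|^2)$, acting on the coefficients of a form, and $\|(\nabla_T^t)^kv\|_t^2=\sum_{i_1,\dots,i_k}\|T_{i_1}^t\cdots T_{i_k}^tv\|_t^2$. Then there is a constant $C_k>0$, independent of $t$, and for every $t\in\mathbb R$ a constant $C_{t,k}>0$, such that for every $v\in H^k_{0,q}(\Omega,e^{-t|z|^2},X^t)$ $$\|v\|_{t,k,\Omega}^2\le C_k\Big(\|\bar\partial v\|_{t,k-1,\Omega}^2+\|\vartheta^tv\|_{t,k-1,\Omega}^2+\|(\nabla_T^t)^kv\|_t^2\Big)+C_{t,k}\|v\|_{t,k-1,\Omega}^2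 .$$ -/

import Mathlib

open MeasureTheory Set
open scoped ENNReal NNReal ContDiff

noncomputable section

namespace WeightedDbar

/-- `ℂⁿ`, identified with `ℝ²ⁿ`: the real coordinates of `z` are `x (j, 0) = Re z_j` and
`x (j, 1) = Im z_j`, with the Euclidean norm and Lebesgue measure. -/
abbrev Cn (n : ℕ) := EuclideanSpace ℝ (Fin n × Fin 2)

/-- The complex coordinate `z_j`. -/
def zCoord {n : ℕ} (j : Fin n) (x : Cn n) : ℂ := (x (j, 0) : ℂ) + Complex.I * (x (j, 1) : ℂ)

/-! ### Weak derivatives and weighted derivatives -/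

/-- `g` is the weak (distributional) derivative `∂f/∂x_l` on the open set `Ω`. -/
def HasWeakDeriv {n : ℕ} (Ω : Set (Cn n)) (l : Fin n × Fin 2) (f g : Cn n → ℂ) : Prop :=
  LocallyIntegrableOn f Ω volume ∧ LocallyIntegrableOn g Ω volume ∧
    ∀ φ : Cn n → ℝ, ContDiff ℝ ∞ φ → HasCompactSupport φ → tsupport φ ⊆ Ω →
      ∫ x in Ω, (fderiv ℝ φ x (EuclideanSpace.single l 1)) • f x = -∫ x in Ω, φ x • g x

open Classical in
/-- The weak derivative `∂f/∂x_l` on `Ω` (unique up to a null set); it is only used for functions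
that have one, and is `0` by convention otherwise. -/
def weakDeriv {n : ℕ} (Ω : Set (Cn n)) (l : Fin n × Fin 2) (f : Cn n → ℂ) : Cn n → ℂ :=
  if h : ∃ g, HasWeakDeriv Ω l f g then h.choose else 0

/-- The weighted derivative `X_l^t = ∂/∂x_l - 2 t x_l`. -/
def wX {n : ℕ} (Ω : Set (Cn n)) (t : ℝ) (l : Fin n × Fin 2) (f : Cn n → ℂ) : Cn n → ℂ :=
  fun x => weakDeriv Ω l f x - 2 * (t : ℂ) * (x l : ℂ) * f x

/-- The weighted derivative `(X^t)^α` for a multi-index `α`, the product being taken in the fixed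
order `x_{(1,0)}, x_{(1,1)}, x_{(2,0)}, …` of the real coordinates. -/
def wXpow {n : ℕ} (Ω : Set (Cn n)) (t : ℝ) (α : Fin n × Fin 2 → ℕ) (f : Cn n → ℂ) : Cn n → ℂ :=
  ((List.finRange n).product (List.finRange 2)).foldr (fun l g => (wX Ω t l)^[α l] g) f

/-! ### Weighted Sobolev spaces -/

/-- The measure `e^{-t|z|²} dV` on `Ω`. -/
def wMeasure {n : ℕ} (Ω : Set (Cn n)) (t : ℝ) : Measure (Cn n) :=
  (volume.restrict Ω).withDensity (fun x => ENNReal.ofReal (Real.exp (-t * ‖x‖ ^ 2)))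

/-- `‖f‖_t² = ∫_Ω |f|² e^{-t|z|²} dV`, as an extended real. -/
def normSqL2 {n : ℕ} (Ω : Set (Cn n)) (t : ℝ) (f : Cn n → ℂ) : ℝ≥0∞ :=
  ∫⁻ x, ‖f x‖ₑ ^ 2 ∂(wMeasure Ω t)

/-- Membership in `H^k(Ω, e^{-t|z|²}, X^t)`: all weighted derivatives of order at most `k` exist
in the weak sense and belong to `L²(Ω, e^{-t|z|²})`. -/
def MemSobolev {n : ℕ} (Ω : Set (Cn n)) (t : ℝ) : ℕ → (Cn n → ℂ) → Prop
  | 0, f => MemLp f 2 (wMeasure Ω t)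
  | k + 1, f => MemLp f 2 (wMeasure Ω t) ∧
      ∀ l : Fin n × Fin 2, (∃ g, HasWeakDeriv Ω l f g) ∧ MemSobolev Ω t k (wX Ω t l f)

/-- `‖f‖_{t,k}² = ∑_{|α| ≤ k} ‖(X^t)^α f‖_t²`. -/
def normSqSobolev {n : ℕ} (Ω : Set (Cn n)) (t : ℝ) (k : ℕ) (f : Cn n → ℂ) : ℝ≥0∞ :=
  ∑ s ∈ Finset.range (k + 1), ∑ α ∈ Finset.piAntidiag Finset.univ s, normSqL2 Ω t (wXpow Ω t α f)

/-! ### `(0,q)`-forms -/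

/-- Increasing multi-indices of length `q`, as subsets of `{1, …, n}`. -/
abbrev MultiIdx (n q : ℕ) := {J : Finset (Fin n) // J.card = q}

/-- A `(0,q)`-form `∑_J u_J dz̄_J`, given by its coefficients. -/
abbrev Form (n q : ℕ) := MultiIdx n q → Cn n → ℂ

/-- `ε^{jI}_J`: the sign of the permutation that sorts `(j, I)` into `J` if `{j} ∪ I = J` with
`j ∉ I`, and `0` otherwise. -/
def eps {n : ℕ} (j : Fin n) (I J : Finset (Fin n)) : ℂ :=
  if j ∉ I ∧ insert j I = J then (-1) ^ (I.filter (fun i => i < j)).card else 0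

/-- `∂f/∂z̄_j`. -/
def dzbar {n : ℕ} (Ω : Set (Cn n)) (j : Fin n) (f : Cn n → ℂ) : Cn n → ℂ :=
  fun x => (1 / 2) * (weakDeriv Ω (j, 0) f x + Complex.I * weakDeriv Ω (j, 1) f x)

/-- `∂f/∂z_j`. -/
def dz {n : ℕ} (Ω : Set (Cn n)) (j : Fin n) (f : Cn n → ℂ) : Cn n → ℂ :=
  fun x => (1 / 2) * (weakDeriv Ω (j, 0) f x - Complex.I * weakDeriv Ω (j, 1) f x)

/-- `L_j^t = ∂/∂z_j - t z̄_j`. -/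
def wL {n : ℕ} (Ω : Set (Cn n)) (t : ℝ) (j : Fin n) (f : Cn n → ℂ) : Cn n → ℂ :=
  fun x => dz Ω j f x - (t : ℂ) * (starRingEnd ℂ) (zCoord j x) * f x

/-- `∂̄u = ∑_{J,K} ∑_j ε^{jJ}_K (∂u_J/∂z̄_j) dz̄_K`. -/
def dbar {n q : ℕ} (Ω : Set (Cn n)) (u : Form n q) : Form n (q + 1) :=
  fun K x => ∑ J : MultiIdx n q, ∑ j : Fin n, eps j J.1 K.1 * dzbar Ω j (u J) x

/-- `u_{jI} = ∑_J ε^{jI}_J u_J`. -/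
def contract {n q : ℕ} (u : Form n q) (j : Fin n) (I : Finset (Fin n)) : Cn n → ℂ :=
  fun x => ∑ J : MultiIdx n q, eps j I J.1 * u J x

/-- The formal adjoint `ϑ^t u = -∑_I ∑_j L_j^t u_{jI} dz̄_I` of `∂̄` in `L²(Ω, e^{-t|z|²})`.
No boundary condition is imposed.  For `q = 0` all `u_{jI}` vanish, so that `ϑ^t u = 0`. -/
def vartheta {n q : ℕ} (Ω : Set (Cn n)) (t : ℝ) (u : Form n q) : Form n (q - 1) :=
  fun I x => -∑ j : Fin n, wL Ω t j (contract u j I.1) x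

/-- `u ∈ H^k_{0,q}(Ω, e^{-t|z|²}, X^t)`. -/
def FormMemSobolev {n q : ℕ} (Ω : Set (Cn n)) (t : ℝ) (k : ℕ) (u : Form n q) : Prop :=
  ∀ J, MemSobolev Ω t k (u J)

/-- `‖u‖_{t,k,Ω}²` for a `(0,q)`-form. -/
def formNormSqSobolev {n q : ℕ} (Ω : Set (Cn n)) (t : ℝ) (k : ℕ) (u : Form n q) : ℝ≥0∞ :=
  ∑ J, normSqSobolev Ω t k (u J)

/-! ### Domains -/

/-- `ρ` is a uniformly `C^m` defining function for `Ω`, with `U` the neighbourhood of the boundary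
on which the uniform bounds hold. -/
structure IsUniformDefiningFunction {n : ℕ} (Ω : Set (Cn n)) (m : ℕ) (ρ : Cn n → ℝ)
    (U : Set (Cn n)) : Prop where
  neg_iff : ∀ x, ρ x < 0 ↔ x ∈ Ω
  zero_iff : ∀ x, ρ x = 0 ↔ x ∈ frontier Ω
  isOpen : IsOpen U
  frontier_subset : frontier Ω ⊆ U
  dist_pos : ∃ d : ℝ, 0 < d ∧ ∀ x ∈ frontier Ω, ∀ y ∈ frontier U, d ≤ dist x y
  contDiffOn : ContDiffOn ℝ m ρ U
  bounded : ∃ M : ℝ, ∀ i ≤ m, ∀ x ∈ U, ‖iteratedFDeriv ℝ i ρ x‖ ≤ M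
  grad_pos : ∃ c : ℝ, 0 < c ∧ ∀ x ∈ U, c ≤ ‖fderiv ℝ ρ x‖

/-- `Ω` (with defining function `ρ`) is asymptotically non-radial: the normal direction is bounded
away from the radial direction at the boundary points far from the origin,
`inf_{r>0} sup_{|x|>r, x ∈ bΩ} |x · ∇ρ| / (|x| |∇ρ|) < 1`.  Here `fderiv ℝ ρ x x = x · ∇ρ(x)`.
The quotient does not depend on the choice of the defining function, and the condition is void for
bounded `Ω`. -/
def AsymptoticallyNonradial {n : ℕ} (Ω : Set (Cn n)) (ρ : Cn n → ℝ) : Prop :=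
  ∃ r : ℝ, 0 < r ∧ ∃ c : ℝ, c < 1 ∧
    ∀ x ∈ frontier Ω, r < ‖x‖ → |fderiv ℝ ρ x x| ≤ c * (‖x‖ * ‖fderiv ℝ ρ x‖)

/-! ### Tangential derivatives -/

/-- The finite family `T` of real vector fields is a global tangential gradient `∇_T` on `Ω`, with
uniformly `C^p` coefficients: on a uniform neighbourhood of the boundary all `T i` are tangential
(`T i ρ = 0`), on a (possibly larger) uniform neighbourhood, compactly inside `U` in the uniform
sense, they span the tangential directions, and away from it they span all directions, with uniform
constants. -/
structure IsTangentialGradient {n : ℕ} {ι : Type*} [Fintype ι] (Ω : Set (Cn n)) (p : ℕ)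
    (ρ : Cn n → ℝ) (U : Set (Cn n)) (T : ι → Cn n → Cn n) : Prop where
  contDiffOn : ∀ i, ContDiffOn ℝ p (T i) Ω
  bounded : ∃ M : ℝ, ∀ i, ∀ s ≤ p, ∀ x ∈ Ω, ‖iteratedFDeriv ℝ s (T i) x‖ ≤ M
  tangential_span : ∃ ε₁ ε₂ r c : ℝ, 0 < ε₁ ∧ ε₁ ≤ ε₂ ∧ ε₂ < r ∧ 0 < c ∧
    Metric.thickening r (frontier Ω) ⊆ U ∧
    (∀ x ∈ Ω ∩ Metric.thickening ε₁ (frontier Ω), ∀ i, fderiv ℝ ρ x (T i x) = 0) ∧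
    (∀ x ∈ Ω ∩ Metric.thickening ε₂ (frontier Ω), ∀ ξ : Cn n, fderiv ℝ ρ x ξ = 0 →
      c * ‖ξ‖ ^ 2 ≤ ∑ i, (inner ℝ (T i x) ξ) ^ 2) ∧
    (∀ x ∈ Ω \ Metric.thickening ε₂ (frontier Ω), ∀ ξ : Cn n,
      c * ‖ξ‖ ^ 2 ≤ ∑ i, (inner ℝ (T i x) ξ) ^ 2)

/-- The weighted operator `T^t = T - t T(|z|²) = ∑_l a_l X_l^t` of the real vector field
`T = ∑_l a_l ∂/∂x_l`. -/
def wT {n : ℕ} (Ω : Set (Cn n)) (t : ℝ) (a : Cn n → Cn n) (f : Cn n → ℂ) : Cn n → ℂ :=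
  fun x => ∑ l : Fin n × Fin 2, (a x l : ℂ) * wX Ω t l f x

/-- `‖(∇_T^t)^k f‖_t²`: the sum of `‖T^t_{i_k} ⋯ T^t_{i_1} f‖_t²` over all `i_1, …, i_k`. -/
def normSqTangential {n : ℕ} {ι : Type*} [Fintype ι] (Ω : Set (Cn n)) (t : ℝ)
    (T : ι → Cn n → Cn n) : ℕ → (Cn n → ℂ) → ℝ≥0∞
  | 0, f => normSqL2 Ω t f
  | k + 1, f => ∑ i, normSqTangential Ω t T k (wT Ω t (T i) f)

/-- `‖(∇_T^t)^k u‖_t²` for a `(0,q)`-form, `∇_T^t` acting on coefficients. -/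
def formNormSqTangential {n q : ℕ} {ι : Type*} [Fintype ι] (Ω : Set (Cn n)) (t : ℝ)
    (T : ι → Cn n → Cn n) (k : ℕ) (u : Form n q) : ℝ≥0∞ :=
  ∑ J, normSqTangential Ω t T k (u J)

end WeightedDbar

end

namespace WeightedDbar

open Filter Topology Metric
open scoped Convolution

/-! Put `L_j = (X_{j,0} - i X_{j,1}) / 2` and `∂̄_j = (X_{j,0} + i X_{j,1}) / 2 + t z_j`. In this
form `(∂̄, ϑ^t)` is a first order system in the commuting operators `X_l` with constant
coefficients, apart from zero order terms `t x_l`. Its commutator with `X_m` is therefore of order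
zero, and `[T^t, X_m]` is of order one with bounded coefficients free of `t`. So the case `k = 1`
applied to `X_m v`, and then to `T_i^t v`, climbs to every order (`famNormSq_succ_le`,
`famNormSq_le_tangential`), and all commutators go into the term of order `k - 1`. What remains is
`k = 1`, where the difficulty is the unbounded factor `t x`.

Near the boundary the argument is ellipticity. The symbol identity `sum_norm_raise_lower_rankOne`
recovers the normal derivative from `∂̄v`, `ϑ^t v` and tangential derivatives, up to an error `t |x|
|v|` (`exists_boundary_pointwise`). To bound that error, integrate the divergence of `e^{-t|x|²} β
⟨T,x⟩ |v|² T`, multiplied by `t`. No boundary term appears, since `T` is tangential, and the weight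
produces `t² ⟨T,x⟩² |v|²` with the good sign. Asymptotic non-radiality gives `∑ ⟨T_i,x⟩² ≥ c |x|²`
far out (`exists_boundary_neighborhood`), and Young's inequality absorbs the rest
(`lintegral_radial_le`, `lintegral_boundary_radial_le`).

In the interior the form can be cut off to compact support, and the Kohn–Morrey–Hörmander identity
(`kohn_morrey`) bounds every `∂̄_j v_J` and `L_j v_J` up to `|t| ‖v‖²`. The factor `t x` is then
removed algebraically: with `A_j` the complex components of a field `T`, `∑ (A_j L_j + Ā_j ∂̄_j) -
T^t = t ∑ Ā_j z_j`, and the last sum has squared modulus `⟨T,x⟩² + ⟨T,ix⟩²` (`radial_le_wirtinger`).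
Summed over the fields this is at least `c |x|²` everywhere, even at radial normals, because the
complex line through `x` always contains a vector of length `|x|` in the kernel of `dρ`
(`IsTangentialGradient.exists_radial_bound`).

Density of smooth forms is never used. Integrations by parts are done on compactly supported `H¹`
functions, through the continuity of translations in `L²`. Unboundedness of `Ω`, and the approach to
the boundary, are handled by exhausting cut-offs and Fatou's lemma. -/

/-- The partial derivative `∂φ/∂x_l`. -/
noncomputable abbrev pd {n : ℕ} {F : Type*} [NormedAddCommGroup F] [NormedSpace ℝ F] (l : Fin n × Fin 2)
    (φ : Cn n → F) (x : Cn n) : F := fderiv ℝ φ x (EuclideanSpace.single l 1)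

/-! ### Enlarging the class of test functions by mollification. -/

section Mollify

variable {n : ℕ} {Ω : Set (Cn n)}

/-- Convolution with bumps of radius tending to zero. The common compact support and the common
bound are what dominated convergence needs in `HasWeakDeriv.integral_c1`. -/
theorem exists_smooth_approx (hΩ : IsOpen Ω) {φ : Cn n → ℝ} (hφ : ContDiff ℝ 1 φ)
    (hc : HasCompactSupport φ) (hs : tsupport φ ⊆ Ω) (l : Fin n × Fin 2) :
    ∃ (ψ : ℕ → Cn n → ℝ) (K : Set (Cn n)) (B : ℝ), IsCompact K ∧ K ⊆ Ω ∧
      (∀ i, ContDiff ℝ ∞ (ψ i)) ∧ (∀ i, HasCompactSupport (ψ i)) ∧ (∀ i, tsupport (ψ i) ⊆ K) ∧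
      (∀ x, Tendsto (fun i => ψ i x) atTop (𝓝 (φ x))) ∧
      (∀ x, Tendsto (fun i => pd l (ψ i) x) atTop (𝓝 (pd l φ x))) ∧
      (∀ i x, |ψ i x| ≤ B) ∧ (∀ i x, |pd l (ψ i) x| ≤ B) := by
  obtain ⟨δ, hδ, hK⟩ := hc.isCompact.exists_cthickening_subset_open hΩ hs
  let b : ℕ → ContDiffBump (0 : Cn n) := fun i =>
    ⟨δ / (2 * ((i : ℝ) + 2)), δ / ((i : ℝ) + 2), by positivity, by
      apply div_lt_div_of_pos_left hδ (by positivity); linarith [(Nat.cast_nonneg i : (0 : ℝ) ≤ i)]⟩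
  have hb : Tendsto (fun i => (b i).rOut) atTop (𝓝 0) := by
    change Tendsto (fun i : ℕ => δ / ((i : ℝ) + 2)) atTop (𝓝 0)
    apply Tendsto.div_atTop tendsto_const_nhds
    exact tendsto_atTop_add_const_right _ _ tendsto_natCast_atTop_atTop
  have hbδ : ∀ i, (b i).rOut ≤ δ := fun i => by
    change δ / ((i : ℝ) + 2) ≤ δ
    exact div_le_self hδ.le (by linarith [(Nat.cast_nonneg i : (0 : ℝ) ≤ i)])
  have hcd : Continuous (pd l φ) := (hφ.continuous_fderiv one_ne_zero).clm_apply continuous_const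
  obtain ⟨B₁, hB₁⟩ : ∃ B, ∀ x, ‖φ x‖ ≤ B := hc.exists_bound_of_continuous hφ.continuous
  have hcpd : HasCompactSupport (pd l φ) := hc.fderiv_apply (𝕜 := ℝ) _
  obtain ⟨B₂, hB₂⟩ : ∃ B, ∀ x, ‖pd l φ x‖ ≤ B := hcpd.exists_bound_of_continuous hcd
  let ψ : ℕ → Cn n → ℝ := fun i => (b i).normed volume ⋆[ContinuousLinearMap.lsmul ℝ ℝ, volume] φ
  have hpd : ∀ i x, pd l (ψ i) x =
      ((b i).normed volume ⋆[ContinuousLinearMap.lsmul ℝ ℝ, volume] (pd l φ)) x := by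
    intro i x
    have hbi : LocallyIntegrable ((b i).normed volume) volume :=
      Continuous.locallyIntegrable (b i).continuous_normed
    have h := hc.hasFDerivAt_convolution_right (ContinuousLinearMap.lsmul ℝ ℝ) hbi hφ x
    change fderiv ℝ (ψ i) x _ = _
    rw [h.fderiv]
    exact convolution_precompR_apply _ hbi (hc.fderiv ℝ) (hφ.continuous_fderiv one_ne_zero) x _
  -- An average of `g` differs from `g x` by at most `2 * B`, hence the crude factor 3.
  have hbd : ∀ (g : Cn n → ℝ) (B : ℝ), Continuous g → (∀ x, ‖g x‖ ≤ B) → ∀ i x,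
      |((b i).normed volume ⋆[ContinuousLinearMap.lsmul ℝ ℝ, volume] g) x| ≤ 3 * B := by
    intro g B hg hB i x
    have h := (b i).dist_normed_convolution_le (μ := volume) (x₀ := x) (g := g) (ε := 2 * B)
      hg.aestronglyMeasurable (fun y _ => by
        rw [dist_eq_norm]; linarith [norm_sub_le (g y) (g x), hB x, hB y])
    rw [dist_eq_norm] at h
    have := hB x
    rw [← Real.norm_eq_abs]
    have h3 := norm_le_norm_add_norm_sub'
      (((b i).normed volume ⋆[ContinuousLinearMap.lsmul ℝ ℝ, volume] g) x) (g x)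
    linarith
  have hsupp : ∀ i, tsupport (ψ i) ⊆ cthickening δ (tsupport φ) := by
    intro i
    apply closure_minimal _ isClosed_cthickening
    refine (support_convolution_subset _).trans ?_
    rw [(b i).support_normed_eq]
    rintro x ⟨y, hy, z, hz, rfl⟩
    apply mem_cthickening_of_dist_le _ z _ _ (subset_tsupport _ hz)
    rw [mem_ball_zero_iff] at hy
    simpa using hy.le.trans (hbδ i)
  refine ⟨ψ, cthickening δ (tsupport φ), max (3 * B₁) (3 * B₂), hc.isCompact.cthickening, hK,
    fun i => ?_, fun i => ?_, hsupp, fun x => ?_, fun x => ?_, fun i x => ?_, fun i x => ?_⟩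
  · exact (b i).hasCompactSupport_normed.contDiff_convolution_left _ (b i).contDiff_normed
      hφ.continuous.locallyIntegrable
  · exact hc.isCompact.cthickening.of_isClosed_subset (isClosed_tsupport _) (hsupp i)
  · exact ContDiffBump.convolution_tendsto_right_of_continuous hb hφ.continuous x
  · simp only [hpd]
    exact ContDiffBump.convolution_tendsto_right_of_continuous hb hcd x
  · exact (hbd φ B₁ hφ.continuous hB₁ i x).trans (le_max_left _ _)
  · rw [hpd]; exact (hbd _ B₂ hcd hB₂ i x).trans (le_max_right _ _)

theorem integrableOn_smul_of_hasCompactSupport {F : Type*} [NormedAddCommGroup F] [NormedSpace ℝ F]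
    {f : Cn n → F} (hf : LocallyIntegrableOn f Ω)
    {φ : Cn n → ℝ} (hφ : Continuous φ) (hc : HasCompactSupport φ) (hs : tsupport φ ⊆ Ω) :
    IntegrableOn (fun x => φ x • f x) Ω := by
  have h1 : IntegrableOn (fun x => φ x • f x) (tsupport φ) :=
    (hf.integrableOn_compact_subset hs hc.isCompact).continuousOn_smul hφ.continuousOn hc.isCompact
  have h2 : Integrable (fun x => φ x • f x) := by
    rw [integrableOn_iff_integrable_of_support_subset] at h1
    · exact h1
    · intro x hx
      exact subset_tsupport _ fun h => hx (by simp [h])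
  exact h2.integrableOn

theorem integrableOn_mul_of_hasCompactSupport {f : Cn n → ℂ} (hf : LocallyIntegrableOn f Ω)
    {φ : Cn n → ℂ} (hφ : ContinuousOn φ Ω) (hc : HasCompactSupport φ) (hs : tsupport φ ⊆ Ω) :
    Integrable (fun x => φ x * f x) := by
  have h1 : IntegrableOn (fun x => φ x * f x) (tsupport φ) :=
    (hf.integrableOn_compact_subset hs hc.isCompact).continuousOn_mul (hφ.mono hs) hc.isCompact
  rw [integrableOn_iff_integrable_of_support_subset] at h1
  · exact h1
  · intro x hx
    exact subset_tsupport _ fun h => hx (by simp [h])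

variable {l : Fin n × Fin 2} {f g : Cn n → ℂ}

/-- Needed for the product rule, where the test function is multiplied by a coefficient that is only
`C¹`. -/
theorem HasWeakDeriv.integral_c1 (hΩ : IsOpen Ω) (h : HasWeakDeriv Ω l f g) {φ : Cn n → ℝ}
    (hφ : ContDiff ℝ 1 φ) (hc : HasCompactSupport φ) (hs : tsupport φ ⊆ Ω) :
    ∫ x in Ω, pd l φ x • f x = -∫ x in Ω, φ x • g x := by
  obtain ⟨ψ, K, B, hK, hKΩ, hψ, hψc, hψK, h1, h2, h3, h4⟩ := exists_smooth_approx hΩ hφ hc hs l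
  have key : ∀ (u : Cn n → ℂ) (η : ℕ → Cn n → ℝ) (η' : Cn n → ℝ), LocallyIntegrableOn u Ω →
      (∀ i, Continuous (η i)) → (∀ i, tsupport (η i) ⊆ K) → (∀ i x, |η i x| ≤ B) →
      (∀ x, Tendsto (fun i => η i x) atTop (𝓝 (η' x))) →
      Tendsto (fun i => ∫ x in Ω, η i x • u x) atTop (𝓝 (∫ x in Ω, η' x • u x)) := by
    intro u η η' hu hη hηK hηB hηl
    apply tendsto_integral_of_dominated_convergence (fun x => K.indicator (fun x => B * ‖u x‖) x)
    · intro i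
      exact (integrableOn_smul_of_hasCompactSupport hu (hη i)
        (hK.of_isClosed_subset (isClosed_tsupport _) (hηK i)) ((hηK i).trans hKΩ)).1
    · apply Integrable.integrableOn
      rw [integrable_indicator_iff hK.measurableSet]
      exact ((hu.integrableOn_compact_subset hKΩ hK).norm).const_mul B
    · intro i
      refine Eventually.of_forall fun x => ?_
      by_cases hx : x ∈ K
      · rw [indicator_of_mem hx, norm_smul]
        exact mul_le_mul_of_nonneg_right (hηB i x) (norm_nonneg _)
      · have : η i x = 0 := image_eq_zero_of_notMem_tsupport fun h => hx (hηK i h)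
        simp [this, hx]
    · refine Eventually.of_forall fun x => (hηl x).smul_const _
  have l1 := key f (fun i => pd l (ψ i)) (pd l φ) h.1
    (fun i => ((hψ i).continuous_fderiv (by simp)).clm_apply continuous_const)
    (fun i => (tsupport_fderiv_apply_subset ℝ _).trans (hψK i)) h4 h2
  have l2 := (key g ψ φ h.2.1 (fun i => (hψ i).continuous) hψK h3 h1).neg
  refine tendsto_nhds_unique l1 (l2.congr fun i => ?_)
  exact (h.2.2 (ψ i) (hψ i) (hψc i) ((hψK i).trans hKΩ)).symm

/-- The defining identity of a weak derivative holds for complex `C¹` test functions. -/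
theorem HasWeakDeriv.integral_test (hΩ : IsOpen Ω) (h : HasWeakDeriv Ω l f g) {φ : Cn n → ℂ}
    (hφ : ContDiff ℝ 1 φ) (hc : HasCompactSupport φ) (hs : tsupport φ ⊆ Ω) :
    ∫ x, pd l φ x * f x = -∫ x, φ x * g x := by
  have hpc : HasCompactSupport (pd l φ) := hc.fderiv_apply (𝕜 := ℝ) _
  have hps : tsupport (pd l φ) ⊆ Ω := (tsupport_fderiv_apply_subset ℝ _).trans hs
  have hre := h.integral_c1 hΩ (φ := fun x => (φ x).re) (Complex.reCLM.contDiff.comp hφ)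
    (hc.comp_left (g := Complex.re) rfl) ((tsupport_comp_subset (g := Complex.re) rfl φ).trans hs)
  have him := h.integral_c1 hΩ (φ := fun x => (φ x).im) (Complex.imCLM.contDiff.comp hφ)
    (hc.comp_left (g := Complex.im) rfl) ((tsupport_comp_subset (g := Complex.im) rfl φ).trans hs)
  have dre : ∀ x, pd l (fun x => (φ x).re) x = (pd l φ x).re := fun x => by
    have := (Complex.reCLM.hasFDerivAt.comp x ((hφ.differentiable one_ne_zero) x).hasFDerivAt)
    change fderiv ℝ (⇑Complex.reCLM ∘ φ) x _ = _
    rw [this.fderiv]; rfl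
  have dim : ∀ x, pd l (fun x => (φ x).im) x = (pd l φ x).im := fun x => by
    have := (Complex.imCLM.hasFDerivAt.comp x ((hφ.differentiable one_ne_zero) x).hasFDerivAt)
    change fderiv ℝ (⇑Complex.imCLM ∘ φ) x _ = _
    rw [this.fderiv]; rfl
  have split : ∀ (η u : Cn n → ℂ), LocallyIntegrableOn u Ω → Continuous η → HasCompactSupport η →
      tsupport η ⊆ Ω → ∫ x, η x * u x =
        (∫ x in Ω, (η x).re • u x) + Complex.I * ∫ x in Ω, (η x).im • u x := by
    intro η u hu hη hηc hηs
    rw [← integral_const_mul, ← integral_add, setIntegral_eq_integral_of_forall_compl_eq_zero]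
    · congr 1; ext x
      conv_lhs => rw [← Complex.re_add_im (η x)]
      simp only [Complex.real_smul]; ring
    · intro x hx
      have : η x = 0 := image_eq_zero_of_notMem_tsupport fun h => hx (hηs h)
      simp [this]
    · exact integrableOn_smul_of_hasCompactSupport hu (Complex.continuous_re.comp hη)
        (hηc.comp_left (g := Complex.re) rfl)
        ((tsupport_comp_subset (g := Complex.re) rfl η).trans hηs)
    · exact (integrableOn_smul_of_hasCompactSupport hu (Complex.continuous_im.comp hη)
        (hηc.comp_left (g := Complex.im) rfl)
        ((tsupport_comp_subset (g := Complex.im) rfl η).trans hηs)).const_mul _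
  rw [split _ f h.1 ((hφ.continuous_fderiv one_ne_zero).clm_apply continuous_const) hpc hps,
    split _ g h.2.1 hφ.continuous hc hs]
  simp only [dre] at hre
  simp only [dim] at him
  rw [hre, him]; ring

theorem hasWeakDeriv_of_complex (hf : LocallyIntegrableOn f Ω) (hg : LocallyIntegrableOn g Ω)
    (h : ∀ φ : Cn n → ℂ, ContDiff ℝ ∞ φ → HasCompactSupport φ → tsupport φ ⊆ Ω →
      ∫ x, pd l φ x * f x = -∫ x, φ x * g x) : HasWeakDeriv Ω l f g := by
  refine ⟨hf, hg, fun φ hφ hc hs => ?_⟩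
  have := h (fun x => (φ x : ℂ)) (Complex.ofRealCLM.contDiff.comp hφ)
    (hc.comp_left (g := Complex.ofReal) rfl)
    ((tsupport_comp_subset (g := Complex.ofReal) rfl φ).trans hs)
  have d : ∀ x, pd l (fun x => (φ x : ℂ)) x = ((pd l φ x : ℝ) : ℂ) := fun x => by
    have := (Complex.ofRealCLM.hasFDerivAt.comp x
      ((hφ.differentiable (by simp)) x).hasFDerivAt)
    change fderiv ℝ (⇑Complex.ofRealCLM ∘ φ) x _ = _
    rw [this.fderiv]; rfl
  simp only [d] at this
  rw [setIntegral_eq_integral_of_forall_compl_eq_zero,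
    setIntegral_eq_integral_of_forall_compl_eq_zero]
  · simpa only [Complex.real_smul] using this
  · intro x hx
    have : φ x = 0 := image_eq_zero_of_notMem_tsupport fun h => hx (hs h)
    simp [this]
  · intro x hx
    have : pd l φ x = 0 := image_eq_zero_of_notMem_tsupport (f := pd l φ) fun h =>
      hx (hs (tsupport_fderiv_apply_subset (f := φ) ℝ _ h))
    rw [show fderiv ℝ φ x (EuclideanSpace.single l 1) = 0 from this, zero_smul]

end Mollify

/-! ### Calculus of weak derivatives. -/

section WeakDeriv

variable {n : ℕ} {Ω : Set (Cn n)} {l m : Fin n × Fin 2} {f f' g g' h : Cn n → ℂ}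

theorem contDiff_of_tsupport_subset {E F : Type*} [NormedAddCommGroup E] [NormedSpace ℝ E]
    [NormedAddCommGroup F] [NormedSpace ℝ F] {V : Set E} (hV : IsOpen V) {k : ℕ∞ω} {φ : E → F}
    (hφ : ContDiffOn ℝ k φ V) (hs : tsupport φ ⊆ V) : ContDiff ℝ k φ := by
  rw [contDiff_iff_contDiffAt]
  intro x
  by_cases hx : x ∈ tsupport φ
  · exact hφ.contDiffAt (hV.mem_nhds (hs hx))
  · exact (contDiffAt_const (c := (0 : F))).congr_of_eventuallyEq
      (notMem_tsupport_iff_eventuallyEq.1 hx)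

/-- The fundamental lemma of the calculus of variations, applied to the difference. It makes the
chosen `weakDeriv` meaningful up to null sets. -/
theorem HasWeakDeriv.ae_eq (hΩ : IsOpen Ω) (h₁ : HasWeakDeriv Ω l f g)
    (h₂ : HasWeakDeriv Ω l f g') : g =ᵐ[volume.restrict Ω] g' := by
  have := hΩ.ae_eq_zero_of_integral_contDiff_smul_eq_zero (h₁.2.1.sub h₂.2.1) ?_
  · rw [EventuallyEq, ae_restrict_iff' hΩ.measurableSet]
    filter_upwards [this] with x hx hxΩ
    exact sub_eq_zero.1 (hx hxΩ)
  · intro φ hφ hc hs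
    have e₁ := h₁.2.2 φ hφ hc hs
    have e₂ := h₂.2.2 φ hφ hc hs
    rw [← setIntegral_eq_integral_of_forall_compl_eq_zero (s := Ω)]
    · simp only [Pi.sub_apply, smul_sub]
      rw [integral_sub (integrableOn_smul_of_hasCompactSupport h₁.2.1 hφ.continuous hc hs)
        (integrableOn_smul_of_hasCompactSupport h₂.2.1 hφ.continuous hc hs), sub_eq_zero]
      exact neg_injective (e₁.symm.trans e₂)
    · intro x hx
      have : φ x = 0 := image_eq_zero_of_notMem_tsupport fun h => hx (hs h)
      simp [this]

theorem HasWeakDeriv.congr (h : HasWeakDeriv Ω l f g) (hf : f =ᵐ[volume.restrict Ω] f')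
    (hg : g =ᵐ[volume.restrict Ω] g') : HasWeakDeriv Ω l f' g' := by
  refine ⟨h.1.congr hf, h.2.1.congr hg, fun φ hφ hc hs => ?_⟩
  have e1 : ∫ x in Ω, fderiv ℝ φ x (EuclideanSpace.single l 1) • f' x =
      ∫ x in Ω, fderiv ℝ φ x (EuclideanSpace.single l 1) • f x :=
    integral_congr_ae (hf.mono fun x hx => by simp only [hx])
  have e2 : ∫ x in Ω, φ x • g' x = ∫ x in Ω, φ x • g x :=
    integral_congr_ae (hg.mono fun x hx => by simp only [hx])
  rw [e1, e2]
  exact h.2.2 φ hφ hc hs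

theorem hasWeakDeriv_weakDeriv (h : ∃ g, HasWeakDeriv Ω l f g) :
    HasWeakDeriv Ω l f (weakDeriv Ω l f) := by
  rw [weakDeriv, dif_pos h]; exact h.choose_spec

theorem HasWeakDeriv.weakDeriv_ae_eq (hΩ : IsOpen Ω) (h : HasWeakDeriv Ω l f g) :
    weakDeriv Ω l f =ᵐ[volume.restrict Ω] g :=
  (hasWeakDeriv_weakDeriv ⟨g, h⟩).ae_eq hΩ h

theorem HasWeakDeriv.add (h₁ : HasWeakDeriv Ω l f g) (h₂ : HasWeakDeriv Ω l f' g') :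
    HasWeakDeriv Ω l (fun x => f x + f' x) (fun x => g x + g' x) := by
  refine ⟨h₁.1.add h₂.1, h₁.2.1.add h₂.2.1, fun φ hφ hc hs => ?_⟩
  have hd : Continuous (fun x => fderiv ℝ φ x (EuclideanSpace.single l 1)) :=
    (hφ.continuous_fderiv (by simp)).clm_apply continuous_const
  have hdc : HasCompactSupport (fun x => fderiv ℝ φ x (EuclideanSpace.single l 1)) :=
    hc.fderiv_apply (𝕜 := ℝ) _
  have hds : tsupport (fun x => fderiv ℝ φ x (EuclideanSpace.single l 1)) ⊆ Ω :=
    (tsupport_fderiv_apply_subset ℝ _).trans hs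
  simp only [smul_add]
  rw [integral_add (integrableOn_smul_of_hasCompactSupport h₁.1 hd hdc hds)
    (integrableOn_smul_of_hasCompactSupport h₂.1 hd hdc hds),
    integral_add (integrableOn_smul_of_hasCompactSupport h₁.2.1 hφ.continuous hc hs)
    (integrableOn_smul_of_hasCompactSupport h₂.2.1 hφ.continuous hc hs),
    h₁.2.2 φ hφ hc hs, h₂.2.2 φ hφ hc hs, neg_add]

theorem hasWeakDeriv_zero : HasWeakDeriv Ω l (fun _ => 0) (fun _ => 0) :=
  ⟨locallyIntegrableOn_zero, locallyIntegrableOn_zero, fun φ _ _ _ => by simp⟩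

theorem HasWeakDeriv.sum {κ : Type*} (s : Finset κ) {F G : κ → Cn n → ℂ}
    (h : ∀ i ∈ s, HasWeakDeriv Ω l (F i) (G i)) :
    HasWeakDeriv Ω l (fun x => ∑ i ∈ s, F i x) (fun x => ∑ i ∈ s, G i x) := by
  classical
  induction s using Finset.induction_on with
  | empty => simpa using hasWeakDeriv_zero
  | insert a s ha ih =>
    simp only [Finset.sum_insert ha]
    exact (h a (Finset.mem_insert_self a s)).add
      (ih fun i hi => h i (Finset.mem_insert_of_mem hi))

theorem LocallyIntegrableOn.mul_of_continuousOn (hΩ : IsOpen Ω) (hf : LocallyIntegrableOn f Ω)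
    {b : Cn n → ℂ} (hb : ContinuousOn b Ω) : LocallyIntegrableOn (fun x => b x * f x) Ω := by
  rw [locallyIntegrableOn_iff hΩ.isLocallyClosed] at hf ⊢
  exact fun K hK hKc => (hf K hK hKc).continuousOn_mul (hb.mono hK) hKc

/-- The product rule for weak derivatives. -/
theorem HasWeakDeriv.mul (hΩ : IsOpen Ω) (h : HasWeakDeriv Ω l f g) {b : Cn n → ℂ}
    (hb : ContDiffOn ℝ 1 b Ω) :
    HasWeakDeriv Ω l (fun x => b x * f x) (fun x => b x * g x + pd l b x * f x) := by
  have hbd : ContinuousOn (pd l b) Ω :=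
    (hb.continuousOn_fderiv_of_isOpen hΩ le_rfl).clm_apply continuousOn_const
  have l1 := LocallyIntegrableOn.mul_of_continuousOn hΩ h.1 hb.continuousOn
  have l2 := LocallyIntegrableOn.mul_of_continuousOn hΩ h.2.1 hb.continuousOn
  have l3 := LocallyIntegrableOn.mul_of_continuousOn hΩ h.1 hbd
  refine hasWeakDeriv_of_complex l1 (l2.add l3) fun φ hφ hc hs => ?_
  have hts : tsupport (fun x => φ x * b x) ⊆ tsupport φ := tsupport_mul_subset_left
  have hφb : ContDiff ℝ 1 (fun x => φ x * b x) := contDiff_of_tsupport_subset hΩ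
    ((hφ.of_le (by simp)).contDiffOn.mul hb) (hts.trans hs)
  have key := h.integral_test hΩ hφb (hc.mul_right) (hts.trans hs)
  have hpd : ∀ x ∈ Ω, pd l (fun x => φ x * b x) x = φ x * pd l b x + pd l φ x * b x := by
    intro x hx
    have hb' : DifferentiableAt ℝ b x :=
      (hb.differentiableOn one_ne_zero).differentiableAt (hΩ.mem_nhds hx)
    have := (((hφ.differentiable (by simp)) x).hasFDerivAt.mul hb'.hasFDerivAt)
    change fderiv ℝ (φ * b) x _ = _
    rw [this.fderiv]
    simp [mul_comm]
  have hdc : HasCompactSupport (pd l φ) := hc.fderiv_apply (𝕜 := ℝ) _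
  have hds : tsupport (pd l φ) ⊆ Ω := (tsupport_fderiv_apply_subset ℝ _).trans hs
  have hdcont : Continuous (pd l φ) := (hφ.continuous_fderiv (by simp)).clm_apply continuous_const
  have e1 : ∀ x, pd l (fun x => φ x * b x) x * f x
      = pd l φ x * (b x * f x) + φ x * (pd l b x * f x) := by
    intro x
    by_cases hx : x ∈ Ω
    · rw [hpd x hx]; ring
    · have h0 : φ x = 0 := image_eq_zero_of_notMem_tsupport fun h => hx (hs h)
      have h1 : pd l φ x = 0 := image_eq_zero_of_notMem_tsupport fun h => hx (hds h)
      have h2 : pd l (fun x => φ x * b x) x = 0 :=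
        image_eq_zero_of_notMem_tsupport (f := pd l (fun x => φ x * b x)) fun h =>
          hx (hs (hts (tsupport_fderiv_apply_subset (f := fun x => φ x * b x) ℝ _ h)))
      rw [h0, h1, h2]; ring
  simp only [e1] at key
  have i1 := integrableOn_mul_of_hasCompactSupport l1 hdcont.continuousOn hdc hds
  have i2 := integrableOn_mul_of_hasCompactSupport l2 hφ.continuous.continuousOn hc hs
  have i3 := integrableOn_mul_of_hasCompactSupport l3 hφ.continuous.continuousOn hc hs
  rw [integral_add i1 i3] at key
  simp only [mul_add]
  rw [integral_add i2 i3, neg_add, eq_sub_of_add_eq key, sub_eq_add_neg]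
  simp only [mul_assoc]

theorem HasWeakDeriv.const_mul (hΩ : IsOpen Ω) (h : HasWeakDeriv Ω l f g) (c : ℂ) :
    HasWeakDeriv Ω l (fun x => c * f x) (fun x => c * g x) := by
  simpa [pd] using h.mul hΩ (b := fun _ => c) contDiffOn_const

theorem pd_comm {φ : Cn n → ℂ} (hφ : ContDiff ℝ ∞ φ) (x : Cn n) :
    pd l (pd m φ) x = pd m (pd l φ) x := by
  have hd : DifferentiableAt ℝ (fderiv ℝ φ) x :=
    ((hφ.fderiv_right (m := ∞) (by simp)).differentiable (by simp)) x
  have key : ∀ a b : Fin n × Fin 2, pd a (pd b φ) x =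
      fderiv ℝ (fderiv ℝ φ) x (EuclideanSpace.single a 1) (EuclideanSpace.single b 1) := by
    intro a b
    have := hd.hasFDerivAt.clm_apply (hasFDerivAt_const (EuclideanSpace.single b (1 : ℝ)) x)
    change fderiv ℝ (fun y => fderiv ℝ φ y (EuclideanSpace.single b 1)) x _ = _
    rw [this.fderiv]; simp
  rw [key, key]
  exact (hφ.contDiffAt.isSymmSndFDerivAt (by
    rw [minSmoothness_of_isRCLikeNormedField]; exact WithTop.coe_le_coe.2 le_top)) _ _

/-- Weak derivatives commute. -/
theorem HasWeakDeriv.comm (hΩ : IsOpen Ω) (h₁ : HasWeakDeriv Ω l f g) (h₂ : HasWeakDeriv Ω m f h)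
    (h₃ : HasWeakDeriv Ω m g g') : HasWeakDeriv Ω l h g' := by
  refine hasWeakDeriv_of_complex h₂.2.1 h₃.2.1 fun φ hφ hc hs => ?_
  have hpd : ∀ a, ContDiff ℝ ∞ (pd a φ) := fun a =>
    (hφ.fderiv_right (m := ∞) (by simp)).clm_apply contDiff_const
  have hpc : ∀ a, HasCompactSupport (pd a φ) := fun a => hc.fderiv_apply (𝕜 := ℝ) _
  have hps : ∀ a, tsupport (pd a φ) ⊆ Ω := fun a => (tsupport_fderiv_apply_subset ℝ _).trans hs
  -- Test `∂_l f` with `∂_m φ` and `∂_m f` with `∂_l φ`; the symmetry of the second derivatives of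
  -- `φ` links the two.
  have e1 := h₁.integral_test hΩ ((hpd m).of_le (by simp)) (hpc m) (hps m)
  have e2 := h₂.integral_test hΩ ((hpd l).of_le (by simp)) (hpc l) (hps l)
  have e3 := h₃.integral_test hΩ (hφ.of_le (by simp)) hc hs
  simp only [pd_comm hφ] at e1
  rw [← neg_inj, ← e2, ← e3, e1]

end WeakDeriv

/-! ### Integration by parts for compactly supported `H¹` functions. -/

section Bilinear

variable {n : ℕ}

/-- A compactly supported function of class `H¹` on `ℝᴺ`, with its weak gradient. -/
structure CompactH1 (F : Cn n → ℂ) (DF : Fin n × Fin 2 → Cn n → ℂ) : Prop where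
  memLp : MemLp F 2 volume
  memLp_deriv : ∀ l, MemLp (DF l) 2 volume
  compact : HasCompactSupport F
  compact_deriv : ∀ l, HasCompactSupport (DF l)
  weak : ∀ l, ∀ φ : Cn n → ℂ, ContDiff ℝ ∞ φ → ∫ x, pd l φ x * F x = -∫ x, φ x * DF l x

theorem integrable_mul_of_memLp_two {α : Type*} [MeasurableSpace α] {μ : Measure α} {P Q : α → ℂ}
    (hP : MemLp P 2 μ) (hQ : MemLp Q 2 μ) : Integrable (fun x => P x * Q x) μ :=
  hP.integrable_mul hQ

theorem memLp_comp_sub {Q : Cn n → ℂ} (hQ : MemLp Q 2 volume) (y : Cn n) :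
    MemLp (fun x => Q (x - y)) 2 volume :=
  hQ.comp_measurePreserving (measurePreserving_sub_right volume y)

/-- The pairing is an inner product with a translate of `Q`, and translations act continuously on
`L²`. -/
theorem continuous_translate_pairing {P Q : Cn n → ℂ} (hP : MemLp P 2 volume)
    (hQ : MemLp Q 2 volume) : Continuous fun y => ∫ x, P x * Q (x - y) := by
  have hP' : MemLp (fun x => (starRingEnd ℂ) (P x)) 2 volume := hP.star
  have h : Continuous fun y : Cn n =>
      (inner ℂ (hP'.toLp) (DomAddAct.mk (-y) +ᵥ hQ.toLp) : ℂ) := by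
    apply Continuous.inner continuous_const
    have h1 : Continuous fun y : Cn n => DomAddAct.mk (-y) :=
      (DomAddAct.mkHomeomorph (M := Cn n)).continuous.comp continuous_neg
    have : Fact ((2 : ℝ≥0∞) ≠ ⊤) := ⟨by norm_num⟩
    exact h1.vadd continuous_const
  convert h using 2 with y
  rw [DomAddAct.mk_vadd_toLp, L2.inner_def]
  apply integral_congr_ae
  filter_upwards [hP'.coeFn_toLp, (hQ.comp_measurePreserving
    (measurePreserving_vadd (-y) volume)).coeFn_toLp] with x h1 h2
  refine Eq.trans ?_ (congrArg₂ (inner ℂ) h1 h2).symm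
  simp [mul_comm, sub_eq_neg_add]

theorem MemLp.integrable_of_hasCompactSupport {Q : Cn n → ℂ} (hQ : MemLp Q 2 volume)
    (hc : HasCompactSupport Q) : Integrable Q := by
  have h : LocallyIntegrable Q volume := hQ.locallyIntegrable (by norm_num)
  have h1 := h.integrableOn_isCompact hc.isCompact
  rw [integrableOn_iff_integrable_of_support_subset (subset_tsupport _)] at h1
  exact h1

theorem integral_mul_convolution {P Q η : Cn n → ℂ} (hP : MemLp P 2 volume)
    (hQ : MemLp Q 2 volume) (hη : Continuous η) (hηc : HasCompactSupport η) :
    ∫ x, P x * (Q ⋆[ContinuousLinearMap.mul ℝ ℂ, volume] η) x =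
      ∫ y, η y * ∫ x, P x * Q (x - y) := by
  have h1 : ∀ x, (Q ⋆[ContinuousLinearMap.mul ℝ ℂ, volume] η) x = ∫ y, Q (x - y) * η y := by
    intro x; rw [convolution_eq_swap]; rfl
  have hmeas : AEStronglyMeasurable (fun p : Cn n × Cn n => P p.1 * (η p.2 * Q (p.1 - p.2)))
      (volume.prod volume) := by
    apply AEStronglyMeasurable.mul
    · exact hP.1.comp_fst
    · exact AEStronglyMeasurable.convolution_integrand (ContinuousLinearMap.mul ℝ ℂ)
        hη.aestronglyMeasurable hQ.1
  have hint : Integrable (fun p : Cn n × Cn n => P p.1 * (η p.2 * Q (p.1 - p.2)))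
      (volume.prod volume) := by
    rw [integrable_prod_iff' hmeas]
    constructor
    · refine Eventually.of_forall fun y => ?_
      have := (integrable_mul_of_memLp_two hP (memLp_comp_sub hQ y)).const_mul (η y)
      refine this.congr (Eventually.of_forall fun x => ?_)
      simp only; ring
    -- Absolute integrability in `y`: the pairing of the moduli is again continuous, and `η` has
    -- compact support.
    · have hn : Continuous fun y => ∫ x, (‖P x‖ : ℂ) * (‖Q (x - y)‖ : ℂ) :=
        continuous_translate_pairing (P := fun x => (‖P x‖ : ℂ)) (Q := fun x => (‖Q x‖ : ℂ))
          hP.norm.ofReal hQ.norm.ofReal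
      have hi : Integrable (fun y => ‖η y‖ * ‖∫ x, (‖P x‖ : ℂ) * (‖Q (x - y)‖ : ℂ)‖) :=
        (hη.norm.mul hn.norm).integrable_of_hasCompactSupport (hηc.norm.mul_right)
      refine hi.congr (Eventually.of_forall fun y => ?_)
      simp only [norm_mul]
      have e1 : ∫ x, (‖P x‖ : ℂ) * (‖Q (x - y)‖ : ℂ) = ((∫ x, ‖P x‖ * ‖Q (x - y)‖ : ℝ) : ℂ) := by
        rw [← integral_complex_ofReal]; simp
      rw [e1, Complex.norm_real, Real.norm_of_nonneg (integral_nonneg fun x => by positivity),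
        ← integral_const_mul]
      congr 1; ext x; ring
  simp only [h1, ← integral_const_mul]
  have e1 := integral_integral_swap (f := fun x y => P x * (η y * Q (x - y))) hint
  calc _ = ∫ x, ∫ y, P x * (η y * Q (x - y)) := by
        congr 1; ext x; congr 1; ext y; ring
    _ = ∫ y, ∫ x, P x * (η y * Q (x - y)) := e1
    _ = _ := by congr 1; ext y; congr 1; ext x; ring

theorem integrable_test_mul {η c : Cn n → ℂ} (hη : Continuous η) (hηc : HasCompactSupport η)
    (hc : Continuous c) : Integrable (fun y => η y * c y) :=
  (hη.mul hc).integrable_of_hasCompactSupport hηc.mul_right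

theorem eq_zero_of_integral_mul_eq_zero {A : Cn n → ℂ} (hA : Continuous A)
    (h : ∀ η : Cn n → ℂ, ContDiff ℝ ∞ η → HasCompactSupport η → ∫ y, η y * A y = 0) : A = 0 := by
  have hae : ∀ᵐ x, A x = 0 := by
    apply ae_eq_zero_of_integral_contDiff_smul_eq_zero hA.locallyIntegrable
    intro g hg hc
    have := h (fun x => (g x : ℂ)) (Complex.ofRealCLM.contDiff.comp hg)
      (hc.comp_left (g := Complex.ofReal) rfl)
    simpa only [Complex.real_smul] using this
  exact (hA.ae_eq_iff_eq volume continuous_const).1 hae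

variable {F G : Cn n → ℂ} {DF DG : Fin n × Fin 2 → Cn n → ℂ}

/-- Test the weak derivative of `G` with `t ↦ η (x - t)`. -/
theorem CompactH1.pd_convolution (hG : CompactH1 G DG) {η : Cn n → ℂ} (hη : ContDiff ℝ ∞ η)
    (hηc : HasCompactSupport η) (l : Fin n × Fin 2) (x : Cn n) :
    pd l (G ⋆[ContinuousLinearMap.mul ℝ ℂ, volume] η) x =
      (DG l ⋆[ContinuousLinearMap.mul ℝ ℂ, volume] η) x := by
  have hGl : LocallyIntegrable G volume := hG.memLp.locallyIntegrable (by norm_num)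
  have h := hηc.hasFDerivAt_convolution_right (ContinuousLinearMap.mul ℝ ℂ) hGl
    (hη.of_le (by simp)) x
  rw [pd, h.fderiv, convolution_precompR_apply _ hGl (hηc.fderiv ℝ)
    (hη.continuous_fderiv (by simp))]
  have hφ : ContDiff ℝ ∞ fun t => η (x - t) := hη.comp (contDiff_const.sub contDiff_id)
  have key := hG.weak l _ hφ
  have hpd : ∀ t, pd l (fun t => η (x - t)) t = -(pd l η (x - t)) := by
    intro t
    have h1 : HasFDerivAt (fun t => x - t) (-ContinuousLinearMap.id ℝ (Cn n)) t :=
      (hasFDerivAt_id t).const_sub x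
    have := ((hη.differentiable (by simp)) (x - t)).hasFDerivAt.comp t h1
    change fderiv ℝ (η ∘ fun t => x - t) t _ = _
    rw [this.fderiv]; simp
  simp only [hpd, neg_mul, integral_neg, neg_inj] at key
  change ∫ t, G t * pd l η (x - t) = ∫ t, DG l t * η (x - t)
  simpa only [mul_comm] using key

theorem CompactH1.contDiff_convolution (hG : CompactH1 G DG) {η : Cn n → ℂ} (hη : ContDiff ℝ ∞ η)
    (hηc : HasCompactSupport η) :
    ContDiff ℝ ∞ (G ⋆[ContinuousLinearMap.mul ℝ ℂ, volume] η) :=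
  hηc.contDiff_convolution_right _ (hG.memLp.locallyIntegrable (by norm_num)) hη

/-- Integration by parts for compactly supported `H¹` functions. -/
theorem CompactH1.integral_by_parts (hF : CompactH1 F DF) (hG : CompactH1 G DG)
    (l : Fin n × Fin 2) : ∫ x, DF l x * G x = -∫ x, F x * DG l x := by
  -- As a function of the translation `y`, the defect of integration by parts is continuous.
  -- Integrated against any `η` it vanishes, because `G ⋆ η` is an admissible test function for `F`.
  -- Hence it is zero, in particular at `y = 0`.
  have hA : (fun y => (∫ x, F x * DG l (x - y)) + ∫ x, DF l x * G (x - y)) = 0 := by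
    have c1 := continuous_translate_pairing hF.memLp (hG.memLp_deriv l)
    have c2 := continuous_translate_pairing (hF.memLp_deriv l) hG.memLp
    apply eq_zero_of_integral_mul_eq_zero (c1.add c2)
    intro η hη hηc
    simp only [Pi.add_apply, mul_add]
    rw [integral_add (integrable_test_mul hη.continuous hηc c1)
      (integrable_test_mul hη.continuous hηc c2),
      ← integral_mul_convolution hF.memLp (hG.memLp_deriv l) hη.continuous hηc,
      ← integral_mul_convolution (hF.memLp_deriv l) hG.memLp hη.continuous hηc]
    have key := hF.weak l _ (hG.contDiff_convolution hη hηc)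
    simp only [hG.pd_convolution hη hηc] at key
    rw [integral_congr_ae (Eventually.of_forall fun x => mul_comm (F x) _),
      integral_congr_ae (Eventually.of_forall fun x => mul_comm (DF l x) _), key, neg_add_cancel]
  have h0 := congrFun hA 0
  simp only [sub_zero, Pi.zero_apply] at h0
  exact eq_neg_of_add_eq_zero_right h0

/-- Formally two integrations by parts, through second derivatives that need not exist. They do
exist, and commute, once `G` is replaced by `G ⋆ η`; continuity in the translation parameter then
removes `η`. -/
theorem CompactH1.integral_deriv_mul_deriv (hF : CompactH1 F DF) (hG : CompactH1 G DG)
    (a b : Fin n × Fin 2) : ∫ x, DF a x * DG b x = ∫ x, DF b x * DG a x := by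
  have hA : (fun y => (∫ x, DF a x * DG b (x - y)) - ∫ x, DF b x * DG a (x - y)) = 0 := by
    have c1 := continuous_translate_pairing (hF.memLp_deriv a) (hG.memLp_deriv b)
    have c2 := continuous_translate_pairing (hF.memLp_deriv b) (hG.memLp_deriv a)
    apply eq_zero_of_integral_mul_eq_zero (c1.sub c2)
    intro η hη hηc
    simp only [Pi.sub_apply, mul_sub]
    rw [integral_sub (integrable_test_mul hη.continuous hηc c1)
      (integrable_test_mul hη.continuous hηc c2),
      ← integral_mul_convolution (hF.memLp_deriv a) (hG.memLp_deriv b) hη.continuous hηc,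
      ← integral_mul_convolution (hF.memLp_deriv b) (hG.memLp_deriv a) hη.continuous hηc]
    have hψ := hG.contDiff_convolution hη hηc
    have hpd : ∀ l, ContDiff ℝ ∞ (pd l (G ⋆[ContinuousLinearMap.mul ℝ ℂ, volume] η)) := fun l =>
      (hψ.fderiv_right (m := ∞) (by simp)).clm_apply contDiff_const
    have k1 := hF.weak a _ (hpd b)
    have k2 := hF.weak b _ (hpd a)
    simp only [pd_comm hψ (l := a) (m := b)] at k1
    rw [k1] at k2
    simp only [hG.pd_convolution hη hηc] at k2
    rw [integral_congr_ae (Eventually.of_forall fun x => mul_comm (DF a x) _),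
      integral_congr_ae (Eventually.of_forall fun x => mul_comm (DF b x) _),
      neg_injective k2, sub_self]
  have h0 := congrFun hA 0
  simp only [sub_zero, Pi.zero_apply] at h0
  exact sub_eq_zero.1 h0

end Bilinear

/-! ### The operators `X_l^t`, local regularity and weighted norms. -/

section Sobolev

variable {n : ℕ} {Ω : Set (Cn n)} {t : ℝ} {k : ℕ} {l m : Fin n × Fin 2} {f f' g g' h : Cn n → ℂ}

/-- The space `W^{k,1}_loc(Ω)`. -/
def Wloc {n : ℕ} (Ω : Set (Cn n)) : ℕ → (Cn n → ℂ) → Prop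
  | 0, f => LocallyIntegrableOn f Ω
  | k + 1, f => LocallyIntegrableOn f Ω ∧
      ∀ l : Fin n × Fin 2, ∃ g, HasWeakDeriv Ω l f g ∧ Wloc Ω k g

theorem Wloc.locallyIntegrableOn : ∀ {k : ℕ}, Wloc Ω k f → LocallyIntegrableOn f Ω
  | 0, h => h
  | _ + 1, h => h.1

theorem Wloc.congr : ∀ {k : ℕ} {f f' : Cn n → ℂ}, Wloc Ω k f → f =ᵐ[volume.restrict Ω] f' →
    Wloc Ω k f'
  | 0, _, _, h, e => LocallyIntegrableOn.congr e h
  | _ + 1, _, _, h, e => ⟨LocallyIntegrableOn.congr e h.1, fun l => by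
      obtain ⟨g, hg, hgk⟩ := h.2 l
      exact ⟨g, hg.congr e EventuallyEq.rfl, hgk⟩⟩

theorem Wloc.of_succ : ∀ {k : ℕ} {f : Cn n → ℂ}, Wloc Ω (k + 1) f → Wloc Ω k f
  | 0, _, h => h.1
  | _ + 1, _, h => ⟨h.1, fun l => by
      obtain ⟨g, hg, hgk⟩ := h.2 l
      exact ⟨g, hg, hgk.of_succ⟩⟩

theorem Wloc.mono {j k : ℕ} (hjk : j ≤ k) (h : Wloc Ω k f) : Wloc Ω j f := by
  induction hjk with
  | refl => exact h
  | step _ ih => exact ih h.of_succ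

theorem wloc_zero : ∀ k : ℕ, Wloc Ω k (fun _ => 0)
  | 0 => locallyIntegrableOn_zero
  | k + 1 => ⟨locallyIntegrableOn_zero, fun _ => ⟨_, hasWeakDeriv_zero, wloc_zero k⟩⟩

theorem Wloc.add : ∀ {k : ℕ} {f g : Cn n → ℂ}, Wloc Ω k f → Wloc Ω k g →
    Wloc Ω k (fun x => f x + g x)
  | 0, _, _, hf, hg => hf.locallyIntegrableOn.add hg.locallyIntegrableOn
  | _ + 1, _, _, hf, hg => ⟨hf.1.add hg.1, fun l => by
      obtain ⟨f', hf', hfk⟩ := hf.2 l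
      obtain ⟨g', hg', hgk⟩ := hg.2 l
      exact ⟨_, hf'.add hg', hfk.add hgk⟩⟩

theorem Wloc.sum {κ : Type*} (s : Finset κ) {F : κ → Cn n → ℂ} (h : ∀ i ∈ s, Wloc Ω k (F i)) :
    Wloc Ω k (fun x => ∑ i ∈ s, F i x) := by
  classical
  induction s using Finset.induction_on with
  | empty => simpa using wloc_zero k
  | insert a s ha ih =>
    simp only [Finset.sum_insert ha]
    exact (h a (Finset.mem_insert_self a s)).add
      (ih fun i hi => h i (Finset.mem_insert_of_mem hi))

theorem contDiffOn_pd (hΩ : IsOpen Ω) {b : Cn n → ℂ} (hb : ContDiffOn ℝ ((k + 1 : ℕ) : ℕ∞ω) b Ω)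
    (l : Fin n × Fin 2) : ContDiffOn ℝ (k : ℕ∞ω) (pd l b) Ω :=
  (hb.fderiv_of_isOpen hΩ (by push_cast; exact le_rfl)).clm_apply contDiffOn_const

theorem Wloc.mul (hΩ : IsOpen Ω) : ∀ {k : ℕ} {f b : Cn n → ℂ}, Wloc Ω k f →
    ContDiffOn ℝ (k : ℕ∞ω) b Ω → Wloc Ω k (fun x => b x * f x)
  | 0, _, _, hf, hb => LocallyIntegrableOn.mul_of_continuousOn hΩ hf hb.continuousOn
  | k + 1, _, _, hf, hb => by
    refine ⟨LocallyIntegrableOn.mul_of_continuousOn hΩ hf.1 hb.continuousOn, fun l => ?_⟩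
    obtain ⟨f', hf', hfk⟩ := hf.2 l
    exact ⟨_, hf'.mul hΩ (hb.of_le (by push_cast; exact le_add_self)),
      (hfk.mul hΩ (hb.of_le (by push_cast; exact le_self_add))).add
        (hf.of_succ.mul hΩ (contDiffOn_pd hΩ hb l))⟩

theorem Wloc.const_mul (hΩ : IsOpen Ω) (hf : Wloc Ω k f) (c : ℂ) : Wloc Ω k (fun x => c * f x) :=
  hf.mul hΩ (b := fun _ => c) contDiffOn_const

theorem Wloc.exists_hasWeakDeriv (hf : Wloc Ω (k + 1) f) (l : Fin n × Fin 2) :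
    ∃ g, HasWeakDeriv Ω l f g := by
  obtain ⟨g, hg, _⟩ := hf.2 l
  exact ⟨g, hg⟩

theorem Wloc.hasWeakDeriv (hf : Wloc Ω (k + 1) f) (l : Fin n × Fin 2) :
    HasWeakDeriv Ω l f (weakDeriv Ω l f) :=
  hasWeakDeriv_weakDeriv (hf.exists_hasWeakDeriv l)

theorem Wloc.weakDeriv (hΩ : IsOpen Ω) (hf : Wloc Ω (k + 1) f) (l : Fin n × Fin 2) :
    Wloc Ω k (weakDeriv Ω l f) := by
  obtain ⟨g, hg, hgk⟩ := hf.2 l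
  exact hgk.congr (hg.weakDeriv_ae_eq hΩ).symm

theorem contDiff_coord (l : Fin n × Fin 2) : ContDiff ℝ ∞ fun x : Cn n => ((x l : ℝ) : ℂ) :=
  Complex.ofRealCLM.contDiff.comp (EuclideanSpace.proj (𝕜 := ℝ) l).contDiff

theorem pd_coord (l m : Fin n × Fin 2) (x : Cn n) :
    pd l (fun x : Cn n => ((x m : ℝ) : ℂ)) x = if l = m then 1 else 0 := by
  have := (Complex.ofRealCLM.comp (EuclideanSpace.proj (𝕜 := ℝ) m)).hasFDerivAt (x := x)
  change fderiv ℝ (⇑(Complex.ofRealCLM.comp (EuclideanSpace.proj (𝕜 := ℝ) m))) x _ = _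
  rw [this.fderiv]
  simp only [ContinuousLinearMap.comp_apply, EuclideanSpace.proj, PiLp.proj_apply,
    PiLp.single_apply, Complex.ofRealCLM_apply, eq_comm (a := m)]
  split_ifs <;> simp

theorem Wloc.wX (hΩ : IsOpen Ω) (hf : Wloc Ω (k + 1) f) (t : ℝ) (l : Fin n × Fin 2) :
    Wloc Ω k (wX Ω t l f) := by
  have h1 := (hf.of_succ.mul hΩ (b := fun x => ((x l : ℝ) : ℂ))
    ((contDiff_coord l).of_le (by exact_mod_cast le_top)).contDiffOn).const_mul hΩ
    (-(2 * (t : ℂ)))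
  refine ((hf.weakDeriv hΩ l).add h1).congr (Eventually.of_forall fun x => ?_)
  simp only [WeightedDbar.wX]; ring

/-- A true equality, not only almost everywhere: functions that agree almost everywhere have the
same weak derivatives, so the choice selects the same one. -/
theorem weakDeriv_congr (e : f =ᵐ[volume.restrict Ω] f') : weakDeriv Ω l f = weakDeriv Ω l f' := by
  have : HasWeakDeriv Ω l f = HasWeakDeriv Ω l f' := by
    ext g
    exact ⟨fun h => h.congr e EventuallyEq.rfl, fun h => h.congr e.symm EventuallyEq.rfl⟩
  have key : ∀ {P Q : (Cn n → ℂ) → Prop}, P = Q →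
      (open Classical in if h : ∃ g, P g then h.choose else 0) =
        (open Classical in if h : ∃ g, Q g then h.choose else 0) := by
    rintro P _ rfl; rfl
  exact key this

theorem wX_congr (e : f =ᵐ[volume.restrict Ω] f') :
    wX Ω t l f =ᵐ[volume.restrict Ω] wX Ω t l f' := by
  filter_upwards [e] with x hx
  simp only [wX, weakDeriv_congr e, hx]

theorem wX_add (hΩ : IsOpen Ω) (hf : Wloc Ω 1 f) (hg : Wloc Ω 1 g) :
    wX Ω t l (fun x => f x + g x) =ᵐ[volume.restrict Ω] fun x => wX Ω t l f x + wX Ω t l g x := by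
  filter_upwards [((hf.hasWeakDeriv l).add (hg.hasWeakDeriv l)).weakDeriv_ae_eq hΩ] with x hx
  simp only [wX, hx]; ring

theorem wX_sum (hΩ : IsOpen Ω) {κ : Type*} (s : Finset κ) {F : κ → Cn n → ℂ}
    (h : ∀ i ∈ s, Wloc Ω 1 (F i)) : wX Ω t l (fun x => ∑ i ∈ s, F i x)
      =ᵐ[volume.restrict Ω] fun x => ∑ i ∈ s, wX Ω t l (F i) x := by
  filter_upwards [(HasWeakDeriv.sum s fun i hi => (h i hi).hasWeakDeriv l).weakDeriv_ae_eq hΩ]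
    with x hx
  simp only [wX, hx, Finset.mul_sum, Finset.sum_sub_distrib]

theorem wX_mul (hΩ : IsOpen Ω) (hf : Wloc Ω 1 f) {b : Cn n → ℂ} (hb : ContDiffOn ℝ 1 b Ω) :
    wX Ω t l (fun x => b x * f x)
      =ᵐ[volume.restrict Ω] fun x => b x * wX Ω t l f x + pd l b x * f x := by
  filter_upwards [((hf.hasWeakDeriv l).mul hΩ hb).weakDeriv_ae_eq hΩ] with x hx
  simp only [wX, hx]; ring

theorem wX_const_mul (hΩ : IsOpen Ω) (hf : Wloc Ω 1 f) (c : ℂ) :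
    wX Ω t l (fun x => c * f x) =ᵐ[volume.restrict Ω] fun x => c * wX Ω t l f x := by
  filter_upwards [((hf.hasWeakDeriv l).const_mul hΩ c).weakDeriv_ae_eq hΩ] with x hx
  simp only [wX, hx]; ring

theorem wX_coord_mul (hΩ : IsOpen Ω) (hf : Wloc Ω 1 f) (m : Fin n × Fin 2) :
    wX Ω t l (fun x => ((x m : ℝ) : ℂ) * f x)
      =ᵐ[volume.restrict Ω]
      fun x => ((x m : ℝ) : ℂ) * wX Ω t l f x + (if l = m then 1 else 0) * f x := by
  filter_upwards [wX_mul (t := t) (l := l) hΩ hf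
    ((contDiff_coord m).of_le (by exact_mod_cast le_top)).contDiffOn] with x hx
  rw [hx, pd_coord]

/-- The weighted derivatives commute. -/
theorem wX_comm (hΩ : IsOpen Ω) (hf : Wloc Ω 2 f) :
    wX Ω t l (wX Ω t m f) =ᵐ[volume.restrict Ω] wX Ω t m (wX Ω t l f) := by
  -- The expansion is symmetric in `a` and `b` apart from the mixed weak derivative, since `[∂_a,
  -- x_b]` contributes only on the diagonal.
  have key : ∀ a b : Fin n × Fin 2, wX Ω t a (wX Ω t b f) =ᵐ[volume.restrict Ω] fun x =>
      weakDeriv Ω a (weakDeriv Ω b f) x - 2 * t * (x a : ℂ) * weakDeriv Ω b f x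
        - 2 * t * (x b : ℂ) * weakDeriv Ω a f x + 4 * t ^ 2 * (x a : ℂ) * (x b : ℂ) * f x
        - (if a = b then 1 else 0) * 2 * t * f x := by
    intro a b
    have e0 : wX Ω t b f = fun x => weakDeriv Ω b f x + (-(2 * t)) * (((x b : ℝ) : ℂ) * f x) := by
      ext x; simp only [wX]; ring
    have hm : Wloc Ω 1 fun x => ((x b : ℝ) : ℂ) * f x := hf.of_succ.mul hΩ
      ((contDiff_coord b).of_le (by exact_mod_cast le_top)).contDiffOn
    rw [e0]
    filter_upwards [wX_add (t := t) (l := a) hΩ (hf.weakDeriv hΩ b)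
      (hm.const_mul hΩ (-(2 * (t : ℂ)))),
      wX_const_mul (t := t) (l := a) hΩ hm (-(2 * (t : ℂ))),
      wX_coord_mul (t := t) (l := a) hΩ hf.of_succ b] with x h1 h2 h3
    rw [h1, h2, h3]
    simp only [wX]; ring
  have hc : weakDeriv Ω l (weakDeriv Ω m f) =ᵐ[volume.restrict Ω]
      weakDeriv Ω m (weakDeriv Ω l f) :=
    (((hf.hasWeakDeriv l).comm hΩ (hf.hasWeakDeriv m)
      ((hf.weakDeriv hΩ l).hasWeakDeriv m))).weakDeriv_ae_eq hΩ
  filter_upwards [key l m, key m l, hc] with x h1 h2 h3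
  rw [h1, h2, h3]
  simp only [eq_comm (a := m) (b := l)]
  ring

/-! ### Recursive Sobolev norms -/

/-- The squared Sobolev norm of order `k`, as a sum over words in the operators `X_l^t`. -/
noncomputable def recNormSq {n : ℕ} (Ω : Set (Cn n)) (t : ℝ) : ℕ → (Cn n → ℂ) → ℝ≥0∞
  | 0, f => normSqL2 Ω t f
  | k + 1, f => normSqL2 Ω t f + ∑ l : Fin n × Fin 2, recNormSq Ω t k (wX Ω t l f)

theorem ae_wMeasure_of_ae {p : Cn n → Prop} (h : ∀ᵐ x ∂(volume.restrict Ω), p x) :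
    ∀ᵐ x ∂(wMeasure Ω t), p x :=
  (withDensity_absolutelyContinuous _ _).ae_le h

theorem normSqL2_congr (e : f =ᵐ[volume.restrict Ω] f') : normSqL2 Ω t f = normSqL2 Ω t f' := by
  apply lintegral_congr_ae
  filter_upwards [ae_wMeasure_of_ae e] with x hx
  rw [hx]

theorem recNormSq_congr : ∀ {k : ℕ} {f f' : Cn n → ℂ}, f =ᵐ[volume.restrict Ω] f' →
    recNormSq Ω t k f = recNormSq Ω t k f'
  | 0, _, _, e => normSqL2_congr e
  | _ + 1, _, _, e => by
    simp only [recNormSq]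
    rw [normSqL2_congr e]
    congr 1
    exact Finset.sum_congr rfl fun l _ => recNormSq_congr (wX_congr e)

theorem normSqL2_le_recNormSq : ∀ k : ℕ, normSqL2 Ω t f ≤ recNormSq Ω t k f
  | 0 => le_rfl
  | _ + 1 => le_self_add

theorem recNormSq_le_succ : ∀ {k : ℕ} {f : Cn n → ℂ}, recNormSq Ω t k f ≤ recNormSq Ω t (k + 1) f
  | 0, _ => le_self_add
  | k + 1, f => by
    conv_lhs => rw [recNormSq]
    conv_rhs => rw [recNormSq]
    gcongr with l _
    exact recNormSq_le_succ

theorem recNormSq_mono {j k : ℕ} (h : j ≤ k) : recNormSq Ω t j f ≤ recNormSq Ω t k f := by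
  induction h with
  | refl => exact le_rfl
  | step _ ih => exact ih.trans recNormSq_le_succ

theorem recNormSq_wX_le : recNormSq Ω t k (wX Ω t l f) ≤ recNormSq Ω t (k + 1) f := by
  conv_rhs => rw [recNormSq]
  exact (Finset.single_le_sum (f := fun l => recNormSq Ω t k (wX Ω t l f)) (fun _ _ => zero_le)
    (Finset.mem_univ l)).trans le_add_self

theorem enorm_add_sq_le (a b : ℂ) : ‖a + b‖ₑ ^ 2 ≤ 2 * (‖a‖ₑ ^ 2 + ‖b‖ₑ ^ 2) := by
  have h : ‖a + b‖₊ ^ 2 ≤ 2 * (‖a‖₊ ^ 2 + ‖b‖₊ ^ 2) := by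
    rw [← NNReal.coe_le_coe]
    push_cast
    nlinarith [norm_add_le a b, norm_nonneg (a + b), sq_nonneg (‖a‖ - ‖b‖), norm_nonneg a,
      norm_nonneg b]
  simp only [enorm_eq_nnnorm]
  exact_mod_cast h

theorem aemeasurable_wMeasure (hf : LocallyIntegrableOn f Ω) :
    AEStronglyMeasurable f (wMeasure Ω t) :=
  hf.aestronglyMeasurable.mono_ac (withDensity_absolutelyContinuous _ _)

theorem normSqL2_add_le (hf : LocallyIntegrableOn f Ω) :
    normSqL2 Ω t (fun x => f x + g x) ≤ 2 * (normSqL2 Ω t f + normSqL2 Ω t g) := by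
  unfold normSqL2
  rw [← lintegral_add_left' ((aemeasurable_wMeasure hf).enorm.pow_const 2),
    ← lintegral_const_mul' _ _ (by norm_num)]
  exact lintegral_mono fun x => enorm_add_sq_le _ _

theorem recNormSq_add_le (hΩ : IsOpen Ω) : ∀ {k : ℕ} {f g : Cn n → ℂ}, Wloc Ω k f → Wloc Ω k g →
    recNormSq Ω t k (fun x => f x + g x) ≤ 2 * (recNormSq Ω t k f + recNormSq Ω t k g)
  | 0, _, _, hf, _ => normSqL2_add_le hf
  | k + 1, f, g, hf, hg => by
    simp only [recNormSq]
    calc _ ≤ 2 * (normSqL2 Ω t f + normSqL2 Ω t g) + ∑ l : Fin n × Fin 2,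
          2 * (recNormSq Ω t k (wX Ω t l f) + recNormSq Ω t k (wX Ω t l g)) := by
          gcongr with l _
          · exact normSqL2_add_le hf.1
          · rw [recNormSq_congr (wX_add hΩ (hf.mono (by omega)) (hg.mono (by omega)))]
            exact recNormSq_add_le hΩ (hf.wX hΩ t l) (hg.wX hΩ t l)
      _ = _ := by
          rw [← Finset.mul_sum, Finset.sum_add_distrib]; ring

theorem recNormSq_zero (hΩ : IsOpen Ω) : ∀ k : ℕ, recNormSq Ω t k (fun _ => 0) = 0
  | 0 => by simp [recNormSq, normSqL2]
  | k + 1 => by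
    have h0 : ∀ l, recNormSq Ω t k (wX Ω t l fun _ => 0) = recNormSq Ω t k (fun _ => 0) := by
      refine fun l => recNormSq_congr ?_
      filter_upwards [(hasWeakDeriv_zero (l := l)).weakDeriv_ae_eq hΩ] with x hx
      simp only [wX, hx]; ring
    simp only [recNormSq, h0, recNormSq_zero hΩ k]
    simp [normSqL2]

/-- The quantifier order matters here and below: constants that reach `C_k` are fixed before `t`. -/
theorem recNormSq_sum_le (hΩ : IsOpen Ω) {κ : Type*} (s : Finset κ) : ∃ C : ℝ≥0,
    ∀ (t : ℝ) (k : ℕ) (F : κ → Cn n → ℂ), (∀ i ∈ s, Wloc Ω k (F i)) →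
      recNormSq Ω t k (fun x => ∑ i ∈ s, F i x) ≤ C * ∑ i ∈ s, recNormSq Ω t k (F i) := by
  classical
  induction s using Finset.induction_on with
  | empty => exact ⟨0, fun t k F _ => by simp [recNormSq_zero hΩ]⟩
  | insert a s ha ih =>
    obtain ⟨C, hC⟩ := ih
    refine ⟨2 * (1 + C), fun t k F hF => ?_⟩
    simp only [Finset.sum_insert ha]
    have hs : ∀ i ∈ s, Wloc Ω k (F i) := fun i hi => hF i (Finset.mem_insert_of_mem hi)
    refine (recNormSq_add_le hΩ (hF a (Finset.mem_insert_self a s)) (Wloc.sum s hs)).trans ?_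
    push_cast
    rw [mul_assoc]
    gcongr
    rw [mul_add]
    gcongr
    · rw [add_mul, one_mul]; exact le_self_add
    · exact (hC t k F hs).trans (by gcongr; exact le_add_self)

/-- Functions of class `C^k` on `Ω`, bounded together with their derivatives of order at most
`k`. -/
def BddC {n : ℕ} (Ω : Set (Cn n)) (k : ℕ) (b : Cn n → ℂ) : Prop :=
  ContDiffOn ℝ (k : ℕ∞ω) b Ω ∧ ∃ M : ℝ, ∀ s ≤ k, ∀ x ∈ Ω, ‖iteratedFDeriv ℝ s b x‖ ≤ M

variable {b : Cn n → ℂ}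

theorem BddC.mono {j k : ℕ} (h : j ≤ k) (hb : BddC Ω k b) : BddC Ω j b := by
  obtain ⟨h1, M, h2⟩ := hb
  exact ⟨h1.of_le (by exact_mod_cast h), M, fun s hs x hx => h2 s (hs.trans h) x hx⟩

theorem BddC.exists_bound (hb : BddC Ω k b) : ∃ M : ℝ≥0, ∀ x ∈ Ω, ‖b x‖ ≤ M := by
  obtain ⟨_, M, h2⟩ := hb
  refine ⟨M.toNNReal, fun x hx => ?_⟩
  have := h2 0 (Nat.zero_le _) x hx
  rw [norm_iteratedFDeriv_zero] at this
  exact this.trans (Real.le_coe_toNNReal M)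

theorem BddC.pd (hΩ : IsOpen Ω) (hb : BddC Ω (k + 1) b) (l : Fin n × Fin 2) :
    BddC Ω k (pd l b) := by
  refine ⟨contDiffOn_pd hΩ hb.1 l, ?_⟩
  obtain ⟨h1, M, h2⟩ := hb
  refine ⟨M, fun s hs x hx => ?_⟩
  have hd : ContDiffAt ℝ (s : ℕ∞ω) (fderiv ℝ b) x :=
    (h1.contDiffAt (hΩ.mem_nhds hx)).fderiv_right (by exact_mod_cast Nat.succ_le_succ hs)
  have := norm_iteratedFDeriv_clm_apply_const (𝕜 := ℝ) (f := fderiv ℝ b)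
    (c := EuclideanSpace.single l (1 : ℝ)) (n := s) hd le_rfl
  refine this.trans ?_
  rw [norm_iteratedFDeriv_fderiv]
  simpa using h2 (s + 1) (Nat.succ_le_succ hs) x hx

theorem normSqL2_mul_le (hΩ : IsOpen Ω) {M : ℝ≥0} (hM : ∀ x ∈ Ω, ‖b x‖ ≤ M) :
    normSqL2 Ω t (fun x => b x * f x) ≤ (M : ℝ≥0∞) ^ 2 * normSqL2 Ω t f := by
  unfold normSqL2
  rw [← lintegral_const_mul' _ _ (by finiteness)]
  apply lintegral_mono_ae
  filter_upwards [ae_wMeasure_of_ae (ae_restrict_mem hΩ.measurableSet)] with x hx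
  rw [enorm_mul, mul_pow]
  gcongr
  rw [enorm_eq_nnnorm]
  exact_mod_cast hM x hx

/-- Multiplication by a function of class `C^k` with bounded derivatives is bounded on the weighted
Sobolev spaces, with a bound independent of the weight. -/
theorem BddC.recNormSq_mul_le (hΩ : IsOpen Ω) : ∀ {k : ℕ} {b : Cn n → ℂ}, BddC Ω k b →
    ∃ C : ℝ≥0, ∀ (t : ℝ) (f : Cn n → ℂ), Wloc Ω k f →
      recNormSq Ω t k (fun x => b x * f x) ≤ C * recNormSq Ω t k f
  | 0, _, hb => by
    obtain ⟨M, hM⟩ := hb.exists_bound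
    exact ⟨M ^ 2, fun t f _ => by push_cast; exact normSqL2_mul_le hΩ hM⟩
  | k + 1, b, hb => by
    obtain ⟨M, hM⟩ := hb.exists_bound
    obtain ⟨C₁, hC₁⟩ := (hb.mono (Nat.le_succ k)).recNormSq_mul_le hΩ
    choose C₂ hC₂ using fun l => (hb.pd hΩ l).recNormSq_mul_le hΩ
    refine ⟨M ^ 2 + ∑ l, 2 * (C₁ + C₂ l), fun t f hf => ?_⟩
    conv_lhs => rw [recNormSq]
    push_cast
    rw [add_mul, Finset.sum_mul]
    gcongr with l _
    · exact (normSqL2_mul_le hΩ hM).trans (by gcongr; exact normSqL2_le_recNormSq _)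
    · have hb1 : ContDiffOn ℝ 1 b Ω := hb.1.of_le (by push_cast; exact le_add_self)
      have hbk : ContDiffOn ℝ (k : ℕ∞ω) b Ω := hb.1.of_le (by push_cast; exact le_self_add)
      -- Commuting `X_l` past `b` leaves only `∂_l b`; the weight does not enter, so no power of `t`
      -- appears.
      rw [recNormSq_congr (wX_mul hΩ (hf.mono (by omega)) hb1), mul_assoc, add_mul]
      refine (recNormSq_add_le hΩ ((hf.wX hΩ t l).mul hΩ hbk)
        (hf.of_succ.mul hΩ (hb.pd hΩ l).1)).trans ?_
      gcongr
      · exact (hC₁ t _ (hf.wX hΩ t l)).trans (by gcongr; exact recNormSq_wX_le)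
      · exact (hC₂ l t _ hf.of_succ).trans (by gcongr; exact recNormSq_le_succ)

theorem bddC_const (c : ℂ) : BddC Ω k (fun _ => c) := by
  refine ⟨contDiffOn_const, ‖c‖, fun s _ x _ => ?_⟩
  rcases s with _ | s
  · simp
  · rw [iteratedFDeriv_const_of_ne (Nat.succ_ne_zero s)]; simp

/-! ### Membership in the weighted Sobolev spaces -/

/-- On a compact set the weight is bounded below, so Lebesgue measure there is dominated by a
multiple of the weighted measure. -/
theorem memLp_restrict_of_memLp (hf : MemLp f 2 (wMeasure Ω t)) {K : Set (Cn n)}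
    (hK : IsCompact K) (hKΩ : K ⊆ Ω) : MemLp f 2 (volume.restrict K) := by
  obtain ⟨B, hB⟩ : ∃ B, ∀ x ∈ K, ‖Real.exp (t * ‖x‖ ^ 2)‖ ≤ B :=
    hK.exists_bound_of_continuousOn (by fun_prop)
  have hle : volume.restrict K ≤ ENNReal.ofReal B • wMeasure Ω t := by
    refine Measure.le_iff.2 fun s hs => ?_
    rw [Measure.smul_apply, wMeasure, withDensity_apply _ hs, smul_eq_mul,
      ← lintegral_const_mul' _ _ ENNReal.ofReal_ne_top, Measure.restrict_restrict hs,
      Measure.restrict_apply hs, ← setLIntegral_one]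
    calc ∫⁻ x in s ∩ K, 1 ≤ ∫⁻ x in s ∩ K,
          ENNReal.ofReal B * ENNReal.ofReal (Real.exp (-t * ‖x‖ ^ 2)) := by
          apply setLIntegral_mono' (hs.inter hK.measurableSet)
          intro x hx
          have h1 := hB x hx.2
          rw [Real.norm_of_nonneg (Real.exp_pos _).le] at h1
          rw [← ENNReal.ofReal_mul ((Real.exp_pos _).le.trans h1), ← ENNReal.ofReal_one]
          apply ENNReal.ofReal_le_ofReal
          calc (1 : ℝ) = Real.exp (t * ‖x‖ ^ 2) * Real.exp (-t * ‖x‖ ^ 2) := by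
                rw [← Real.exp_add]; simp
            _ ≤ _ := by gcongr
      _ ≤ _ := lintegral_mono_set (inter_subset_inter_right s hKΩ)
  exact hf.of_measure_le_smul ENNReal.ofReal_ne_top hle

theorem locallyIntegrableOn_of_memLp (hΩ : IsOpen Ω) (hf : MemLp f 2 (wMeasure Ω t)) :
    LocallyIntegrableOn f Ω := by
  rw [locallyIntegrableOn_iff hΩ.isLocallyClosed]
  intro K hK hKc
  have : IsFiniteMeasure (volume.restrict K) := ⟨by simpa using hKc.measure_lt_top⟩
  exact (memLp_restrict_of_memLp hf hKc hK).integrable (by norm_num)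

/-- The hypothesis concerns `X_l f`, whereas `∂_l f = X_l f + 2 t x_l f` also involves `f` itself.
Hence the inner bootstrap: local regularity of order `j` for `f` yields order `j + 1`, up to `k +
1`. -/
theorem MemSobolev.wloc (hΩ : IsOpen Ω) : ∀ {k : ℕ} {f : Cn n → ℂ}, MemSobolev Ω t k f →
    Wloc Ω k f
  | 0, _, h => locallyIntegrableOn_of_memLp hΩ h
  | k + 1, f, h => by
    have h0 := locallyIntegrableOn_of_memLp hΩ h.1
    have hk : ∀ j ≤ k, Wloc Ω j f → Wloc Ω (j + 1) f := by
      intro j hj hf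
      refine ⟨h0, fun l => ?_⟩
      obtain ⟨hg, hX⟩ := h.2 l
      refine ⟨_, hasWeakDeriv_weakDeriv hg, ?_⟩
      have h1 := (hf.mul hΩ (b := fun x => ((x l : ℝ) : ℂ))
        ((contDiff_coord l).of_le (by exact_mod_cast le_top)).contDiffOn).const_mul hΩ (2 * (t : ℂ))
      refine ((hX.wloc hΩ).mono hj |>.add h1).congr (Eventually.of_forall fun x => ?_)
      simp only [WeightedDbar.wX]; ring
    have : ∀ j ≤ k + 1, Wloc Ω j f := by
      intro j
      induction j with
      | zero => exact fun _ => h0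
      | succ j ih => exact fun hj => hk j (by omega) (ih (by omega))
    exact this _ le_rfl

theorem normSqL2_lt_top_iff (hf : LocallyIntegrableOn f Ω) :
    normSqL2 Ω t f < ⊤ ↔ MemLp f 2 (wMeasure Ω t) := by
  have h : eLpNorm f 2 (wMeasure Ω t) < ⊤ ↔ normSqL2 Ω t f < ⊤ := by
    rw [eLpNorm_lt_top_iff_lintegral_rpow_enorm_lt_top (by norm_num) (by norm_num)]
    simp [normSqL2]
  exact ⟨fun h' => ⟨aemeasurable_wMeasure hf, h.2 h'⟩, fun h' => h.1 h'.2⟩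

theorem MemSobolev.recNormSq_lt_top (hΩ : IsOpen Ω) : ∀ {k : ℕ} {f : Cn n → ℂ},
    MemSobolev Ω t k f → recNormSq Ω t k f < ⊤
  | 0, _, h => (normSqL2_lt_top_iff (locallyIntegrableOn_of_memLp hΩ h)).2 h
  | k + 1, f, h => by
    rw [recNormSq, ENNReal.add_lt_top, ENNReal.sum_lt_top]
    exact ⟨(normSqL2_lt_top_iff (locallyIntegrableOn_of_memLp hΩ h.1)).2 h.1,
      fun l _ => (h.2 l).2.recNormSq_lt_top hΩ⟩

/-- Reduces membership in the weighted space to local regularity and a finite norm; this is how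
`T_i^t v` is seen to be admissible in the induction. -/
theorem Wloc.memSobolev (hΩ : IsOpen Ω) : ∀ {k : ℕ} {f : Cn n → ℂ}, Wloc Ω k f →
    recNormSq Ω t k f < ⊤ → MemSobolev Ω t k f
  | 0, _, hf, h => (normSqL2_lt_top_iff hf).1 h
  | k + 1, f, hf, h => by
    rw [recNormSq, ENNReal.add_lt_top, ENNReal.sum_lt_top] at h
    exact ⟨(normSqL2_lt_top_iff hf.1).1 h.1, fun l => ⟨hf.exists_hasWeakDeriv l,
      (hf.wX hΩ t l).memSobolev hΩ (h.2 l (Finset.mem_univ l))⟩⟩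

end Sobolev

/-! ### Comparison of the norm over words with the norm over multi-indices. -/

section Words

variable {n : ℕ} {Ω : Set (Cn n)} {t : ℝ} {k : ℕ} {f : Cn n → ℂ}

/-- The composition `X_{l_1}^t ⋯ X_{l_r}^t` along a word `l_1 … l_r`. -/
noncomputable def wXword {n : ℕ} (Ω : Set (Cn n)) (t : ℝ) (w : List (Fin n × Fin 2))
    (f : Cn n → ℂ) : Cn n → ℂ := w.foldr (fun l g => wX Ω t l g) f

theorem Wloc.wXword (hΩ : IsOpen Ω) {j : ℕ} : ∀ {w : List (Fin n × Fin 2)},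
    Wloc Ω (j + w.length) f → Wloc Ω j (wXword Ω t w f)
  | [], h => h
  | l :: w, h => by
    have : Wloc Ω (j + 1) (WeightedDbar.wXword Ω t w f) := by
      apply Wloc.wXword hΩ
      rwa [add_assoc, add_comm 1]
    exact this.wX hΩ t l

/-- A permutation is built from adjacent swaps, and each swap is `wX_comm`. Up to null sets a word
depends only on how often each letter occurs. -/
theorem wXword_perm (hΩ : IsOpen Ω) {w w' : List (Fin n × Fin 2)} (h : w.Perm w')
    (hf : Wloc Ω w.length f) : wXword Ω t w f =ᵐ[volume.restrict Ω] wXword Ω t w' f := by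
  induction h with
  | nil => rfl
  | cons l _ ih => exact wX_congr (ih hf.of_succ)
  | swap a b w =>
    have : Wloc Ω 2 (wXword Ω t w f) := Wloc.wXword hΩ (by
      simp only [List.length_cons] at hf; rwa [add_comm])
    exact wX_comm hΩ this
  | trans h₁ _ ih₁ ih₂ => exact (ih₁ hf).trans (ih₂ (h₁.length_eq ▸ hf))

/-- The word of the monomial `(X^t)^α`, in the order used by `wXpow`. -/
def monomialWord {n : ℕ} (α : Fin n × Fin 2 → ℕ) : List (Fin n × Fin 2) :=
  ((List.finRange n).product (List.finRange 2)).flatMap fun l => List.replicate (α l) l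

theorem wXpow_eq_wXword (α : Fin n × Fin 2 → ℕ) :
    wXpow Ω t α f = wXword Ω t (monomialWord α) f := by
  unfold wXpow monomialWord wXword
  induction (List.finRange n).product (List.finRange 2) with
  | nil => rfl
  | cons a L ih =>
    rw [List.foldr_cons, ih, List.flatMap_cons, List.foldr_append]
    generalize List.foldr (fun l g => wX Ω t l g) f
      (List.flatMap (fun l => List.replicate (α l) l) L) = g
    induction α a with
    | zero => rfl
    | succ r ih' => rw [Function.iterate_succ_apply', ih', List.replicate_succ, List.foldr_cons]

theorem count_monomialWord (α : Fin n × Fin 2 → ℕ) (l : Fin n × Fin 2) :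
    (monomialWord α).count l = α l := by
  have hnd : ((List.finRange n).product (List.finRange 2)).Nodup :=
    (List.nodup_finRange n).product (List.nodup_finRange 2)
  rw [monomialWord, List.count_flatMap, ← List.sum_toFinset _ hnd]
  rw [Finset.sum_eq_single l]
  · simp
  · intro m _ hm
    simp [List.count_replicate, hm]
  · intro hl
    exact absurd (List.mem_toFinset.2 (List.pair_mem_product.2
      ⟨List.mem_finRange _, List.mem_finRange _⟩)) hl

theorem length_eq_sum_count (w : List (Fin n × Fin 2)) : w.length = ∑ l, w.count l := by
  induction w with
  | nil => simp
  | cons a w ih => simp [List.count_cons, Finset.sum_add_distrib, ih]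

theorem perm_monomialWord (w : List (Fin n × Fin 2)) :
    w.Perm (monomialWord fun l => w.count l) := by
  rw [List.perm_iff_count]
  intro a
  rw [count_monomialWord]

theorem length_monomialWord (α : Fin n × Fin 2 → ℕ) : (monomialWord α).length = ∑ l, α l := by
  rw [length_eq_sum_count]
  simp only [count_monomialWord]

theorem wXword_concat (w : List (Fin n × Fin 2)) (l : Fin n × Fin 2) :
    wXword Ω t (w ++ [l]) f = wXword Ω t w (wX Ω t l f) := by
  simp [wXword, List.foldr_append]

theorem normSqL2_wXword_le : ∀ {k : ℕ} {w : List (Fin n × Fin 2)} {f : Cn n → ℂ},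
    w.length ≤ k → normSqL2 Ω t (wXword Ω t w f) ≤ recNormSq Ω t k f
  | 0, w, f, h => by
    rw [List.length_eq_zero_iff.1 (Nat.le_zero.1 h)]; exact le_rfl
  | k + 1, w, f, h => by
    rcases List.eq_nil_or_concat w with rfl | ⟨w', l, rfl⟩
    · exact normSqL2_le_recNormSq _
    · rw [List.concat_eq_append, wXword_concat]
      refine (normSqL2_wXword_le ?_).trans recNormSq_wX_le
      simpa using h

/-- Words are extended at the right end, where the operator acts first; this is the operator that
`recNormSq` peels off. -/
theorem recNormSq_le_of_words (n k : ℕ) : ∃ C : ℝ≥0, ∀ (Ω : Set (Cn n)) (t : ℝ) (f : Cn n → ℂ)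
    (B : ℝ≥0∞), (∀ w : List (Fin n × Fin 2), w.length ≤ k → normSqL2 Ω t (wXword Ω t w f) ≤ B) →
      recNormSq Ω t k f ≤ C * B := by
  induction k with
  | zero => exact ⟨1, fun Ω t f B h => by
      rw [ENNReal.coe_one, one_mul]; exact h [] le_rfl⟩
  | succ k ih =>
    obtain ⟨C, hC⟩ := ih
    refine ⟨1 + (Fintype.card (Fin n × Fin 2)) * C, fun Ω t f B h => ?_⟩
    rw [recNormSq]
    push_cast
    rw [add_mul, one_mul]
    gcongr
    · exact h [] (by simp)
    · refine (Finset.sum_le_sum fun l _ => hC Ω t (wX Ω t l f) B fun w hw => ?_).trans ?_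
      · rw [← wXword_concat]
        exact h _ (by simpa using hw)
      · simp [Finset.sum_const, mul_assoc]

/-- Each monomial is a word, and the constant counts monomials. No regularity of `f` is needed in
this direction. -/
theorem normSqSobolev_le (n k : ℕ) : ∃ C : ℝ≥0, ∀ (Ω : Set (Cn n)) (t : ℝ) (f : Cn n → ℂ),
    normSqSobolev Ω t k f ≤ C * recNormSq Ω t k f := by
  refine ⟨∑ s ∈ Finset.range (k + 1),
    ((Finset.piAntidiag (Finset.univ : Finset (Fin n × Fin 2)) s).card : ℝ≥0), fun Ω t f => ?_⟩
  unfold normSqSobolev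
  push_cast
  rw [Finset.sum_mul]
  refine Finset.sum_le_sum fun s hs => ?_
  rw [← nsmul_eq_mul]
  refine Finset.sum_le_card_nsmul _ _ _ fun α hα => ?_
  rw [wXpow_eq_wXword]
  apply normSqL2_wXword_le
  rw [length_monomialWord, (Finset.mem_piAntidiag.1 hα).1]
  exact Nat.lt_succ_iff.1 (Finset.mem_range.1 hs)

/-- Sorting a word into a monomial uses commutation, hence the regularity hypothesis. -/
theorem recNormSq_le (n k : ℕ) : ∃ C : ℝ≥0, ∀ (Ω : Set (Cn n)) (_ : IsOpen Ω) (t : ℝ)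
    (f : Cn n → ℂ), Wloc Ω k f → recNormSq Ω t k f ≤ C * normSqSobolev Ω t k f := by
  obtain ⟨C, hC⟩ := recNormSq_le_of_words n k
  refine ⟨C, fun Ω hΩ t f hf => hC Ω t f _ fun w hw => ?_⟩
  rw [normSqL2_congr (wXword_perm hΩ (perm_monomialWord w) (hf.mono hw)), ← wXpow_eq_wXword]
  unfold normSqSobolev
  refine le_trans ?_ (Finset.single_le_sum (fun _ _ => zero_le)
    (Finset.mem_range.2 (Nat.lt_succ_iff.2 hw)))
  refine Finset.single_le_sum (f := fun α => normSqL2 Ω t (wXpow Ω t α f)) (fun _ _ => zero_le)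
    (Finset.mem_piAntidiag.2 ⟨(length_eq_sum_count w).symm, fun _ _ => Finset.mem_univ _⟩)

end Words

/-! ### Commutators of the first order system, the operators `X_m^t` and the fields. -/

section FirstOrder

variable {n : ℕ} {Ω : Set (Cn n)} {t : ℝ} {k : ℕ} {f : Cn n → ℂ} {σ κ : Type*} [Fintype σ]

theorem BddC.const_mul {b : Cn n → ℂ} (hΩ : IsOpen Ω) (hb : BddC Ω k b) (c : ℂ) :
    BddC Ω k (fun x => c * b x) := by
  obtain ⟨h1, M, h2⟩ := hb
  refine ⟨contDiffOn_const.mul h1, ‖c‖ * M, fun s hs x hx => ?_⟩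
  have hd : ContDiffAt ℝ (s : ℕ∞ω) b x :=
    (h1.contDiffAt (hΩ.mem_nhds hx)).of_le (by exact_mod_cast hs)
  have : iteratedFDeriv ℝ s (fun x => c * b x) x = c • iteratedFDeriv ℝ s b x :=
    iteratedFDeriv_const_smul_apply (a := c) hd
  rw [this, norm_smul]
  exact mul_le_mul_of_nonneg_left (h2 s hs x hx) (norm_nonneg c)

/-- Finite linear combinations with coefficients in `BddC` are bounded on Sobolev spaces. -/
theorem recNormSq_sum_mul_le (hΩ : IsOpen Ω) {β : Type*} [Fintype β] {b : β → Cn n → ℂ}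
    (hb : ∀ i, BddC Ω k (b i)) : ∃ C : ℝ≥0, ∀ (t : ℝ) (F : β → Cn n → ℂ),
      (∀ i, Wloc Ω k (F i)) →
        recNormSq Ω t k (fun x => ∑ i, b i x * F i x) ≤ C * ∑ i, recNormSq Ω t k (F i) := by
  obtain ⟨C₁, hC₁⟩ := recNormSq_sum_le hΩ (Finset.univ : Finset β)
  choose C₂ hC₂ using fun i => (hb i).recNormSq_mul_le hΩ
  refine ⟨C₁ * ∑ i, C₂ i, fun t F hF => ?_⟩
  refine (hC₁ t k _ fun i _ => (hF i).mul hΩ (hb i).1).trans ?_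
  push_cast
  rw [mul_assoc]
  gcongr
  rw [Finset.mul_sum]
  refine Finset.sum_le_sum fun i _ => (hC₂ i t _ (hF i)).trans ?_
  gcongr
  exact Finset.single_le_sum (f := fun i => (C₂ i : ℝ≥0∞)) (fun _ _ => zero_le)
    (Finset.mem_univ i)

/-- A first order system in the operators `X_l^t` with constant coefficients and zero order terms
of the form `t x_l`. -/
noncomputable def firstOrder {n : ℕ} (Ω : Set (Cn n)) (t : ℝ)
    (c d : κ → σ → Fin n × Fin 2 → ℂ) (v : σ → Cn n → ℂ) (K : κ) : Cn n → ℂ :=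
  fun x => ∑ p : σ × (Fin n × Fin 2), (c K p.1 p.2 * wX Ω t p.2 (v p.1) x +
    (t * d K p.1 p.2) * (((x p.2 : ℝ) : ℂ) * v p.1 x))

/-- The squared Sobolev norm of a finite family of functions. -/
noncomputable def famNormSq {n : ℕ} (Ω : Set (Cn n)) (t : ℝ) (k : ℕ) (v : σ → Cn n → ℂ) : ℝ≥0∞ :=
  ∑ J, recNormSq Ω t k (v J)

theorem famNormSq_mono {j k : ℕ} (h : j ≤ k) (v : σ → Cn n → ℂ) :
    famNormSq Ω t j v ≤ famNormSq Ω t k v :=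
  Finset.sum_le_sum fun _ _ => recNormSq_mono h

theorem recNormSq_le_famNormSq (v : σ → Cn n → ℂ) (J : σ) :
    recNormSq Ω t k (v J) ≤ famNormSq Ω t k v :=
  Finset.single_le_sum (f := fun J => recNormSq Ω t k (v J)) (fun _ _ => zero_le)
    (Finset.mem_univ J)

theorem famNormSq_wX_le (v : σ → Cn n → ℂ) (l : Fin n × Fin 2) :
    famNormSq Ω t k (fun J => wX Ω t l (v J)) ≤ famNormSq Ω t (k + 1) v :=
  Finset.sum_le_sum fun _ _ => recNormSq_wX_le

variable {c d : κ → σ → Fin n × Fin 2 → ℂ} {v : σ → Cn n → ℂ}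

theorem wloc_coord_mul (hΩ : IsOpen Ω) (hf : Wloc Ω k f) (l : Fin n × Fin 2) :
    Wloc Ω k (fun x => ((x l : ℝ) : ℂ) * f x) :=
  hf.mul hΩ ((contDiff_coord l).of_le (by exact_mod_cast le_top)).contDiffOn

theorem wloc_firstOrder (hΩ : IsOpen Ω) (hv : ∀ J, Wloc Ω (k + 1) (v J)) (K : κ) :
    Wloc Ω k (firstOrder Ω t c d v K) :=
  Wloc.sum _ fun p _ => (((hv p.1).wX hΩ t p.2).const_mul hΩ _).add
    ((wloc_coord_mul hΩ (hv p.1).of_succ p.2).const_mul hΩ _)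

/-- The `X_l` commute with each other and with constants, so the only commutator is `[X_m, x_l] =
δ_{ml}`, which leaves a term of order zero. -/
theorem wX_firstOrder (hΩ : IsOpen Ω) (hv : ∀ J, Wloc Ω 2 (v J)) (m : Fin n × Fin 2) (K : κ) :
    wX Ω t m (firstOrder Ω t c d v K) =ᵐ[volume.restrict Ω] fun x =>
      firstOrder Ω t c d (fun J => wX Ω t m (v J)) K x + ∑ J, (t * d K J m) * v J x := by
  have h1 := wX_sum (t := t) (l := m) hΩ (Finset.univ : Finset (σ × (Fin n × Fin 2)))
    (F := fun p x => c K p.1 p.2 * wX Ω t p.2 (v p.1) x +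
      (t * d K p.1 p.2) * (((x p.2 : ℝ) : ℂ) * v p.1 x))
    fun p _ => (((hv p.1).wX hΩ t p.2).const_mul hΩ _).add
      ((wloc_coord_mul hΩ (hv p.1).of_succ p.2).const_mul hΩ _)
  have h2 : ∀ p : σ × (Fin n × Fin 2), wX Ω t m (fun x => c K p.1 p.2 * wX Ω t p.2 (v p.1) x +
      (t * d K p.1 p.2) * (((x p.2 : ℝ) : ℂ) * v p.1 x)) =ᵐ[volume.restrict Ω] fun x =>
      (c K p.1 p.2 * wX Ω t p.2 (wX Ω t m (v p.1)) x +
        (t * d K p.1 p.2) * (((x p.2 : ℝ) : ℂ) * wX Ω t m (v p.1) x)) +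
        (if m = p.2 then (t * d K p.1 p.2) * v p.1 x else 0) := by
    intro p
    have w1 := (hv p.1).wX hΩ t p.2
    have w2 := wloc_coord_mul hΩ (hv p.1).of_succ p.2
    filter_upwards [wX_add (t := t) (l := m) hΩ (w1.const_mul hΩ (c K p.1 p.2))
      (w2.const_mul hΩ (t * d K p.1 p.2)), wX_const_mul (t := t) (l := m) hΩ w1 (c K p.1 p.2),
      wX_const_mul (t := t) (l := m) hΩ w2 (t * d K p.1 p.2),
      wX_coord_mul (t := t) (l := m) hΩ (hv p.1).of_succ p.2,
      wX_comm (t := t) (l := m) (m := p.2) hΩ (hv p.1)] with x e1 e2 e3 e4 e5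
    rw [e1, e2, e3, e4, e5]
    split_ifs <;> ring
  filter_upwards [h1, ae_all_iff.2 h2] with x e1 e2
  unfold firstOrder
  rw [e1]
  simp only [e2, Finset.sum_add_distrib]
  congr 1
  rw [Fintype.sum_prod_type]
  simp

/-- The coefficient functions of a real vector field. -/
abbrev coef {n : ℕ} (a : Cn n → Cn n) (l : Fin n × Fin 2) : Cn n → ℂ := fun x => ((a x l : ℝ) : ℂ)

variable {a : Cn n → Cn n}

theorem wloc_wT (hΩ : IsOpen Ω) (ha : ∀ l, ContDiffOn ℝ (k : ℕ∞ω) (coef a l) Ω)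
    (hf : Wloc Ω (k + 1) f) : Wloc Ω k (wT Ω t a f) :=
  Wloc.sum _ fun l _ => (hf.wX hΩ t l).mul hΩ (ha l)

theorem wX_wT (hΩ : IsOpen Ω) (ha : ∀ l, ContDiffOn ℝ 1 (coef a l) Ω)
    (hf : Wloc Ω 2 f) (m : Fin n × Fin 2) :
    wX Ω t m (wT Ω t a f) =ᵐ[volume.restrict Ω] fun x =>
      ∑ l, (coef a l x * wX Ω t m (wX Ω t l f) x + pd m (coef a l) x * wX Ω t l f x) := by
  have h1 := wX_sum (t := t) (l := m) hΩ (Finset.univ : Finset (Fin n × Fin 2))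
    (F := fun l x => coef a l x * wX Ω t l f x) fun l _ => (hf.wX hΩ t l).mul hΩ (ha l)
  filter_upwards [h1, ae_all_iff.2 fun l => wX_mul (t := t) (l := m) hΩ (hf.wX hΩ t l) (ha l)]
    with x e1 e2
  refine e1.trans (Finset.sum_congr rfl fun l _ => e2 l)

theorem recNormSq_wT_le (hΩ : IsOpen Ω) (ha : ∀ l, BddC Ω k (coef a l)) : ∃ C : ℝ≥0,
    ∀ (t : ℝ) (f : Cn n → ℂ), Wloc Ω (k + 1) f →
      recNormSq Ω t k (wT Ω t a f) ≤ C * recNormSq Ω t (k + 1) f := by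
  obtain ⟨C, hC⟩ := recNormSq_sum_mul_le hΩ ha
  refine ⟨C * 1, fun t f hf => ?_⟩
  refine (hC t (fun l => wX Ω t l f) fun l => hf.wX hΩ t l).trans ?_
  rw [mul_one]
  gcongr
  conv_rhs => rw [recNormSq]
  exact le_add_self

/-- Since `T^t = ∑ a_l X_l`, the commutator `[T^t, X_m]` is `-∑ (∂_m a_l) X_l`: first order, bounded
coefficients, no `t`. One derivative of the coefficients is spent. -/
theorem recNormSq_wT_wX_le (hΩ : IsOpen Ω) (ha : ∀ l, BddC Ω (k + 1) (coef a l))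
    (m : Fin n × Fin 2) : ∃ C : ℝ≥0, ∀ (t : ℝ) (f : Cn n → ℂ), Wloc Ω (k + 2) f →
      recNormSq Ω t k (wT Ω t a (wX Ω t m f)) ≤
        2 * recNormSq Ω t k (wX Ω t m (wT Ω t a f)) + C * recNormSq Ω t (k + 1) f := by
  have hb : ∀ l, BddC Ω k fun x => (-1) * pd m (coef a l) x := fun l =>
    ((ha l).pd hΩ m).const_mul hΩ (-1)
  obtain ⟨C, hC⟩ := recNormSq_sum_mul_le hΩ hb
  refine ⟨2 * C, fun t f hf => ?_⟩
  have hw1 : Wloc Ω k (wX Ω t m (wT Ω t a f)) :=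
    (wloc_wT hΩ (fun l => (ha l).1) hf).wX hΩ t m
  have hw2 : Wloc Ω k (fun x => ∑ l, (-1) * pd m (coef a l) x * wX Ω t l f x) :=
    Wloc.sum _ fun l _ => (hf.of_succ.wX hΩ t l).mul hΩ (hb l).1
  have e : wT Ω t a (wX Ω t m f) =ᵐ[volume.restrict Ω] fun x => wX Ω t m (wT Ω t a f) x +
      ∑ l, (-1) * pd m (coef a l) x * wX Ω t l f x := by
    filter_upwards [wX_wT (t := t) hΩ (fun l => (ha l).1.of_le (by push_cast; exact le_add_self))
      (hf.mono (by omega)) m,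
      ae_all_iff.2 fun l => wX_comm (t := t) (l := l) (m := m) hΩ (hf.mono (by omega))]
      with x e1 e2
    rw [e1, ← Finset.sum_add_distrib]
    unfold wT
    refine Finset.sum_congr rfl fun l _ => ?_
    rw [e2]; ring
  rw [recNormSq_congr e]
  refine (recNormSq_add_le hΩ hw1 hw2).trans ?_
  rw [mul_add]
  gcongr 2 * _ + ?_
  push_cast
  rw [mul_assoc]
  gcongr
  refine (hC t (fun l => wX Ω t l f) fun l => hf.of_succ.wX hΩ t l).trans ?_
  gcongr
  conv_rhs => rw [recNormSq]
  exact le_add_self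

/-- The commutator from `wX_firstOrder` carries a factor `t`, so it is paid by `D`, chosen after
`t`; the leading constant 2 is universal. -/
theorem famNormSq_firstOrder_wX_le [Fintype κ] (hΩ : IsOpen Ω) (c d : κ → σ → Fin n × Fin 2 → ℂ) (k : ℕ)
    (t : ℝ) : ∃ D : ℝ≥0, ∀ (v : σ → Cn n → ℂ) (m : Fin n × Fin 2), (∀ J, Wloc Ω (k + 2) (v J)) →
      famNormSq Ω t k (firstOrder Ω t c d fun J => wX Ω t m (v J)) ≤
        2 * famNormSq Ω t (k + 1) (firstOrder Ω t c d v) + D * famNormSq Ω t k v := by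
  have hb : ∀ (K : κ) (m : Fin n × Fin 2) (J : σ), BddC Ω k fun _ => -(t * d K J m) :=
    fun K m J => bddC_const _
  choose D hD using fun K m => recNormSq_sum_mul_le hΩ (hb K m)
  refine ⟨∑ K, 2 * ∑ m, D K m, fun v m hv => ?_⟩
  unfold famNormSq
  push_cast
  rw [Finset.mul_sum, Finset.sum_mul, ← Finset.sum_add_distrib]
  refine Finset.sum_le_sum fun K _ => ?_
  have e : firstOrder Ω t c d (fun J => wX Ω t m (v J)) K =ᵐ[volume.restrict Ω] fun x =>
      wX Ω t m (firstOrder Ω t c d v K) x + ∑ J, -(t * d K J m) * v J x := by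
    filter_upwards [wX_firstOrder (t := t) (c := c) (d := d) hΩ
      (fun J => (hv J).mono (by omega : 2 ≤ k + 2)) m K] with x e1
    rw [e1]
    simp only [neg_mul, Finset.sum_neg_distrib]; ring
  rw [recNormSq_congr e]
  refine (recNormSq_add_le hΩ ((wloc_firstOrder hΩ hv K).wX hΩ t m)
    (Wloc.sum _ fun J _ => ((hv J).mono (by omega)).const_mul hΩ _)).trans ?_
  rw [mul_add, mul_assoc]
  gcongr
  · exact recNormSq_wX_le
  · refine (hD K m t v fun J => (hv J).mono (by omega)).trans ?_
    gcongr
    exact Finset.single_le_sum (f := fun m => (D K m : ℝ≥0∞)) (fun _ _ => zero_le)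
      (Finset.mem_univ m)

/-- The commutator of the system with `T^t` has two parts: derivatives of the coefficients of `T`
times `X_l v`, and the multiples of `t v` that come from `wX_firstOrder`. -/
theorem firstOrder_wT (hΩ : IsOpen Ω) (ha : ∀ l, ContDiffOn ℝ 1 (coef a l) Ω)
    (hv : ∀ J, Wloc Ω 2 (v J)) (K : κ) :
    firstOrder Ω t c d (fun J => wT Ω t a (v J)) K =ᵐ[volume.restrict Ω] fun x =>
      wT Ω t a (firstOrder Ω t c d v K) x +
      ((∑ p : (σ × (Fin n × Fin 2)) × (Fin n × Fin 2),
        c K p.1.1 p.1.2 * pd p.1.2 (coef a p.2) x * wX Ω t p.2 (v p.1.1) x) +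
      ∑ p : σ × (Fin n × Fin 2), -(t * d K p.1 p.2) * coef a p.2 x * v p.1 x) := by
  filter_upwards [ae_all_iff.2 fun m => wX_firstOrder (t := t) (c := c) (d := d) hΩ hv m K,
    ae_all_iff.2 fun J => ae_all_iff.2 fun l => wX_wT (t := t) hΩ ha (hv J) l] with x e1 e2
  have e3 : wT Ω t a (firstOrder Ω t c d v K) x = ∑ m, coef a m x *
      (firstOrder Ω t c d (fun J => wX Ω t m (v J)) K x + ∑ J, (t * d K J m) * v J x) :=
    Finset.sum_congr rfl fun m _ => by rw [e1]
  have e4 : ∑ p : σ × (Fin n × Fin 2), -(t * d K p.1 p.2) * coef a p.2 x * v p.1 x =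
      -∑ m, coef a m x * ∑ J, (t * d K J m) * v J x := by
    rw [Fintype.sum_prod_type_right, ← Finset.sum_neg_distrib]
    refine Finset.sum_congr rfl fun m _ => ?_
    rw [Finset.mul_sum, ← Finset.sum_neg_distrib]
    exact Finset.sum_congr rfl fun J _ => by ring
  rw [e3, e4, Fintype.sum_prod_type (f := fun p : (σ × (Fin n × Fin 2)) × (Fin n × Fin 2) =>
    c K p.1.1 p.1.2 * pd p.1.2 (coef a p.2) x * wX Ω t p.2 (v p.1.1) x)]
  simp only [mul_add, Finset.sum_add_distrib]
  rw [add_assoc, add_comm (∑ m, coef a m x * ∑ J, (t * d K J m) * v J x), add_assoc,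
    neg_add_cancel, add_zero]
  simp only [firstOrder, e2, wT, Finset.mul_sum]
  rw [Finset.sum_comm, ← Finset.sum_add_distrib]
  refine Finset.sum_congr rfl fun p _ => ?_
  rw [← Finset.sum_add_distrib, ← Finset.sum_add_distrib]
  exact Finset.sum_congr rfl fun m _ => by ring

/-- Both commutator parts of `firstOrder_wT` involve at most `k + 1` derivatives of `v`, one fewer
than the order being estimated, so they go into `D`. -/
theorem famNormSq_firstOrder_wT_le [Fintype κ] (hΩ : IsOpen Ω) (c d : κ → σ → Fin n × Fin 2 → ℂ)
    (ha : ∀ l, BddC Ω (k + 1) (coef a l)) : ∃ C : ℝ≥0, ∀ t : ℝ, ∃ D : ℝ≥0,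
      ∀ v : σ → Cn n → ℂ, (∀ J, Wloc Ω (k + 2) (v J)) →
        famNormSq Ω t k (firstOrder Ω t c d fun J => wT Ω t a (v J)) ≤
          C * famNormSq Ω t (k + 1) (firstOrder Ω t c d v) + D * famNormSq Ω t (k + 1) v := by
  obtain ⟨C, hC⟩ := recNormSq_wT_le hΩ fun l => (ha l).mono (Nat.le_succ k)
  refine ⟨2 * C, fun t => ?_⟩
  have hb1 : ∀ (K : κ) (p : (σ × (Fin n × Fin 2)) × (Fin n × Fin 2)),
      BddC Ω k fun x => c K p.1.1 p.1.2 * pd p.1.2 (coef a p.2) x :=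
    fun K p => ((ha p.2).pd hΩ p.1.2).const_mul hΩ _
  have hb2 : ∀ (K : κ) (p : σ × (Fin n × Fin 2)),
      BddC Ω k fun x => -(t * d K p.1 p.2) * coef a p.2 x :=
    fun K p => ((ha p.2).mono (Nat.le_succ k)).const_mul hΩ _
  choose D₁ hD₁ using fun K => recNormSq_sum_mul_le hΩ (hb1 K)
  choose D₂ hD₂ using fun K => recNormSq_sum_mul_le hΩ (hb2 K)
  refine ⟨∑ K, 4 * (D₁ K * Fintype.card ((σ × (Fin n × Fin 2)) × (Fin n × Fin 2)) +
    D₂ K * Fintype.card (σ × (Fin n × Fin 2))), fun v hv => ?_⟩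
  conv_lhs => rw [famNormSq]
  conv_rhs => rw [famNormSq]
  push_cast
  rw [Finset.mul_sum, Finset.sum_mul, ← Finset.sum_add_distrib]
  refine Finset.sum_le_sum fun K _ => ?_
  have hv2 : ∀ J, Wloc Ω 2 (v J) := fun J => (hv J).mono (by omega)
  have hX : ∀ J l, Wloc Ω k (wX Ω t l (v J)) := fun J l => (hv J).of_succ.wX hΩ t l
  rw [recNormSq_congr (firstOrder_wT (t := t) (c := c) (d := d) hΩ
    (fun l => (ha l).1.of_le (by push_cast; exact le_add_self)) hv2 K)]
  have w1 : Wloc Ω k fun x => ∑ p : (σ × (Fin n × Fin 2)) × (Fin n × Fin 2),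
      c K p.1.1 p.1.2 * pd p.1.2 (coef a p.2) x * wX Ω t p.2 (v p.1.1) x :=
    Wloc.sum _ fun p _ => (hX p.1.1 p.2).mul hΩ (hb1 K p).1
  have w2 : Wloc Ω k fun x => ∑ p : σ × (Fin n × Fin 2),
      -(t * d K p.1 p.2) * coef a p.2 x * v p.1 x :=
    Wloc.sum _ fun p _ => ((hv p.1).mono (by omega)).mul hΩ (hb2 K p).1
  have hP := wloc_firstOrder (t := t) (c := c) (d := d) hΩ hv K
  refine (recNormSq_add_le hΩ (wloc_wT hΩ (fun l => ((ha l).mono (Nat.le_succ k)).1) hP)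
    (w1.add w2)).trans ?_
  rw [mul_add, mul_assoc]
  have b1 : ∀ p : (σ × (Fin n × Fin 2)) × (Fin n × Fin 2),
      recNormSq Ω t k (wX Ω t p.2 (v p.1.1)) ≤ famNormSq Ω t (k + 1) v := fun p =>
    recNormSq_wX_le.trans (recNormSq_le_famNormSq v p.1.1)
  have b2 : ∀ p : σ × (Fin n × Fin 2),
      recNormSq Ω t k (v p.1) ≤ famNormSq Ω t (k + 1) v := fun p =>
    recNormSq_le_succ.trans (recNormSq_le_famNormSq v p.1)
  have s1 := (hD₁ K t (fun p => wX Ω t p.2 (v p.1.1)) fun p => hX p.1.1 p.2).trans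
    (mul_le_mul_right (Finset.sum_le_card_nsmul Finset.univ _ _ fun p _ => b1 p) _)
  have s2 := (hD₂ K t (fun p => v p.1) fun p => (hv p.1).mono (by omega)).trans
    (mul_le_mul_right (Finset.sum_le_card_nsmul Finset.univ _ _ fun p _ => b2 p) _)
  gcongr ?_ + ?_
  · gcongr
    exact hC t _ hP
  · refine (mul_le_mul_right ((recNormSq_add_le hΩ w1 w2).trans
      (mul_le_mul_right (add_le_add s1 s2) 2)) 2).trans (le_of_eq ?_)
    simp only [Finset.card_univ, nsmul_eq_mul]; ring

end FirstOrder

/-! ### From order one to order `k`. -/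

section Induction

variable {n p : ℕ} {Ω : Set (Cn n)} {σ κ ι : Type*} [Fintype σ] [Fintype κ] [Fintype ι]
  {c d : κ → σ → Fin n × Fin 2 → ℂ} {T : ι → Cn n → Cn n}

theorem memSobolev_wT (hΩ : IsOpen Ω) {a : Cn n → Cn n} {t : ℝ} {k : ℕ} {f : Cn n → ℂ}
    (ha : ∀ l, BddC Ω k (coef a l)) (hf : MemSobolev Ω t (k + 1) f) :
    MemSobolev Ω t k (wT Ω t a f) := by
  have hw := hf.wloc hΩ
  obtain ⟨C, hC⟩ := recNormSq_wT_le hΩ ha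
  exact (wloc_wT hΩ (fun l => (ha l).1) hw).memSobolev hΩ
    ((hC t f hw).trans_lt (ENNReal.mul_lt_top ENNReal.coe_lt_top (hf.recNormSq_lt_top hΩ)))

theorem MemSobolev.wX {t : ℝ} {k : ℕ} {f : Cn n → ℂ} (hf : MemSobolev Ω t (k + 1) f)
    (l : Fin n × Fin 2) : MemSobolev Ω t k (wX Ω t l f) := (hf.2 l).2

/-- The one-step estimate: all derivatives of order `k + 1` are controlled by the first order
system and by the derivatives of order `k` of the tangential derivatives. -/
theorem famNormSq_succ_le (hΩ : IsOpen Ω) (hT : ∀ i l, BddC Ω p (coef (T i) l))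
    (hbase : ∃ C : ℝ≥0, ∀ t : ℝ, ∃ D : ℝ≥0, ∀ v : σ → Cn n → ℂ, (∀ J, MemSobolev Ω t 1 (v J)) →
      famNormSq Ω t 1 v ≤ C * (famNormSq Ω t 0 (firstOrder Ω t c d v) +
        ∑ i, famNormSq Ω t 0 (fun J => wT Ω t (T i) (v J))) + D * famNormSq Ω t 0 v) :
    ∀ k : ℕ, k + 1 ≤ p → ∃ C : ℝ≥0, ∀ t : ℝ, ∃ D : ℝ≥0, ∀ v : σ → Cn n → ℂ,
      (∀ J, MemSobolev Ω t (k + 1) (v J)) →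
      famNormSq Ω t (k + 1) v ≤ C * (famNormSq Ω t k (firstOrder Ω t c d v) +
        ∑ i, famNormSq Ω t k (fun J => wT Ω t (T i) (v J))) + D * famNormSq Ω t k v := by
  intro k
  induction k with
  | zero => exact fun _ => hbase
  | succ k ih =>
    intro hk
    obtain ⟨C, hC⟩ := ih (by omega)
    choose C₁ hC₁ using fun i m => recNormSq_wT_wX_le (k := k) hΩ
      (fun l => (hT i l).mono (by omega : k + 1 ≤ p)) m
    -- The factor 2 is the loss in each commutator estimate, the cardinality comes from summing over
    -- the `X_m`; neither sees `t`.
    refine ⟨Fintype.card (Fin n × Fin 2) * (2 * C), fun t => ?_⟩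
    obtain ⟨D, hD⟩ := hC t
    obtain ⟨D₁, hD₁⟩ := famNormSq_firstOrder_wX_le hΩ c d k t
    obtain ⟨E, hE⟩ : ∃ E : Fin n × Fin 2 → ℝ≥0, ∀ m, E m = C * (D₁ + ∑ i, C₁ i m) + D :=
      ⟨_, fun _ => rfl⟩
    refine ⟨1 + ∑ m, E m, fun v hv => ?_⟩
    have hw : ∀ J, Wloc Ω (k + 2) (v J) := fun J => (hv J).wloc hΩ
    set A := famNormSq Ω t (k + 1) (firstOrder Ω t c d v)
    set B := ∑ i, famNormSq Ω t (k + 1) (fun J => wT Ω t (T i) (v J))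
    set V := famNormSq Ω t (k + 1) v
    -- The estimate of the previous order for the family `X_m v`, with the system and the fields
    -- moved past `X_m`.
    have step : ∀ m, famNormSq Ω t (k + 1) (fun J => wX Ω t m (v J)) ≤
        2 * C * (A + B) + E m * V := by
      intro m
      have h1 := hD₁ v m hw
      have h2 : ∀ i, famNormSq Ω t k (fun J => wT Ω t (T i) (wX Ω t m (v J))) ≤
          2 * famNormSq Ω t (k + 1) (fun J => wT Ω t (T i) (v J)) + C₁ i m * V := by
        intro i
        simp only [famNormSq, V, Finset.mul_sum]
        rw [← Finset.sum_add_distrib]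
        refine Finset.sum_le_sum fun J _ => (hC₁ i m t (v J) (hw J)).trans ?_
        gcongr
        exact recNormSq_wX_le
      calc _ ≤ C * (famNormSq Ω t k (firstOrder Ω t c d fun J => wX Ω t m (v J)) +
            ∑ i, famNormSq Ω t k (fun J => wT Ω t (T i) (wX Ω t m (v J)))) +
            D * famNormSq Ω t k (fun J => wX Ω t m (v J)) :=
            hD _ fun J => (hv J).wX m
        _ ≤ C * ((2 * A + D₁ * V) + ∑ i, (2 * famNormSq Ω t (k + 1)
              (fun J => wT Ω t (T i) (v J)) + C₁ i m * V)) + D * V := by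
            gcongr with i
            · exact h1.trans (by gcongr; exact famNormSq_mono (Nat.le_succ k) v)
            · exact h2 i
            · exact famNormSq_wX_le v m
        _ = _ := by
            rw [Finset.sum_add_distrib, ← Finset.mul_sum, ← Finset.sum_mul, hE]
            push_cast
            ring
    have e : famNormSq Ω t (k + 2) v = famNormSq Ω t 0 v +
        ∑ m, famNormSq Ω t (k + 1) (fun J => wX Ω t m (v J)) := by
      simp only [famNormSq]
      rw [Finset.sum_comm, ← Finset.sum_add_distrib]
      rfl
    rw [e]
    calc _ ≤ V + ∑ m, (2 * C * (A + B) + E m * V) := by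
          gcongr with m
          · exact famNormSq_mono (Nat.zero_le _) v
          · exact step m
      _ = _ := by
          rw [Finset.sum_add_distrib, Finset.sum_const, nsmul_eq_mul, ← Finset.sum_mul]
          push_cast
          rw [Finset.card_univ]
          ring

/-- `famNormSq_succ_le` trades a full derivative for one tangential derivative. The remaining norms
are those of `T_i^t v`, at one order less, so the induction hypothesis applies to them and turns
every derivative into a tangential one. -/
theorem famNormSq_le_tangential (hΩ : IsOpen Ω) (hT : ∀ i l, BddC Ω p (coef (T i) l))
    (hbase : ∃ C : ℝ≥0, ∀ t : ℝ, ∃ D : ℝ≥0, ∀ v : σ → Cn n → ℂ, (∀ J, MemSobolev Ω t 1 (v J)) →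
      famNormSq Ω t 1 v ≤ C * (famNormSq Ω t 0 (firstOrder Ω t c d v) +
        ∑ i, famNormSq Ω t 0 (fun J => wT Ω t (T i) (v J))) + D * famNormSq Ω t 0 v) :
    ∀ k : ℕ, k + 1 ≤ p → ∃ C : ℝ≥0, ∀ t : ℝ, ∃ D : ℝ≥0, ∀ v : σ → Cn n → ℂ,
      (∀ J, MemSobolev Ω t (k + 1) (v J)) →
      famNormSq Ω t (k + 1) v ≤ C * (famNormSq Ω t k (firstOrder Ω t c d v) +
        ∑ J, normSqTangential Ω t T (k + 1) (v J)) + D * famNormSq Ω t k v := by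
  have hR := famNormSq_succ_le hΩ hT hbase
  intro k
  induction k with
  | zero =>
    intro hk
    obtain ⟨C, hC⟩ := hR 0 hk
    refine ⟨C, fun t => ?_⟩
    obtain ⟨D, hD⟩ := hC t
    refine ⟨D, fun v hv => (hD v hv).trans_eq ?_⟩
    congr 3
    simp only [famNormSq, recNormSq, normSqTangential]
    rw [Finset.sum_comm]
  | succ k ih =>
    intro hk
    obtain ⟨C, hC⟩ := hR (k + 1) hk
    obtain ⟨C', hC'⟩ := ih (by omega)
    choose C₂ hC₂ using fun i => recNormSq_wT_le hΩ
      (fun l => (hT i l).mono (by omega : k ≤ p))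
    choose C₃ hC₃ using fun i => famNormSq_firstOrder_wT_le (k := k) hΩ c d
      (fun l => (hT i l).mono (by omega : k + 1 ≤ p))
    refine ⟨C * (1 + ∑ i, C' * C₃ i + C'), fun t => ?_⟩
    obtain ⟨D, hD⟩ := hC t
    obtain ⟨D', hD'⟩ := hC' t
    choose D₃ hD₃ using fun i => hC₃ i t
    refine ⟨C * ∑ i, (C' * D₃ i + D' * C₂ i) + D, fun v hv => ?_⟩
    have hw : ∀ J, Wloc Ω (k + 2) (v J) := fun J => (hv J).wloc hΩ
    set A := famNormSq Ω t (k + 1) (firstOrder Ω t c d v)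
    set B := ∑ J, normSqTangential Ω t T (k + 2) (v J)
    have hB : B = ∑ i, ∑ J, normSqTangential Ω t T (k + 1) (wT Ω t (T i) (v J)) := Finset.sum_comm
    set V := famNormSq Ω t (k + 1) v
    -- Induction hypothesis for `T_i^t v`: the system applied to `T_i^t v` is compared with the
    -- system applied to `v`, and the lower order norm of `T_i^t v` with that of `v`.
    have step : ∀ i, famNormSq Ω t (k + 1) (fun J => wT Ω t (T i) (v J)) ≤
        C' * C₃ i * A + C' * ∑ J, normSqTangential Ω t T (k + 1) (wT Ω t (T i) (v J)) +
          (C' * D₃ i + D' * C₂ i : ℝ≥0) * V := by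
      intro i
      have h1 := hD₃ i v hw
      have h2 : famNormSq Ω t k (fun J => wT Ω t (T i) (v J)) ≤ C₂ i * V := by
        simp only [famNormSq, V, Finset.mul_sum]
        exact Finset.sum_le_sum fun J _ => hC₂ i t (v J) (hw J).of_succ
      calc _ ≤ _ := hD' _ fun J => memSobolev_wT hΩ (fun l => (hT i l).mono (by omega)) (hv J)
        _ ≤ C' * ((C₃ i * A + D₃ i * V) +
            ∑ J, normSqTangential Ω t T (k + 1) (wT Ω t (T i) (v J))) + D' * (C₂ i * V) := by
            gcongr
        _ = _ := by push_cast; ring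
    calc _ ≤ _ := hD v hv
      _ ≤ C * (A + ∑ i, (C' * C₃ i * A + C' * ∑ J, normSqTangential Ω t T (k + 1)
            (wT Ω t (T i) (v J)) + (C' * D₃ i + D' * C₂ i : ℝ≥0) * V)) + D * V := by
          gcongr with i
          exact step i
      _ = C * ((1 + ∑ i, (C' : ℝ≥0∞) * C₃ i) * A + C' * B) +
            (C * ∑ i, (C' * D₃ i + D' * C₂ i) + D : ℝ≥0) * V := by
          rw [Finset.sum_add_distrib, Finset.sum_add_distrib, ← Finset.sum_mul, ← Finset.mul_sum,
            ← Finset.mul_sum, ← Finset.sum_mul, hB]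
          push_cast
          ring
      _ ≤ _ := by
          gcongr ?_ + _
          push_cast
          rw [mul_assoc]
          gcongr
          rw [mul_add]
          gcongr ?_ * _ + ?_ * _
          · exact le_self_add
          · exact le_add_self

end Induction

/-! ### Cut-off functions at a fixed scale. -/

section Cutoff

open scoped Convolution

/-- Smooth approximations of indicator functions at a fixed scale, with a gradient bound that does
not depend on the set. -/
theorem exists_smooth_cutoff (n : ℕ) {d : ℝ} (hd : 0 < d) : ∃ C : ℝ, 0 ≤ C ∧
    ∀ A : Set (Cn n), MeasurableSet A → ∃ b : Cn n → ℝ, ContDiff ℝ ∞ b ∧ (∀ x, 0 ≤ b x) ∧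
      (∀ x, b x ≤ 1) ∧ (∀ x, ball x d ⊆ A → b x = 1) ∧ (∀ x, Disjoint (ball x d) A → b x = 0) ∧
      ∀ x, ‖fderiv ℝ b x‖ ≤ C := by
  let φ : ContDiffBump (0 : Cn n) := ⟨d / 2, d, half_pos hd, half_lt_self hd⟩
  set L : ℝ →L[ℝ] ℝ →L[ℝ] ℝ := ContinuousLinearMap.lsmul ℝ ℝ with hL
  have hφd : ContDiff ℝ ∞ (φ.normed volume) := φ.contDiff_normed
  have hφc : HasCompactSupport (φ.normed volume) := φ.hasCompactSupport_normed
  have hφi : Integrable (fun x => ‖fderiv ℝ (φ.normed volume) x‖) :=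
    ((hφd.continuous_fderiv (by simp)).norm).integrable_of_hasCompactSupport (hφc.fderiv ℝ).norm
  refine ⟨∫ x, ‖fderiv ℝ (φ.normed volume) x‖, integral_nonneg fun _ => norm_nonneg _,
    fun A hA => ?_⟩
  -- The cut-off is the convolution of this indicator with one fixed bump, so its gradient is
  -- bounded by the `L¹` norm of the gradient of the bump, whatever `A` is.
  let g : Cn n → ℝ := A.indicator 1
  have hg0 : ∀ x, 0 ≤ g x := fun x => indicator_nonneg (fun _ _ => zero_le_one) x
  have hg1 : ∀ x, g x ≤ 1 := fun x => indicator_le_self' (fun _ _ => zero_le_one) x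
  have hgl : LocallyIntegrable g volume := (locallyIntegrable_const (1 : ℝ)).indicator hA
  have hφint : Integrable (φ.normed volume) :=
    hφd.continuous.integrable_of_hasCompactSupport hφc
  have hdef : ∀ x, (φ.normed volume ⋆[L, volume] g) x = ∫ y, φ.normed volume y * g (x - y) :=
    fun x => rfl
  refine ⟨φ.normed volume ⋆[L, volume] g, hφc.contDiff_convolution_left L hφd hgl,
    fun x => ?_, fun x => ?_, fun x hx => ?_, fun x hx => ?_, fun x => ?_⟩
  · rw [hdef]
    exact integral_nonneg fun y => mul_nonneg (φ.nonneg_normed y) (hg0 _)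
  · rw [hdef, ← φ.integral_normed (μ := volume)]
    refine integral_mono_of_nonneg (Eventually.of_forall fun y =>
      mul_nonneg (φ.nonneg_normed y) (hg0 _)) hφint (Eventually.of_forall fun y => ?_)
    exact mul_le_of_le_one_right (φ.nonneg_normed y) (hg1 _)
  · have h1 : ∀ y ∈ ball x d, g y = 1 := fun y hy => indicator_of_mem (hx hy) _
    rw [hL, ContDiffBump.normed_convolution_eq_right]
    · exact h1 x (mem_ball_self hd)
    · intro y hy; rw [h1 y hy, h1 x (mem_ball_self hd)]
  · have h1 : ∀ y ∈ ball x d, g y = 0 := fun y hy =>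
      indicator_of_notMem (fun h => disjoint_left.1 hx hy h) _
    rw [hL, ContDiffBump.normed_convolution_eq_right]
    · exact h1 x (mem_ball_self hd)
    · intro y hy; rw [h1 y hy, h1 x (mem_ball_self hd)]
  · rw [(hφc.hasFDerivAt_convolution_left L (hφd.of_le (by simp)) hgl x).fderiv]
    refine norm_integral_le_of_norm_le hφi (Eventually.of_forall fun y => ?_)
    refine ContinuousLinearMap.opNorm_le_bound _ (norm_nonneg _) fun v => ?_
    rw [ContinuousLinearMap.precompL_apply, hL, ContinuousLinearMap.lsmul_apply, norm_smul,
      Real.norm_of_nonneg (hg0 _)]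
    exact (mul_le_of_le_one_right (norm_nonneg _) (hg1 _)).trans
      (ContinuousLinearMap.le_opNorm _ _)

end Cutoff

/-! ### Which directions the tangential fields control. -/

section Geometry

variable {n m : ℕ} {Ω U : Set (Cn n)} {ρ : Cn n → ℝ} {ι : Type*} [Fintype ι]
  {T : ι → Cn n → Cn n}

/-- Multiplication by `i` on `ℂⁿ`. -/
def rotJ {n : ℕ} (x : Cn n) : Cn n :=
  WithLp.toLp 2 fun l => if l.2 = 0 then -x (l.1, 1) else x (l.1, 0)

theorem rotJ_zero_coord (x : Cn n) (j : Fin n) : rotJ x (j, 0) = -x (j, 1) := by simp [rotJ]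

theorem rotJ_one_coord (x : Cn n) (j : Fin n) : rotJ x (j, 1) = x (j, 0) := by simp [rotJ]

theorem norm_rotJ (x : Cn n) : ‖rotJ x‖ ^ 2 = ‖x‖ ^ 2 := by
  simp only [EuclideanSpace.norm_sq_eq, Fintype.sum_prod_type, Fin.sum_univ_two, rotJ_zero_coord,
    rotJ_one_coord, Real.norm_eq_abs, sq_abs]
  refine Finset.sum_congr rfl fun j _ => ?_
  ring

theorem inner_rotJ_self (x : Cn n) : inner ℝ x (rotJ x) = 0 := by
  simp only [PiLp.inner_apply, Fintype.sum_prod_type, Fin.sum_univ_two, rotJ_zero_coord,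
    rotJ_one_coord]
  refine Finset.sum_eq_zero fun j _ => ?_
  simp; ring

/-- A real linear functional on the real plane spanned by `x` and `ix` has a kernel, so some
unimodular multiple of `x` is annihilated. -/
theorem exists_rotation_mem_ker (x : Cn n) (ν : Cn n →L[ℝ] ℝ) :
    ∃ α β : ℝ, α ^ 2 + β ^ 2 = 1 ∧ ν (α • x + β • rotJ x) = 0 := by
  by_cases h : (ν x) ^ 2 + (ν (rotJ x)) ^ 2 = 0
  · have h1 : ν x = 0 := by nlinarith [sq_nonneg (ν x), sq_nonneg (ν (rotJ x))]
    exact ⟨1, 0, by norm_num, by simp [h1]⟩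
  · have hpos : 0 < (ν x) ^ 2 + (ν (rotJ x)) ^ 2 := lt_of_le_of_ne (by positivity) (Ne.symm h)
    set s := Real.sqrt ((ν x) ^ 2 + (ν (rotJ x)) ^ 2) with hs
    have hs0 : 0 < s := Real.sqrt_pos.2 hpos
    have hss : s ^ 2 = (ν x) ^ 2 + (ν (rotJ x)) ^ 2 := Real.sq_sqrt hpos.le
    refine ⟨ν (rotJ x) / s, -(ν x) / s, ?_, ?_⟩
    · field_simp; rw [hss]; ring
    · simp only [map_add, map_smul, smul_eq_mul]; field_simp; ring

/-- Near the boundary the spanning condition is applied to a rotation of `x` in its complex line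
that is tangential to the level set; Cauchy–Schwarz with `α² + β² = 1` replaces that combination by
both inner products. Non-radiality is not needed, because `ix` is allowed as well as `x`. -/
theorem IsTangentialGradient.exists_radial_bound {p : ℕ} (hT : IsTangentialGradient Ω p ρ U T) :
    ∃ c : ℝ, 0 < c ∧ ∀ x ∈ Ω,
      c * ‖x‖ ^ 2 ≤ ∑ i, ((inner ℝ (T i x) x) ^ 2 + (inner ℝ (T i x) (rotJ x)) ^ 2) := by
  obtain ⟨ε₁, ε₂, r, c, _, _, _, hc, _, _, h₂, h₃⟩ := hT.tangential_span
  refine ⟨c, hc, fun x hx => ?_⟩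
  by_cases hxt : x ∈ thickening ε₂ (frontier Ω)
  · obtain ⟨α, β, hαβ, hν⟩ := exists_rotation_mem_ker x (fderiv ℝ ρ x)
    have h := h₂ x ⟨hx, hxt⟩ _ hν
    have hn : ‖α • x + β • rotJ x‖ ^ 2 = ‖x‖ ^ 2 := by
      rw [norm_add_sq_real, inner_smul_left, inner_smul_right, inner_rotJ_self, norm_smul,
        norm_smul, mul_pow, mul_pow, norm_rotJ, Real.norm_eq_abs, Real.norm_eq_abs, sq_abs, sq_abs]
      simp only [mul_zero, add_zero]
      rw [← add_mul, hαβ, one_mul]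
    rw [hn] at h
    refine h.trans (Finset.sum_le_sum fun i _ => ?_)
    rw [inner_add_right, inner_smul_right, inner_smul_right]
    nlinarith [sq_nonneg (α * inner ℝ (T i x) (rotJ x) - β * inner ℝ (T i x) x)]
  · refine (h₃ x ⟨hx, hxt⟩ x).trans (Finset.sum_le_sum fun i _ => ?_)
    exact le_add_of_nonneg_right (sq_nonneg _)

/-- Data near the boundary extracted from the hypotheses: on a uniform neighbourhood of the
boundary, the vector fields are tangential to the level sets of `ρ`, they span the tangential
directions, and far from the origin they control the radial direction. -/
theorem exists_boundary_neighborhood (hm : 2 ≤ m) (hρ : IsUniformDefiningFunction Ω m ρ U)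
    (hnr : AsymptoticallyNonradial Ω ρ) {p : ℕ} (hT : IsTangentialGradient Ω p ρ U T) :
    ∃ δ c R : ℝ, 0 < δ ∧ 0 < c ∧ 0 ≤ R ∧ thickening δ (frontier Ω) ⊆ U ∧
      ∀ x ∈ Ω ∩ thickening δ (frontier Ω), fderiv ℝ ρ x ≠ 0 ∧ (∀ i, fderiv ℝ ρ x (T i x) = 0) ∧
        (∀ ξ : Cn n, fderiv ℝ ρ x ξ = 0 → c * ‖ξ‖ ^ 2 ≤ ∑ i, (inner ℝ (T i x) ξ) ^ 2) ∧
        (R ≤ ‖x‖ → c * ‖x‖ ^ 2 ≤ ∑ i, (inner ℝ (T i x) x) ^ 2) := by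
  obtain ⟨ε₁, ε₂, r, c, hε₁, hε₁₂, hεr, hc, hrU, h₁, h₂, h₃⟩ := hT.tangential_span
  obtain ⟨r₀, hr₀, γ₀, hγ₀, hγ⟩ := hnr
  obtain ⟨M₀, hM₀⟩ := hρ.bounded
  obtain ⟨c₀, hc₀, hgrad⟩ := hρ.grad_pos
  set M := max M₀ 0 + 1 with hM
  have hMpos : 0 < M := by positivity
  set γ := max γ₀ 0 with hγd
  have hγ1 : γ < 1 := max_lt hγ₀ one_pos
  have hγ0 : 0 ≤ γ := le_max_right _ _
  -- Small enough that moving from a boundary point to a point within `δ` changes the radial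
  -- quotient by at most half of its gap `1 - γ`. The factor 5 collects the error terms in `hrad`.
  set δ := min (min ε₁ 1) ((1 - γ) * c₀ / (10 * M)) with hδ
  have hδpos : 0 < δ := by
    refine lt_min (lt_min hε₁ one_pos) (div_pos (mul_pos (by linarith) hc₀) (by positivity))
  have hδε : δ ≤ ε₁ := (min_le_left _ _).trans (min_le_left _ _)
  have hδ1 : δ ≤ 1 := (min_le_left _ _).trans (min_le_right _ _)
  have hδM : 5 * δ * M ≤ (1 - γ) / 2 * c₀ := by
    have : δ ≤ (1 - γ) * c₀ / (10 * M) := min_le_right _ _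
    rw [le_div_iff₀ (by positivity)] at this
    linarith
  have hD1 : ∀ x ∈ U, ‖fderiv ℝ ρ x‖ ≤ M := by
    intro x hx
    have := hM₀ 1 (by omega) x hx
    rw [norm_iteratedFDeriv_one] at this
    linarith [le_max_left M₀ 0]
  have hD2 : ∀ x ∈ U, ‖fderiv ℝ (fderiv ℝ ρ) x‖ ≤ M := by
    intro x hx
    have := hM₀ 2 hm x hx
    rw [← norm_iteratedFDeriv_fderiv, norm_iteratedFDeriv_one] at this
    linarith [le_max_left M₀ 0]
  have hdiff : ∀ x ∈ U, DifferentiableAt ℝ (fderiv ℝ ρ) x := by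
    intro x hx
    have h2 : ContDiffAt ℝ 2 ρ x :=
      (hρ.contDiffOn.contDiffAt (hρ.isOpen.mem_nhds hx)).of_le (by exact_mod_cast hm)
    exact (h2.fderiv_right (m := 1) (by norm_num)).differentiableAt (by norm_num)
  set γ' := (1 + γ) / 2 with hγ'
  have hγ'1 : γ' < 1 := by rw [hγ']; linarith
  have hγ'0 : 0 ≤ γ' := by rw [hγ']; linarith
  have hγ'2 : 0 < 1 - γ' ^ 2 := by nlinarith
  have hle : thickening δ (frontier Ω) ⊆ thickening ε₁ (frontier Ω) := thickening_mono hδε _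
  refine ⟨δ, c * (1 - γ' ^ 2), r₀ + 2, hδpos, mul_pos hc hγ'2, by linarith,
    hle.trans ((thickening_mono (hε₁₂.trans hεr.le) _).trans hrU), ?_⟩
  rintro x ⟨hxΩ, hxt⟩
  have hxU : x ∈ U := hrU (thickening_mono (hδε.trans (hε₁₂.trans hεr.le)) _ hxt)
  have hDpos : 0 < ‖fderiv ℝ ρ x‖ := hc₀.trans_le (hgrad x hxU)
  have htan := h₁ x ⟨hxΩ, hle hxt⟩
  have hspan := h₂ x ⟨hxΩ, thickening_mono (hδε.trans hε₁₂) _ hxt⟩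
  refine ⟨norm_pos_iff.1 hDpos, htan, fun ξ hξ => ?_, fun hR => ?_⟩
  · refine le_trans ?_ (hspan ξ hξ)
    have : 1 - γ' ^ 2 ≤ 1 := by nlinarith [sq_nonneg γ']
    have h0 : 0 ≤ c * ‖ξ‖ ^ 2 := by positivity
    nlinarith
  obtain ⟨y, hy, hxy⟩ := mem_thickening_iff.1 hxt
  have hballU : ball y r ⊆ U := fun z hz => hrU (mem_thickening_iff.2 ⟨y, hy, hz⟩)
  have hyU : y ∈ U := hballU (mem_ball_self (by linarith))
  have hLip : ‖fderiv ℝ ρ x - fderiv ℝ ρ y‖ ≤ M * ‖x - y‖ :=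
    (convex_ball y r).norm_image_sub_le_of_norm_fderiv_le (𝕜 := ℝ)
      (fun z hz => hdiff z (hballU hz)) (fun z hz => hD2 z (hballU hz))
      (mem_ball_self (by linarith)) (by rw [mem_ball]; linarith)
  rw [dist_eq_norm] at hxy
  have hyn : ‖y‖ ≤ ‖x‖ + δ := by
    have := norm_le_norm_add_norm_sub' y x
    rw [norm_sub_rev] at this; linarith
  have hyn' : r₀ < ‖y‖ := by
    have := norm_le_norm_add_norm_sub' x y
    linarith
  have hx1 : 1 ≤ ‖x‖ := by linarith
  have hDy : ‖fderiv ℝ ρ y‖ ≤ ‖fderiv ℝ ρ x‖ + M * δ := by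
    have h1 := norm_le_norm_add_norm_sub' (fderiv ℝ ρ y) (fderiv ℝ ρ x)
    rw [norm_sub_rev] at h1
    have : M * ‖x - y‖ ≤ M * δ := mul_le_mul_of_nonneg_left hxy.le hMpos.le
    linarith
  -- Non-radiality is assumed only on the boundary. It is carried from a nearby boundary point `y`
  -- to `x` by the bound on the second derivatives of `ρ`, at the price of replacing `γ` by the
  -- midpoint `γ'` of `γ` and 1. Taking `R = r₀ + 2` ensures `|y| > r₀` and `|x| ≥ 1`.
  have hrad : |fderiv ℝ ρ x x| ≤ γ' * (‖x‖ * ‖fderiv ℝ ρ x‖) := by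
    have e : fderiv ℝ ρ x x = fderiv ℝ ρ y y + fderiv ℝ ρ y (x - y) +
        (fderiv ℝ ρ x - fderiv ℝ ρ y) x := by
      simp only [map_sub, sub_apply]; ring
    have b1 : |fderiv ℝ ρ y y| ≤ γ * ((‖x‖ + δ) * (‖fderiv ℝ ρ x‖ + M * δ)) := by
      refine (hγ y hy hyn').trans ?_
      have : γ₀ * (‖y‖ * ‖fderiv ℝ ρ y‖) ≤ γ * (‖y‖ * ‖fderiv ℝ ρ y‖) :=
        mul_le_mul_of_nonneg_right (le_max_left _ _) (by positivity)
      refine this.trans ?_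
      gcongr
    have b2 : |fderiv ℝ ρ y (x - y)| ≤ M * δ := by
      have := (fderiv ℝ ρ y).le_opNorm (x - y)
      rw [Real.norm_eq_abs] at this
      refine this.trans (mul_le_mul (hD1 y hyU) hxy.le (norm_nonneg _) hMpos.le)
    have b3 : |(fderiv ℝ ρ x - fderiv ℝ ρ y) x| ≤ M * δ * ‖x‖ := by
      have := (fderiv ℝ ρ x - fderiv ℝ ρ y).le_opNorm x
      rw [Real.norm_eq_abs] at this
      refine this.trans (mul_le_mul_of_nonneg_right (hLip.trans ?_) (norm_nonneg _))
      exact mul_le_mul_of_nonneg_left hxy.le hMpos.le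
    have b4 : |fderiv ℝ ρ x x| ≤ γ * ((‖x‖ + δ) * (‖fderiv ℝ ρ x‖ + M * δ)) + M * δ +
        M * δ * ‖x‖ := by
      rw [e]
      refine (abs_add_le _ _).trans (add_le_add ((abs_add_le _ _).trans (add_le_add b1 b2)) b3)
    have hDM := hD1 x hxU
    have hX := norm_nonneg x
    set X := ‖x‖
    set D := ‖fderiv ℝ ρ x‖
    have q1 : γ * ((X + δ) * (D + M * δ)) ≤ γ * (X * D) + 3 * (δ * M) * X := by
      have : (X + δ) * (D + M * δ) - X * D ≤ 3 * (δ * M) * X := by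
        have a1 : δ * D ≤ δ * M * X := by
          calc δ * D ≤ δ * M := by gcongr
            _ ≤ δ * M * X := le_mul_of_one_le_right (by positivity) hx1
        have a2 : M * δ * δ ≤ δ * M * X := by
          calc M * δ * δ ≤ M * δ * 1 := by gcongr
            _ = δ * M := by ring
            _ ≤ δ * M * X := le_mul_of_one_le_right (by positivity) hx1
        have a3 : (X + δ) * (D + M * δ) - X * D = δ * M * X + δ * D + M * δ * δ := by ring
        have a4 : 3 * (δ * M) * X = 3 * (δ * M * X) := by ring
        linarith
      have h3 : 0 ≤ 3 * (δ * M) * X := by positivity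
      calc γ * ((X + δ) * (D + M * δ)) = γ * (X * D) + γ * ((X + δ) * (D + M * δ) - X * D) := by
            ring
        _ ≤ γ * (X * D) + γ * (3 * (δ * M) * X) := by gcongr
        _ ≤ γ * (X * D) + 1 * (3 * (δ * M) * X) := by gcongr
        _ = _ := by ring
    have q2 : M * δ ≤ δ * M * X := by
      rw [mul_comm M]; exact le_mul_of_one_le_right (by positivity) hx1
    have q3 : 5 * (δ * M * X) ≤ (1 - γ) / 2 * (X * D) := by
      calc 5 * (δ * M * X) = 5 * δ * M * X := by ring
        _ ≤ (1 - γ) / 2 * c₀ * X := mul_le_mul_of_nonneg_right hδM hX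
        _ ≤ (1 - γ) / 2 * D * X :=
          mul_le_mul_of_nonneg_right (mul_le_mul_of_nonneg_left (hgrad x hxU) (by linarith)) hX
        _ = _ := by ring
    have q4 : γ' * (X * D) = γ * (X * D) + (1 - γ) / 2 * (X * D) := by rw [hγ']; ring
    have q5 : 3 * (δ * M) * X = 3 * (δ * M * X) := by ring
    have q6 : M * δ * X = δ * M * X := by ring
    linarith
  -- Remove from `x` its component along the gradient. The rest is tangential and has squared length
  -- at least `(1 - γ'²) |x|²`, while its inner products with the tangential fields are those of
  -- `x`.
  set g := (InnerProductSpace.toDual ℝ (Cn n)).symm (fderiv ℝ ρ x) with hg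
  have hgin : ∀ z, inner ℝ g z = fderiv ℝ ρ x z := fun z =>
    InnerProductSpace.toDual_symm_apply
  have hgn : ‖g‖ = ‖fderiv ℝ ρ x‖ := LinearIsometryEquiv.norm_map _ _
  have hg2 : ‖g‖ ^ 2 ≠ 0 := by rw [hgn]; positivity
  set s := fderiv ℝ ρ x x / ‖g‖ ^ 2 with hs
  have hker : fderiv ℝ ρ x (x - s • g) = 0 := by
    rw [map_sub, map_smul, ← hgin g, real_inner_self_eq_norm_sq, smul_eq_mul, hs,
      div_mul_cancel₀ _ hg2, sub_self]
  have h := hspan _ hker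
  have hin : ∀ i, inner ℝ (T i x) (x - s • g) = inner ℝ (T i x) x := by
    intro i
    rw [inner_sub_right, inner_smul_right, real_inner_comm g (T i x), hgin, htan i, mul_zero, sub_zero]
  simp only [hin] at h
  refine le_trans ?_ h
  have hnorm : ‖x - s • g‖ ^ 2 = ‖x‖ ^ 2 - (fderiv ℝ ρ x x) ^ 2 / ‖g‖ ^ 2 := by
    rw [norm_sub_sq_real, inner_smul_right, real_inner_comm, hgin, norm_smul, mul_pow,
      Real.norm_eq_abs, sq_abs, hs]
    field_simp; ring
  rw [mul_assoc]
  gcongr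
  rw [hnorm]
  have : (fderiv ℝ ρ x x) ^ 2 / ‖g‖ ^ 2 ≤ γ' ^ 2 * ‖x‖ ^ 2 := by
    rw [div_le_iff₀ (by positivity), hgn, ← sq_abs]
    calc |fderiv ℝ ρ x x| ^ 2 ≤ (γ' * (‖x‖ * ‖fderiv ℝ ρ x‖)) ^ 2 := by gcongr
      _ = _ := by ring
  linarith

end Geometry

/-! ### Weighted integration by parts. -/

section Parts

variable {n : ℕ} {Ω : Set (Cn n)} {t : ℝ} {l : Fin n × Fin 2} {f g : Cn n → ℂ}

/-- The weight `e^{-t|z|²}`, as a complex valued function. -/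
noncomputable def wt {n : ℕ} (t : ℝ) (x : Cn n) : ℂ := ((Real.exp (-t * ‖x‖ ^ 2) : ℝ) : ℂ)

theorem contDiff_wt : ContDiff ℝ ∞ (wt t : Cn n → ℂ) :=
  Complex.ofRealCLM.contDiff.comp
    (Real.contDiff_exp.comp (contDiff_const.mul (contDiff_norm_sq ℝ)))

theorem pd_wt (x : Cn n) : pd l (wt t) x = -2 * t * (x l : ℂ) * wt t x := by
  have h1 := ((hasStrictFDerivAt_norm_sq x).hasFDerivAt.const_mul (-t)).exp
  have h2 := Complex.ofRealCLM.hasFDerivAt.comp x h1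
  change fderiv ℝ (⇑Complex.ofRealCLM ∘ fun x : Cn n => Real.exp (-t * ‖x‖ ^ 2)) x _ = _
  rw [h2.fderiv]
  simp [wt, EuclideanSpace.inner_single_right]
  ring

theorem pd_mul {u v : Cn n → ℂ} {x : Cn n} (hu : DifferentiableAt ℝ u x)
    (hv : DifferentiableAt ℝ v x) :
    pd l (fun x => u x * v x) x = u x * pd l v x + pd l u x * v x := by
  have := (hu.hasFDerivAt.mul hv.hasFDerivAt).fderiv
  change fderiv ℝ (fun x => u x * v x) x _ = _
  rw [show (fun x => u x * v x) = u * v from rfl, this]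
  simp [mul_comm]

theorem pd_conj {u : Cn n → ℂ} {x : Cn n} (hu : DifferentiableAt ℝ u x) :
    pd l (fun x => (starRingEnd ℂ) (u x)) x = (starRingEnd ℂ) (pd l u x) := by
  have := (Complex.conjCLE.toContinuousLinearMap.hasFDerivAt.comp x hu.hasFDerivAt)
  change fderiv ℝ (⇑Complex.conjCLE.toContinuousLinearMap ∘ u) x _ = _
  rw [this.fderiv]; rfl

theorem pd_ofReal {u : Cn n → ℝ} {x : Cn n} (hu : DifferentiableAt ℝ u x) :
    pd l (fun x => ((u x : ℝ) : ℂ)) x = ((pd l u x : ℝ) : ℂ) := by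
  have := (Complex.ofRealCLM.hasFDerivAt.comp x hu.hasFDerivAt)
  change fderiv ℝ (⇑Complex.ofRealCLM ∘ u) x _ = _
  rw [this.fderiv]; rfl

theorem pd_eq_zero_of_notMem {F : Type*} [NormedAddCommGroup F] [NormedSpace ℝ F] {u : Cn n → F}
    {x : Cn n} (hx : x ∉ tsupport u) : pd l u x = 0 := by
  rw [pd, fderiv_of_notMem_tsupport ℝ hx, zero_apply]

theorem memLp_mul_of_hasCompactSupport {θ : Cn n → ℂ} (hθ : Continuous θ) (hc : HasCompactSupport θ)
    (hf : MemLp f 2 (volume.restrict (tsupport θ))) : MemLp (fun x => θ x * f x) 2 volume := by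
  obtain ⟨B, hB⟩ := hc.exists_bound_of_continuous hθ
  have h1 : MemLp (fun x => θ x * f x) 2 (volume.restrict (tsupport θ)) :=
    (hf.const_mul (B : ℂ)).of_le (hθ.aestronglyMeasurable.mul hf.1) (Eventually.of_forall fun x => by
      rw [norm_mul, norm_mul]
      gcongr
      exact (hB x).trans (by simpa using le_abs_self B))
  rw [← memLp_indicator_iff_restrict (isClosed_tsupport θ).measurableSet] at h1
  rwa [indicator_eq_self.2 fun x hx => subset_tsupport _ (left_ne_zero_of_mul hx)] at h1

/-- Cutting off a function with a locally square integrable weak gradient. -/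
theorem compactH1_of_hasWeakDeriv (hΩ : IsOpen Ω) {g : Fin n × Fin 2 → Cn n → ℂ}
    (h : ∀ l, HasWeakDeriv Ω l f (g l)) (hf : ∀ K, IsCompact K → K ⊆ Ω → MemLp f 2 (volume.restrict K))
    (hg : ∀ l K, IsCompact K → K ⊆ Ω → MemLp (g l) 2 (volume.restrict K)) {θ : Cn n → ℂ}
    (hθ : ContDiff ℝ 1 θ) (hc : HasCompactSupport θ) (hs : tsupport θ ⊆ Ω) :
    CompactH1 (fun x => θ x * f x) (fun l x => θ x * g l x + pd l θ x * f x) where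
  memLp := memLp_mul_of_hasCompactSupport hθ.continuous hc (hf _ hc.isCompact hs)
  memLp_deriv l := by
    have h1 := memLp_mul_of_hasCompactSupport hθ.continuous hc (hg l _ hc.isCompact hs)
    have hpc : HasCompactSupport (pd l θ) := hc.fderiv_apply (𝕜 := ℝ) _
    have hps : tsupport (pd l θ) ⊆ Ω := (tsupport_fderiv_apply_subset ℝ _).trans hs
    exact h1.add (memLp_mul_of_hasCompactSupport
      ((hθ.continuous_fderiv one_ne_zero).clm_apply continuous_const) hpc (hf _ hpc.isCompact hps))
  compact := hc.mul_right
  compact_deriv l := by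
    have hpc : HasCompactSupport (pd l θ) := hc.fderiv_apply (𝕜 := ℝ) _
    exact (hc.mul_right (f' := g l)).add (hpc.mul_right (f' := f))
  weak l φ hφ := by
    have h1 := (h l).integral_test hΩ (φ := fun x => φ x * θ x)
      ((hφ.of_le (by simp)).mul hθ) hc.mul_left ((tsupport_mul_subset_right).trans hs)
    have e : ∀ x, pd l (fun x => φ x * θ x) x = φ x * pd l θ x + pd l φ x * θ x := fun x =>
      pd_mul ((hφ.differentiable (by simp)) x) ((hθ.differentiable one_ne_zero) x)
    simp only [e] at h1
    have hpc : HasCompactSupport (pd l θ) := hc.fderiv_apply (𝕜 := ℝ) _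
    have hps : tsupport (pd l θ) ⊆ Ω := (tsupport_fderiv_apply_subset ℝ _).trans hs
    have hdc : Continuous (pd l θ) := (hθ.continuous_fderiv one_ne_zero).clm_apply continuous_const
    have hpφ : Continuous (pd l φ) := (hφ.continuous_fderiv (by simp)).clm_apply continuous_const
    have i1 : Integrable fun x => (φ x * pd l θ x) * f x :=
      integrableOn_mul_of_hasCompactSupport (h l).1 (hφ.continuous.mul hdc).continuousOn
        hpc.mul_left ((tsupport_mul_subset_right).trans hps)
    have i2 : Integrable fun x => (pd l φ x * θ x) * f x :=
      integrableOn_mul_of_hasCompactSupport (h l).1 (hpφ.mul hθ.continuous).continuousOn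
        hc.mul_left ((tsupport_mul_subset_right).trans hs)
    have i3 : Integrable fun x => (φ x * θ x) * g l x :=
      integrableOn_mul_of_hasCompactSupport (h l).2.1 (hφ.continuous.mul hθ.continuous).continuousOn
        hc.mul_left ((tsupport_mul_subset_right).trans hs)
    have h2 : ∫ x, (φ x * pd l θ x + pd l φ x * θ x) * f x =
        (∫ x, (φ x * pd l θ x) * f x) + ∫ x, (pd l φ x * θ x) * f x := by
      rw [← integral_add i1 i2]; congr 1; ext x; ring
    have h3 : ∫ x, φ x * (θ x * g l x + pd l θ x * f x) =
        (∫ x, (φ x * θ x) * g l x) + ∫ x, (φ x * pd l θ x) * f x := by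
      rw [← integral_add i3 i1]; congr 1; ext x; ring
    rw [h2] at h1
    rw [h3]
    have h4 : ∫ x, pd l φ x * (θ x * f x) = ∫ x, (pd l φ x * θ x) * f x := by
      congr 1; ext x; ring
    rw [h4]
    linear_combination h1

theorem MemSobolev.hasWeakDeriv (hΩ : IsOpen Ω) {k : ℕ} (hf : MemSobolev Ω t (k + 1) f)
    (l : Fin n × Fin 2) : HasWeakDeriv Ω l f (weakDeriv Ω l f) :=
  (hf.wloc hΩ).hasWeakDeriv l

theorem MemSobolev.memLp {k : ℕ} (hf : MemSobolev Ω t k f) : MemLp f 2 (wMeasure Ω t) := by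
  cases k with
  | zero => exact hf
  | succ k => exact hf.1

theorem weakDeriv_eq_wX (x : Cn n) :
    weakDeriv Ω l f x = wX Ω t l f x + 2 * t * (x l : ℂ) * f x := by
  simp only [wX]; ring

theorem MemSobolev.memLp_weakDeriv_restrict (hf : MemSobolev Ω t 1 f) {K : Set (Cn n)}
    (hK : IsCompact K) (hKΩ : K ⊆ Ω) : MemLp (weakDeriv Ω l f) 2 (volume.restrict K) := by
  have h1 := memLp_restrict_of_memLp (hf.wX l).memLp hK hKΩ
  have h2 := memLp_restrict_of_memLp hf.memLp hK hKΩ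
  obtain ⟨B, hB⟩ : ∃ B, ∀ x ∈ K, ‖(2 * t * (x l : ℂ) : ℂ)‖ ≤ B :=
    hK.exists_bound_of_continuousOn (by fun_prop)
  have h3 : MemLp (fun x => (2 * t * (x l : ℂ)) * f x) 2 (volume.restrict K) :=
    (h2.const_mul (B : ℂ)).of_le
      ((by fun_prop : Continuous fun x : Cn n => (2 * t * (x l : ℂ) : ℂ)).aestronglyMeasurable.mul h2.1)
      ((ae_restrict_iff' hK.measurableSet).2 (Eventually.of_forall fun x hx => by
        rw [norm_mul, norm_mul (B : ℂ)]
        gcongr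
        exact (hB x hx).trans (by simpa using le_abs_self B)))
  refine (h1.add h3).congr_norm (h1.add h3).1 (Eventually.of_forall fun x => rfl) |>.ae_eq ?_
  exact Eventually.of_forall fun x => (weakDeriv_eq_wX x).symm

theorem MemSobolev.compactH1 (hΩ : IsOpen Ω) (hf : MemSobolev Ω t 1 f) {θ : Cn n → ℂ}
    (hθ : ContDiff ℝ 1 θ) (hc : HasCompactSupport θ) (hs : tsupport θ ⊆ Ω) :
    CompactH1 (fun x => θ x * f x) (fun l x => θ x * weakDeriv Ω l f x + pd l θ x * f x) :=
  compactH1_of_hasWeakDeriv hΩ (fun l => hf.hasWeakDeriv hΩ l)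
    (fun _ hK hKΩ => memLp_restrict_of_memLp hf.memLp hK hKΩ)
    (fun _ _ hK hKΩ => hf.memLp_weakDeriv_restrict hK hKΩ) hθ hc hs

variable {F G : Cn n → ℂ} {DF DG : Fin n × Fin 2 → Cn n → ℂ}

theorem CompactH1.conj (hF : CompactH1 F DF) :
    CompactH1 (fun x => (starRingEnd ℂ) (F x)) (fun l x => (starRingEnd ℂ) (DF l x)) where
  memLp := hF.memLp.star
  memLp_deriv l := (hF.memLp_deriv l).star
  compact := hF.compact.comp_left (g := starRingEnd ℂ) (map_zero _)
  compact_deriv l := (hF.compact_deriv l).comp_left (g := starRingEnd ℂ) (map_zero _)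
  weak l φ hφ := by
    have h := hF.weak l (fun x => (starRingEnd ℂ) (φ x))
      (Complex.conjCLE.toContinuousLinearMap.contDiff.comp hφ)
    simp only [pd_conj ((hφ.differentiable (by simp)) _)] at h
    have h' := congrArg (starRingEnd ℂ) h
    rw [map_neg, ← integral_conj, ← integral_conj] at h'
    simpa using h'

theorem memLp_continuous_mul {Q u : Cn n → ℂ} (hQ : MemLp Q 2 volume) (hQc : HasCompactSupport Q)
    (hu : Continuous u) : MemLp (fun x => u x * Q x) 2 volume := by
  obtain ⟨B, hB⟩ : ∃ B, ∀ x ∈ tsupport Q, ‖u x‖ ≤ B :=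
    hQc.isCompact.exists_bound_of_continuousOn hu.continuousOn
  refine (hQ.const_mul (B : ℂ)).of_le (hu.aestronglyMeasurable.mul hQ.1)
    (Eventually.of_forall fun x => ?_)
  rw [norm_mul, norm_mul]
  by_cases hx : x ∈ tsupport Q
  · gcongr
    exact (hB x hx).trans (by simpa using le_abs_self B)
  · simp [image_eq_zero_of_notMem_tsupport hx]

/-- No bound on `h` is required, as `F` has compact support; used with the weight and with
coordinate functions. -/
theorem CompactH1.mul_smooth (hF : CompactH1 F DF) {h : Cn n → ℂ} (hh : ContDiff ℝ ∞ h) :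
    CompactH1 (fun x => h x * F x) (fun l x => h x * DF l x + pd l h x * F x) := by
  have key : ∀ {Q u : Cn n → ℂ}, MemLp Q 2 volume → HasCompactSupport Q → Continuous u →
      MemLp (fun x => u x * Q x) 2 volume := fun hQ hQc hu => memLp_continuous_mul hQ hQc hu
  have hpd : ∀ l, ContDiff ℝ ∞ (pd l h) := fun l =>
    (hh.fderiv_right (m := ∞) (by simp)).clm_apply contDiff_const
  refine ⟨key hF.memLp hF.compact hh.continuous, fun l => ?_, hF.compact.mul_left, fun l => ?_,
    fun l φ hφ => ?_⟩
  · exact (key (hF.memLp_deriv l) (hF.compact_deriv l) hh.continuous).add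
      (key hF.memLp hF.compact (hpd l).continuous)
  · exact ((hF.compact_deriv l).mul_left (f := h)).add (hF.compact.mul_left (f := pd l h))
  · have h1 := hF.weak l (fun x => φ x * h x) (hφ.mul hh)
    simp only [pd_mul ((hφ.differentiable (by simp)) _) ((hh.differentiable (by simp)) _)] at h1
    have int : ∀ {Q u : Cn n → ℂ}, MemLp Q 2 volume → HasCompactSupport Q → Continuous u →
        Integrable fun x => u x * Q x := fun hQ hQc hu =>
      MemLp.integrable_of_hasCompactSupport (key hQ hQc hu) hQc.mul_left
    have i1 : Integrable fun x => (φ x * pd l h x) * F x :=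
      int hF.memLp hF.compact (hφ.continuous.mul (hpd l).continuous)
    have i2 : Integrable fun x => (pd l φ x * h x) * F x := int hF.memLp hF.compact
      (((hφ.fderiv_right (m := ∞) (by simp)).clm_apply contDiff_const).continuous.mul hh.continuous)
    have i3 : Integrable fun x => (φ x * h x) * DF l x := int (hF.memLp_deriv l) (hF.compact_deriv l) (hφ.continuous.mul hh.continuous)
    have h2 : ∫ x, (φ x * pd l h x + pd l φ x * h x) * F x =
        (∫ x, (φ x * pd l h x) * F x) + ∫ x, (pd l φ x * h x) * F x := by
      rw [← integral_add i1 i2]; congr 1; ext x; ring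
    have h3 : ∫ x, φ x * (h x * DF l x + pd l h x * F x) =
        (∫ x, (φ x * h x) * DF l x) + ∫ x, (φ x * pd l h x) * F x := by
      rw [← integral_add i3 i1]; congr 1; ext x; ring
    rw [h2] at h1
    rw [h3]
    have h4 : ∫ x, pd l φ x * (h x * F x) = ∫ x, (pd l φ x * h x) * F x := by
      congr 1; ext x; ring
    rw [h4]
    linear_combination h1

theorem integral_wMeasure_eq {P : Cn n → ℂ} (hP : ∀ x ∉ Ω, P x = 0) :
    ∫ x, P x ∂(wMeasure Ω t) = ∫ x, wt t x * P x := by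
  rw [wMeasure, integral_withDensity_eq_integral_toReal_smul
    (by fun_prop) (Eventually.of_forall fun x => ENNReal.ofReal_lt_top),
    setIntegral_eq_integral_of_forall_compl_eq_zero (fun x hx => by rw [hP x hx, smul_zero])]
  refine integral_congr_ae (Eventually.of_forall fun x => ?_)
  simp only [ENNReal.toReal_ofReal (Real.exp_pos _).le, Complex.real_smul, wt]

/-- The commutation identity behind the Kohn–Morrey–Hörmander formula, for real derivatives. -/
theorem CompactH1.integral_weighted_comm (hF : CompactH1 F DF) (hG : CompactH1 G DG)
    (a b : Fin n × Fin 2) :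
    ∫ x, wt t x * ((DF a x - 2 * t * (x a : ℂ) * F x) *
        (starRingEnd ℂ) (DG b x - 2 * t * (x b : ℂ) * G x)) =
      (∫ x, wt t x * (DF b x * (starRingEnd ℂ) (DG a x))) +
        (if a = b then (2 * t : ℂ) else 0) * ∫ x, wt t x * (F x * (starRingEnd ℂ) (G x)) := by
  -- With `w` the weight, `w` times the conjugate of `X_b G` is `∂_b (w Ḡ)`. The indices of the
  -- leading term are exchanged by `CompactH1.integral_deriv_mul_deriv`; the factor `x_a` is handled
  -- by one integration by parts, which yields the diagonal term.
  have hG' := hG.conj.mul_smooth (contDiff_wt (t := t))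
  have hx := hG'.mul_smooth (contDiff_coord a)
  have e1 := hF.integral_deriv_mul_deriv hG' a b
  have e2 := hF.integral_by_parts hx b
  have int : ∀ {P Q : Cn n → ℂ}, MemLp P 2 volume → MemLp Q 2 volume →
      Integrable fun x => P x * Q x := fun hP hQ => integrable_mul_of_memLp_two hP hQ
  have i1 := int (hF.memLp_deriv a) (hG'.memLp_deriv b)
  have i2 := int hF.memLp (hx.memLp_deriv b)
  have i3 := int (hF.memLp_deriv b) (hG'.memLp_deriv a)
  have i4 := int (hF.memLp_deriv b) hx.memLp
  have i5 := int hF.memLp hG'.memLp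
  have j1 : ∫ x, wt t x * ((DF a x - 2 * t * (x a : ℂ) * F x) *
        (starRingEnd ℂ) (DG b x - 2 * t * (x b : ℂ) * G x)) =
      ∫ x, (DF a x * (wt t x * (starRingEnd ℂ) (DG b x) + pd b (wt t) x * (starRingEnd ℂ) (G x)) -
        2 * t * (F x * ((x a : ℂ) * (wt t x * (starRingEnd ℂ) (DG b x) +
          pd b (wt t) x * (starRingEnd ℂ) (G x)) + pd b (fun x : Cn n => ((x a : ℝ) : ℂ)) x *
            (wt t x * (starRingEnd ℂ) (G x)))) +
        (if a = b then (2 * t : ℂ) else 0) * (F x * (wt t x * (starRingEnd ℂ) (G x)))) := by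
    congr 1; ext x
    rw [pd_wt, pd_coord, if_congr (eq_comm (a := b) (b := a)) rfl rfl]
    split_ifs <;> simp only [map_sub, map_mul, Complex.conj_ofReal, map_ofNat] <;> ring
  have j2 : ∫ x, wt t x * (DF b x * (starRingEnd ℂ) (DG a x)) =
      ∫ x, (DF b x * (wt t x * (starRingEnd ℂ) (DG a x) + pd a (wt t) x * (starRingEnd ℂ) (G x)) +
        2 * t * (DF b x * ((x a : ℂ) * (wt t x * (starRingEnd ℂ) (G x))))) := by
    congr 1; ext x
    rw [pd_wt]; ring
  have j3 : ∫ x, wt t x * (F x * (starRingEnd ℂ) (G x)) =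
      ∫ x, F x * (wt t x * (starRingEnd ℂ) (G x)) := by
    congr 1; ext x; ring
  have lin : ∀ {A B C : Cn n → ℂ}, Integrable A → Integrable B → Integrable C → ∀ c d : ℂ,
      ∫ x, (A x - c * B x + d * C x) = (∫ x, A x) - c * (∫ x, B x) + d * ∫ x, C x := by
    intro A B C hA hB hC c d
    have h1 : Integrable fun x => A x - c * B x := hA.sub (hB.const_mul c)
    rw [integral_add h1 (hC.const_mul d), integral_sub hA (hB.const_mul c), integral_const_mul,
      integral_const_mul]
  have k1 := lin i3 i4 i5 (-(2 * t)) 0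
  simp only [neg_mul, sub_neg_eq_add, zero_mul, add_zero] at k1
  rw [j1, j2, j3, k1]
  refine (lin i1 i2 i5 _ _).trans ?_
  rw [e1, e2]
  ring

/-- Lets a second factor be made compactly supported without changing it where the first one lives.
-/
theorem exists_cutoff_eq_one {K : Set (Cn n)} (hK : IsCompact K) (hΩ : IsOpen Ω) (hKΩ : K ⊆ Ω) :
    ∃ χ : Cn n → ℝ, ContDiff ℝ ∞ χ ∧ HasCompactSupport χ ∧ tsupport χ ⊆ Ω ∧
      (∀ x ∈ K, χ =ᶠ[𝓝 x] 1) := by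
  obtain ⟨δ, hδ, hδΩ⟩ := hK.exists_cthickening_subset_open hΩ hKΩ
  have h3 : 0 < δ / 3 := by positivity
  obtain ⟨C, hC, h⟩ := exists_smooth_cutoff n h3
  obtain ⟨b, hb, hb0, hb1, h1, h0, -⟩ := h (thickening (2 * (δ / 3)) K) isOpen_thickening.measurableSet
  have hs : tsupport b ⊆ cthickening δ K := by
    refine closure_minimal (fun x hx => ?_) isClosed_cthickening
    by_contra hxK
    refine hx (h0 x (disjoint_left.2 fun y hy hyK => hxK ?_))
    obtain ⟨z, hz, hyz⟩ := mem_thickening_iff.1 hyK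
    refine mem_cthickening_of_dist_le x z δ K hz ?_
    rw [mem_ball] at hy
    have := dist_triangle x y z
    rw [dist_comm x y] at this
    linarith
  refine ⟨b, hb, hK.cthickening.of_isClosed_subset (isClosed_tsupport _) hs, hs.trans hδΩ,
    fun x hx => ?_⟩
  filter_upwards [ball_mem_nhds x h3] with y hy
  refine h1 y fun z hz => mem_thickening_iff.2 ⟨x, hx, ?_⟩
  rw [mem_ball] at hy hz
  have := dist_triangle z y x
  linarith

/-- Integration by parts in the weighted space, against a compactly supported multiplier. -/
theorem integral_wX_mul_conj (hΩ : IsOpen Ω) (hf : MemSobolev Ω t 1 f) (hg : MemSobolev Ω t 1 g)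
    {η : Cn n → ℂ} (hη : ContDiff ℝ 1 η) (hc : HasCompactSupport η) (hs : tsupport η ⊆ Ω)
    (l : Fin n × Fin 2) :
    ∫ x, (pd l η x * (f x * (starRingEnd ℂ) (g x)) +
      η x * (wX Ω t l f x * (starRingEnd ℂ) (g x) + f x * (starRingEnd ℂ) (wX Ω t l g x)) +
      2 * t * (x l : ℂ) * (η x * (f x * (starRingEnd ℂ) (g x)))) ∂(wMeasure Ω t) = 0 := by
  -- The multiplier `η` truncates only `f`; `χ`, equal to 1 near the support of `η`, truncates `g`.
  obtain ⟨χ, hχ, hχc, hχs, hχ1⟩ := exists_cutoff_eq_one hc.isCompact hΩ hs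
  have hχC : ContDiff ℝ ∞ fun x => ((χ x : ℝ) : ℂ) := Complex.ofRealCLM.contDiff.comp hχ
  have hF := hf.compactH1 hΩ hη hc hs
  have hG := ((hg.compactH1 hΩ (θ := fun x => ((χ x : ℝ) : ℂ)) (hχC.of_le (by simp))
    (hχc.comp_left (g := Complex.ofReal) rfl)
    ((tsupport_comp_subset (g := Complex.ofReal) rfl χ).trans hχs)).conj).mul_smooth
      (contDiff_wt (t := t))
  have e := hF.integral_by_parts hG l
  have i1 := integrable_mul_of_memLp_two (hF.memLp_deriv l) hG.memLp
  have i2 := integrable_mul_of_memLp_two hF.memLp (hG.memLp_deriv l)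
  rw [eq_neg_iff_add_eq_zero, ← integral_add i1 i2] at e
  rw [integral_wMeasure_eq, ← e]
  · congr 1; ext x
    by_cases hx : x ∈ tsupport η
    · have h1 : χ x = 1 := (hχ1 x hx).self_of_nhds
      have h2 : pd l (fun x => ((χ x : ℝ) : ℂ)) x = 0 := by
        have : (fun x => ((χ x : ℝ) : ℂ)) =ᶠ[𝓝 x] fun _ => (1 : ℂ) := by
          filter_upwards [hχ1 x hx] with y hy
          rw [hy]; simp
        rw [pd, this.fderiv_eq]; simp
      rw [pd_wt, h2, h1, weakDeriv_eq_wX (t := t), weakDeriv_eq_wX (t := t)]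
      simp only [map_add, map_mul, Complex.conj_ofReal, map_ofNat, Complex.ofReal_one,
        one_mul, zero_mul, add_zero]
      ring
    · simp [image_eq_zero_of_notMem_tsupport hx, pd_eq_zero_of_notMem hx]
  · intro x hx
    have : x ∉ tsupport η := fun h => hx (hs h)
    simp [image_eq_zero_of_notMem_tsupport this, pd_eq_zero_of_notMem this]

end Parts

/-! ### Control of `t x` by fields with a radial component. -/

section RadialEstimate

variable {n : ℕ} {Ω : Set (Cn n)} {t : ℝ} {l : Fin n × Fin 2} {f g : Cn n → ℂ}

/-- The real linear functional `y ↦ y_l`, with complex values. -/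
noncomputable def coordCLM {n : ℕ} (l : Fin n × Fin 2) : Cn n →L[ℝ] ℂ :=
  Complex.ofRealCLM.comp (EuclideanSpace.proj (𝕜 := ℝ) l)

theorem coef_eq (a : Cn n → Cn n) : coef a l = coordCLM l ∘ a := rfl

theorem bddC_coef (hΩ : IsOpen Ω) {p : ℕ} {a : Cn n → Cn n} (ha : ContDiffOn ℝ p a Ω) {M : ℝ}
    (hM : ∀ s ≤ p, ∀ x ∈ Ω, ‖iteratedFDeriv ℝ s a x‖ ≤ M) : BddC Ω p (coef a l) := by
  refine ⟨(coordCLM l).contDiff.comp_contDiffOn ha, ‖(coordCLM l : Cn n →L[ℝ] ℂ)‖ * M,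
    fun s hs x hx => ?_⟩
  have hd : ContDiffAt ℝ (s : ℕ∞ω) a x :=
    (ha.contDiffAt (hΩ.mem_nhds hx)).of_le (by exact_mod_cast hs)
  rw [coef_eq, (coordCLM l).iteratedFDeriv_comp_left hd le_rfl]
  exact ((coordCLM l).norm_compContinuousMultilinearMap_le _).trans
    (mul_le_mul_of_nonneg_left (hM s hs x hx) (norm_nonneg _))

theorem ofReal_integral_norm_sq (hf : MemLp f 2 (wMeasure Ω t)) :
    ENNReal.ofReal (∫ x, ‖f x‖ ^ 2 ∂(wMeasure Ω t)) = normSqL2 Ω t f := by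
  rw [ofReal_integral_eq_lintegral_ofReal ((memLp_two_iff_integrable_sq_norm hf.1).1 hf)
    (Eventually.of_forall fun x => by positivity)]
  refine lintegral_congr fun x => ?_
  rw [ENNReal.ofReal_pow (norm_nonneg _), ofReal_norm]

theorem integrable_compactSupport_mul {μ : Measure (Cn n)} {F : Type*} [NormedRing F]
    {η u : Cn n → F} (hη : Continuous η) (hc : HasCompactSupport η) (hu : Integrable u μ) :
    Integrable (fun x => η x * u x) μ := by
  obtain ⟨B, hB⟩ := hc.exists_bound_of_continuous hη
  exact hu.bdd_mul hη.aestronglyMeasurable (Eventually.of_forall hB)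

theorem integrable_wX_mul_conj (hf : MemSobolev Ω t 1 f) (hg : MemSobolev Ω t 1 g)
    {η : Cn n → ℂ} (hη : ContDiff ℝ 1 η) (hc : HasCompactSupport η) (l : Fin n × Fin 2) :
    Integrable (fun x => pd l η x * (f x * (starRingEnd ℂ) (g x)) +
      η x * (wX Ω t l f x * (starRingEnd ℂ) (g x) + f x * (starRingEnd ℂ) (wX Ω t l g x)) +
      2 * t * (x l : ℂ) * (η x * (f x * (starRingEnd ℂ) (g x)))) (wMeasure Ω t) := by
  have h0 := integrable_mul_of_memLp_two hf.memLp hg.memLp.star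
  have h1 := integrable_mul_of_memLp_two (hf.wX l).memLp hg.memLp.star
  have h2 := integrable_mul_of_memLp_two hf.memLp (hg.wX l).memLp.star
  have hpc : HasCompactSupport (pd l η) := hc.fderiv_apply (𝕜 := ℝ) _
  have i1 := integrable_compactSupport_mul
    ((hη.continuous_fderiv one_ne_zero).clm_apply continuous_const) hpc h0
  have i2 := integrable_compactSupport_mul hη.continuous hc (h1.add h2)
  have i3 := integrable_compactSupport_mul
    (((contDiff_coord l).continuous.const_mul (2 * (t : ℂ))).mul hη.continuous)
    (hc.mul_left (f := fun x : Cn n => 2 * (t : ℂ) * (x l : ℂ))) h0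
  refine ((i1.add i2).add i3).congr (Eventually.of_forall fun x => ?_)
  simp only [Pi.add_apply, Pi.star_apply, Pi.mul_apply, RCLike.star_def]
  ring

variable {a : Cn n → Cn n} {β : Cn n → ℝ}

/-- The integrand of the weighted divergence identity for the field `β ⟨a, x⟩ a`. -/
noncomputable def energy {n : ℕ} (Ω : Set (Cn n)) (t : ℝ) (a : Cn n → Cn n) (β : Cn n → ℝ)
    (f : Cn n → ℂ) (x : Cn n) : ℝ :=
  (∑ l, pd l (fun x => β x * inner ℝ (a x) x * a x l) x) * ‖f x‖ ^ 2 +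
    2 * (β x * inner ℝ (a x) x) * (f x * (starRingEnd ℂ) (wT Ω t a f x)).re +
    2 * t * (β x * (inner ℝ (a x) x) ^ 2) * ‖f x‖ ^ 2

/-- The weighted divergence theorem for `β ⟨a,x⟩ a |f|²`: sum `integral_wX_mul_conj` with `g = f`
over the components of the field. The compact support of `β` in `Ω` excludes boundary terms. -/
theorem energy_integral (hΩ : IsOpen Ω) (ha : ContDiffOn ℝ 1 a Ω) (hβ : ContDiff ℝ 1 β)
    (hc : HasCompactSupport β) (hs : tsupport β ⊆ Ω) (hf : MemSobolev Ω t 1 f) :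
    Integrable (energy Ω t a β f) (wMeasure Ω t) ∧
      ∫ x, energy Ω t a β f x ∂(wMeasure Ω t) = 0 := by
  have hη : ∀ l, ContDiff ℝ 1 fun x => β x * inner ℝ (a x) x * a x l := fun l => by
    refine contDiff_of_tsupport_subset hΩ ?_
      ((tsupport_mul_subset_left.trans tsupport_mul_subset_left).trans hs)
    exact (hβ.contDiffOn.mul (ha.inner ℝ contDiffOn_id)).mul
      ((EuclideanSpace.proj (𝕜 := ℝ) l).contDiff.comp_contDiffOn ha)
  have hηc : ∀ l, HasCompactSupport fun x => β x * inner ℝ (a x) x * a x l := fun l =>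
    hc.mul_right.mul_right
  have hηC : ∀ l, ContDiff ℝ 1 fun x => ((β x * inner ℝ (a x) x * a x l : ℝ) : ℂ) := fun l =>
    Complex.ofRealCLM.contDiff.comp (hη l)
  have hηCc : ∀ l, HasCompactSupport fun x => ((β x * inner ℝ (a x) x * a x l : ℝ) : ℂ) := fun l =>
    (hηc l).comp_left (g := Complex.ofReal) rfl
  have hηCs : ∀ l, tsupport (fun x => ((β x * inner ℝ (a x) x * a x l : ℝ) : ℂ)) ⊆ Ω := fun l =>
    (tsupport_comp_subset (g := Complex.ofReal) rfl
      (fun x => β x * inner ℝ (a x) x * a x l)).trans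
      ((tsupport_mul_subset_left.trans tsupport_mul_subset_left).trans hs)
  have key : ∀ x, ((energy Ω t a β f x : ℝ) : ℂ) = ∑ l,
      (pd l (fun x => ((β x * inner ℝ (a x) x * a x l : ℝ) : ℂ)) x *
        (f x * (starRingEnd ℂ) (f x)) +
      ((β x * inner ℝ (a x) x * a x l : ℝ) : ℂ) *
        (wX Ω t l f x * (starRingEnd ℂ) (f x) + f x * (starRingEnd ℂ) (wX Ω t l f x)) +
      2 * t * (x l : ℂ) * (((β x * inner ℝ (a x) x * a x l : ℝ) : ℂ) *
        (f x * (starRingEnd ℂ) (f x)))) := by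
    intro x
    have e0 : f x * (starRingEnd ℂ) (f x) = ((‖f x‖ ^ 2 : ℝ) : ℂ) := by
      rw [Complex.mul_conj, Complex.normSq_eq_norm_sq]
    have e1 : ∀ l, pd l (fun x => ((β x * inner ℝ (a x) x * a x l : ℝ) : ℂ)) x =
        ((pd l (fun x => β x * inner ℝ (a x) x * a x l) x : ℝ) : ℂ) := fun l =>
      pd_ofReal (((hη l).differentiable one_ne_zero) x)
    have e2 : ((2 * (f x * (starRingEnd ℂ) (wT Ω t a f x)).re : ℝ) : ℂ) =
        ∑ l, (a x l : ℂ) *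
          (wX Ω t l f x * (starRingEnd ℂ) (f x) + f x * (starRingEnd ℂ) (wX Ω t l f x)) := by
      have h := Complex.add_conj (f x * (starRingEnd ℂ) (wT Ω t a f x))
      rw [← h, map_mul, Complex.conj_conj]
      simp only [wT, map_sum, map_mul, Complex.conj_ofReal, Finset.mul_sum]
      rw [← Finset.sum_add_distrib]
      exact Finset.sum_congr rfl fun l _ => by ring
    have e3 : inner ℝ (a x) x = ∑ l, a x l * x l := by
      simp [PiLp.inner_apply, mul_comm]
    have e4 : ((energy Ω t a β f x : ℝ) : ℂ) =
        (∑ l, ((pd l (fun x => β x * inner ℝ (a x) x * a x l) x : ℝ) : ℂ)) * ((‖f x‖ ^ 2 : ℝ) : ℂ) +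
        ((β x * inner ℝ (a x) x : ℝ) : ℂ) *
          ((2 * (f x * (starRingEnd ℂ) (wT Ω t a f x)).re : ℝ) : ℂ) +
        2 * t * ((β x * inner ℝ (a x) x : ℝ) : ℂ) * (∑ l, (a x l : ℂ) * (x l : ℂ)) *
          ((‖f x‖ ^ 2 : ℝ) : ℂ) := by
      have e5 : (∑ l, (a x l : ℂ) * (x l : ℂ)) = ((inner ℝ (a x) x : ℝ) : ℂ) := by
        rw [e3]; push_cast; rfl
      rw [e5, energy]
      push_cast
      ring
    rw [e4, e2, Finset.sum_mul, Finset.mul_sum, Finset.mul_sum, Finset.sum_mul,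
      ← Finset.sum_add_distrib, ← Finset.sum_add_distrib]
    refine Finset.sum_congr rfl fun l _ => ?_
    rw [e0, e1]
    push_cast
    ring
  have hi := fun l => integrable_wX_mul_conj hf hf (hηC l) (hηCc l) l
  have h0 := fun l => integral_wX_mul_conj hΩ hf hf (hηC l) (hηCc l) (hηCs l) l
  have hI : Integrable (fun x => ((energy Ω t a β f x : ℝ) : ℂ)) (wMeasure Ω t) := by
    simp only [key]
    exact integrable_finsetSum _ fun l _ => hi l
  refine ⟨hI.re, ?_⟩
  have h1 : ∫ x, ((energy Ω t a β f x : ℝ) : ℂ) ∂(wMeasure Ω t) = 0 := by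
    simp only [key]
    rw [integral_finsetSum _ fun l _ => hi l]
    exact Finset.sum_eq_zero fun l _ => h0 l
  rw [integral_complex_ofReal] at h1
  exact_mod_cast h1

/-- The derivative of `β` along `a` is kept apart: in the application the full gradient of `β` blows
up at the boundary and only its tangential derivatives are bounded. -/
theorem abs_sum_pd_le {M : ℝ} {x : Cn n} (ha : DifferentiableAt ℝ a x)
    (hβ : DifferentiableAt ℝ β x) (hM0 : ‖a x‖ ≤ M) (hM1 : ‖fderiv ℝ a x‖ ≤ M) (hβ0 : 0 ≤ β x) :
    |∑ l, pd l (fun x => β x * inner ℝ (a x) x * a x l) x| ≤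
      M * ‖x‖ * |fderiv ℝ β x (a x)| +
        β x * (M ^ 2 * (1 + ‖x‖) + (Fintype.card (Fin n × Fin 2)) * M ^ 2 * ‖x‖) := by
  have hM : 0 ≤ M := (norm_nonneg _).trans hM0
  have hp : HasFDerivAt (fun x => inner ℝ (a x) x) _ x := ha.hasFDerivAt.inner ℝ (hasFDerivAt_id x)
  have hpv : ∀ v, fderiv ℝ (fun x => inner ℝ (a x) x) x v =
      inner ℝ (a x) v + inner ℝ (fderiv ℝ a x v) x := by
    intro v
    rw [hp.fderiv]
    simp
  have hbp := hβ.hasFDerivAt.mul hp.differentiableAt.hasFDerivAt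
  have hal : ∀ l, HasFDerivAt (fun x => a x l)
      ((EuclideanSpace.proj (𝕜 := ℝ) l).comp (fderiv ℝ a x)) x := fun l =>
    (EuclideanSpace.proj (𝕜 := ℝ) l).hasFDerivAt.comp x ha.hasFDerivAt
  set L := β x • fderiv ℝ (fun x => inner ℝ (a x) x) x + (inner ℝ (a x) x : ℝ) • fderiv ℝ β x with hL
  have e : ∀ l, pd l (fun x => β x * inner ℝ (a x) x * a x l) x =
      L (a x l • EuclideanSpace.single l 1) +
        β x * inner ℝ (a x) x * (fderiv ℝ a x (EuclideanSpace.single l 1)) l := by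
    intro l
    have h := (hbp.mul (hal l)).fderiv
    change fderiv ℝ (fun x => β x * inner ℝ (a x) x * a x l) x _ = _
    rw [show (fun x => β x * inner ℝ (a x) x * a x l) =
      ((β * fun x => inner ℝ (a x) x) * fun x => a x l) from rfl, h, map_smul]
    simp [hL]
    ring
  have hsum : ∑ l, a x l • (EuclideanSpace.single l 1 : Cn n) = a x := by
    ext m; simp [Finset.sum_apply, Pi.single_apply]
  simp only [e]
  rw [Finset.sum_add_distrib, ← map_sum, hsum, ← Finset.mul_sum]
  have b0 : |inner ℝ (a x) x| ≤ M * ‖x‖ :=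
    (abs_real_inner_le_norm _ _).trans (mul_le_mul_of_nonneg_right hM0 (norm_nonneg _))
  have b1 : |∑ l, (fderiv ℝ a x (EuclideanSpace.single l 1)) l| ≤
      (Fintype.card (Fin n × Fin 2)) * M := by
    refine (Finset.abs_sum_le_sum_abs _ _).trans ?_
    refine (Finset.sum_le_card_nsmul _ _ M fun l _ => ?_).trans (by rw [nsmul_eq_mul]; rfl)
    rw [← Real.norm_eq_abs]
    refine (PiLp.norm_apply_le _ _).trans (((fderiv ℝ a x).le_opNorm _).trans ?_)
    simpa using hM1
  have b2 : |fderiv ℝ (fun x => inner ℝ (a x) x) x (a x)| ≤ M ^ 2 * (1 + ‖x‖) := by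
    rw [hpv]
    refine (abs_add_le _ _).trans ?_
    have h1 : |inner ℝ (a x) (a x)| ≤ M * M :=
      (abs_real_inner_le_norm _ _).trans (mul_le_mul hM0 hM0 (norm_nonneg _) hM)
    have h2 : |inner ℝ (fderiv ℝ a x (a x)) x| ≤ M * M * ‖x‖ := by
      refine (abs_real_inner_le_norm _ _).trans (mul_le_mul_of_nonneg_right ?_ (norm_nonneg _))
      exact ((fderiv ℝ a x).le_opNorm _).trans (mul_le_mul hM1 hM0 (norm_nonneg _) hM)
    linarith
  have b3 : L (a x) = β x * fderiv ℝ (fun x => inner ℝ (a x) x) x (a x) +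
      inner ℝ (a x) x * fderiv ℝ β x (a x) := by simp [hL]
  rw [b3]
  calc _ ≤ |β x * fderiv ℝ (fun x => inner ℝ (a x) x) x (a x)| +
        |inner ℝ (a x) x * fderiv ℝ β x (a x)| +
        |β x * inner ℝ (a x) x * ∑ l, (fderiv ℝ a x (EuclideanSpace.single l 1)) l| :=
        (abs_add_le _ _).trans (add_le_add_left (abs_add_le _ _) _)
    _ ≤ β x * (M ^ 2 * (1 + ‖x‖)) + M * ‖x‖ * |fderiv ℝ β x (a x)| +
        β x * (M * ‖x‖) * (Fintype.card (Fin n × Fin 2) * M) := by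
        rw [abs_mul, abs_mul, abs_mul, abs_mul, abs_of_nonneg hβ0]
        gcongr
    _ = _ := by ring

theorem ae_mem_wMeasure (hΩ : IsOpen Ω) : ∀ᵐ x ∂(wMeasure Ω t), x ∈ Ω :=
  ae_wMeasure_of_ae (ae_restrict_mem hΩ.measurableSet)

/-- Multiplication by `t` makes the leading term `2 t² β ⟨a,x⟩² |f|²` nonnegative for either sign of
`t`; half of it absorbs the cross term with `T^t f`. -/
theorem energy_ge {x : Cn n} {Q : ℝ} (h0 : 0 ≤ β x) (h1 : β x ≤ 1)
    (hQ : |∑ l, pd l (fun x => β x * inner ℝ (a x) x * a x l) x| ≤ Q) :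
    t ^ 2 * (β x * (inner ℝ (a x) x) ^ 2) * ‖f x‖ ^ 2 - |t| * Q * ‖f x‖ ^ 2 -
      ‖wT Ω t a f x‖ ^ 2 ≤ t * energy Ω t a β f x := by
  rw [energy]
  generalize ∑ l, pd l (fun x => β x * inner ℝ (a x) x * a x l) x = d at *
  generalize inner ℝ (a x) x = p
  generalize wT Ω t a f x = w
  generalize f x = z
  generalize β x = b at *
  have e1 : |(z * (starRingEnd ℂ) w).re| ≤ ‖z‖ * ‖w‖ := by
    refine (Complex.abs_re_le_norm _).trans ?_
    rw [norm_mul, RCLike.norm_conj]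
  generalize (z * (starRingEnd ℂ) w).re = q at *
  have e2 : -(|t| * Q * ‖z‖ ^ 2) ≤ t * (d * ‖z‖ ^ 2) := by
    have := neg_abs_le (t * (d * ‖z‖ ^ 2))
    rw [abs_mul, abs_mul, abs_of_nonneg (sq_nonneg ‖z‖)] at this
    have h3 : |t| * (|d| * ‖z‖ ^ 2) ≤ |t| * (Q * ‖z‖ ^ 2) := by gcongr
    linarith
  have e3 : -(t ^ 2 * (b * p ^ 2) * ‖z‖ ^ 2 + ‖w‖ ^ 2) ≤ t * (2 * (b * p) * q) := by
    have h4 := neg_abs_le (t * (2 * (b * p) * q))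
    have h5 : |t * (2 * (b * p) * q)| ≤ |t| * (2 * (b * |p|) * (‖z‖ * ‖w‖)) := by
      rw [abs_mul, abs_mul, abs_mul, abs_mul, abs_of_nonneg h0, abs_two]
      gcongr
    have h6 : 0 ≤ b * (|t| * |p| * ‖z‖ - ‖w‖) ^ 2 := mul_nonneg h0 (sq_nonneg _)
    have h7 : b * ‖w‖ ^ 2 ≤ ‖w‖ ^ 2 := mul_le_of_le_one_left (sq_nonneg _) h1
    have h8 : b * (|t| * |p| * ‖z‖ - ‖w‖) ^ 2 = t ^ 2 * (b * p ^ 2) * ‖z‖ ^ 2 -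
        |t| * (2 * (b * |p|) * (‖z‖ * ‖w‖)) + b * ‖w‖ ^ 2 := by
      rw [← sq_abs t, ← sq_abs p]; ring
    linarith
  have e4 : t * (d * ‖z‖ ^ 2 + 2 * (b * p) * q + 2 * t * (b * p ^ 2) * ‖z‖ ^ 2) =
      t * (d * ‖z‖ ^ 2) + t * (2 * (b * p) * q) + 2 * (t ^ 2 * (b * p ^ 2) * ‖z‖ ^ 2) := by ring
  rw [e4]
  linarith

/-- The divergence grows like `√β |x|`, exactly the square root of the good term `β |x|²`, so
Young's inequality absorbs it. The region `|x| < R` costs only `c R² t²`, part of the constant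
depending on `t`. -/
theorem radial_absorb {c R X b s S k P : ℝ} (hc : 0 < c) (hX : 0 ≤ X) (h0 : 0 ≤ b) (h1 : b ≤ 1)
    (hs : s ^ 2 = b) (hS : 0 ≤ S) (h : b ≠ 0 → R ≤ X → c * X ^ 2 ≤ S) :
    c / 2 * (t ^ 2 * (b * X ^ 2)) -
        (c * R ^ 2 * t ^ 2 + |t| * (k * P) + 2 / c * (k * P) ^ 2) ≤
      t ^ 2 * (b * S) - k * (|t| * (P * (2 * (s * X) + 1))) := by
  have hR0 : 0 ≤ c * R ^ 2 := by positivity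
  have hrad : c * (b * X ^ 2) - c * R ^ 2 ≤ b * S := by
    by_cases hb : b = 0
    · simp only [hb, zero_mul, mul_zero]; linarith
    by_cases hR : R ≤ X
    · have := mul_le_mul_of_nonneg_left (h hb hR) h0
      have e : b * (c * X ^ 2) = c * (b * X ^ 2) := by ring
      linarith
    · have h1' : X ^ 2 ≤ R ^ 2 := pow_le_pow_left₀ hX (not_le.1 hR).le 2
      have h2 : b * X ^ 2 ≤ X ^ 2 := mul_le_of_le_one_left (sq_nonneg _) h1
      have h3 : 0 ≤ b * S := mul_nonneg h0 hS
      have h4 := mul_le_mul_of_nonneg_left (h2.trans h1') hc.le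
      linarith
  have hyoung : |t| * (k * P) * (2 * (s * X)) ≤
      c / 2 * (t ^ 2 * (b * X ^ 2)) + 2 / c * (k * P) ^ 2 := by
    have h1 : 0 ≤ c / 2 * (|t| * (s * X) - 2 / c * (k * P)) ^ 2 := by positivity
    have h2 : c / 2 * (|t| * (s * X) - 2 / c * (k * P)) ^ 2 =
        c / 2 * (t ^ 2 * (b * X ^ 2)) + 2 / c * (k * P) ^ 2 -
          |t| * (k * P) * (2 * (s * X)) := by
      rw [← hs, ← sq_abs t]; field_simp; ring
    linarith
  have h5 := mul_le_mul_of_nonneg_left hrad (sq_nonneg t)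
  have e : k * (|t| * (P * (2 * (s * X) + 1))) =
    |t| * (k * P) * (2 * (s * X)) + |t| * (k * P) := by ring
  have e' : t ^ 2 * (c * (b * X ^ 2) - c * R ^ 2) =
    2 * (c / 2 * (t ^ 2 * (b * X ^ 2))) - c * R ^ 2 * t ^ 2 := by ring
  rw [e]
  rw [e'] at h5
  linarith

variable {ι : Type*} [Fintype ι] {T : ι → Cn n → Cn n}

/-- The weighted radial estimate: fields whose flow respects the cut-off `β` control the
multiplication by `t x` as far as they control the radial direction. -/
theorem lintegral_radial_le (hΩ : IsOpen Ω) {M c R B : ℝ} (hc : 0 < c) (hB : 0 ≤ B)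
    (hT : ∀ i, ContDiffOn ℝ 1 (T i) Ω) (hM0 : ∀ i, ∀ x ∈ Ω, ‖T i x‖ ≤ M)
    (hM1 : ∀ i, ∀ x ∈ Ω, ‖fderiv ℝ (T i) x‖ ≤ M) : ∃ C : ℝ≥0, ∀ t : ℝ, ∃ D : ℝ≥0,
    ∀ β : Cn n → ℝ, ContDiff ℝ 1 β → HasCompactSupport β → tsupport β ⊆ Ω → (∀ x, 0 ≤ β x) →
      (∀ x, β x ≤ 1) → (∀ i, ∀ x ∈ Ω, |fderiv ℝ β x (T i x)| ≤ B * Real.sqrt (β x)) →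
      (∀ x ∈ Ω, β x ≠ 0 → R ≤ ‖x‖ → c * ‖x‖ ^ 2 ≤ ∑ i, (inner ℝ (T i x) x) ^ 2) →
      ∀ f, MemSobolev Ω t 1 f →
        ∫⁻ x, ENNReal.ofReal (t ^ 2 * (β x * ‖x‖ ^ 2)) * ‖f x‖ₑ ^ 2 ∂(wMeasure Ω t) ≤
          C * ∑ i, normSqL2 Ω t (wT Ω t (T i) f) + D * normSqL2 Ω t f := by
  obtain ⟨N, hN⟩ : ∃ N : ℝ, N = (Fintype.card (Fin n × Fin 2) : ℝ) := ⟨_, rfl⟩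
  have hN0 : 0 ≤ N := by rw [hN]; positivity
  set P := |M| * B + M ^ 2 + N * M ^ 2 with hP
  have hP0 : 0 ≤ P := by positivity
  set k := (Fintype.card ι : ℝ) with hk
  refine ⟨(2 / c).toNNReal, fun t => ?_⟩
  set D := c * R ^ 2 * t ^ 2 + |t| * (k * P) + 2 / c * (k * P) ^ 2 with hD
  have hD0 : 0 ≤ D := by positivity
  refine ⟨(2 / c * D).toNNReal, fun β hβ hβc hβs hβ0 hβ1 hβT hβR f hf => ?_⟩
  have hTf : ∀ i, MemLp (wT Ω t (T i) f) 2 (wMeasure Ω t) := fun i => by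
    have : ∀ l, BddC Ω 0 (coef (T i) l) := fun l =>
      bddC_coef hΩ ((hT i).of_le (by simp)) (M := M) fun s hs x hx => by
        rw [Nat.le_zero.1 hs, norm_iteratedFDeriv_zero]; exact hM0 i x hx
    exact memSobolev_wT (k := 0) hΩ this hf
  have hE := fun i => energy_integral hΩ (hT i) hβ hβc hβs hf
  have hpt : ∀ x ∈ Ω, c / 2 * (t ^ 2 * (β x * ‖x‖ ^ 2)) * ‖f x‖ ^ 2 ≤
      ∑ i, ‖wT Ω t (T i) f x‖ ^ 2 + D * ‖f x‖ ^ 2 + ∑ i, t * energy Ω t (T i) β f x := by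
    intro x hx
    have hX := norm_nonneg x
    set X := ‖x‖ with hXd
    set s := Real.sqrt (β x) with hs
    have hss : s ^ 2 = β x := Real.sq_sqrt (hβ0 x)
    have hs0 : 0 ≤ s := Real.sqrt_nonneg _
    have hs1 : s ≤ 1 := Real.sqrt_le_one.2 (hβ1 x)
    set u := ‖f x‖ ^ 2 with hu
    have hu0 : 0 ≤ u := by positivity
    have hdiv : ∀ i, |∑ l, pd l (fun x => β x * inner ℝ (T i x) x * T i x l) x| ≤
        P * (2 * (s * X) + 1) := by
      intro i
      have hM : 0 ≤ M := (norm_nonneg _).trans (hM0 i x hx)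
      refine (abs_sum_pd_le (((hT i).contDiffAt (hΩ.mem_nhds hx)).differentiableAt one_ne_zero)
        ((hβ.differentiable one_ne_zero) x) (hM0 i x hx) (hM1 i x hx) (hβ0 x)).trans ?_
      rw [← hN, hP, abs_of_nonneg hM]
      have h1 : M * X * |fderiv ℝ β x (T i x)| ≤ M * X * (B * s) :=
        mul_le_mul_of_nonneg_left (hβT i x hx) (by positivity)
      -- Since `β ≤ 1`, also the terms with a plain factor `β` are bounded through `√β`.
      have h2 : β x ≤ s := by rw [← hss, sq]; exact mul_le_of_le_one_left hs0 hs1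
      have h3 : β x * (M ^ 2 * (1 + X) + N * M ^ 2 * X) ≤ M ^ 2 * (1 + s * X) + N * M ^ 2 * (s * X) := by
        have : β x * X ≤ s * X := mul_le_mul_of_nonneg_right h2 hX
        have e : β x * (M ^ 2 * (1 + X) + N * M ^ 2 * X) =
          M ^ 2 * (β x + β x * X) + N * M ^ 2 * (β x * X) := by ring
        rw [e]
        gcongr
        exact hβ1 x
      have h4 : 0 ≤ M * B * (s * X) + M * B + M ^ 2 * (s * X) + N * M ^ 2 * (s * X) + N * M ^ 2 := by
        positivity
      calc _ ≤ M * X * (B * s) + (M ^ 2 * (1 + s * X) + N * M ^ 2 * (s * X)) := add_le_add h1 h3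
        _ ≤ M * X * (B * s) + (M ^ 2 * (1 + s * X) + N * M ^ 2 * (s * X)) +
          (M * B * (s * X) + M * B + M ^ 2 * (s * X) + N * M ^ 2 * (s * X) + N * M ^ 2) :=
            le_add_of_nonneg_right h4
        _ = _ := by ring
    have hEi := fun i => energy_ge (t := t) (Ω := Ω) (a := T i) (f := f) (hβ0 x) (hβ1 x) (hdiv i)
    have hsum := Finset.sum_le_sum fun i (_ : i ∈ Finset.univ) => hEi i
    rw [Finset.sum_sub_distrib, Finset.sum_sub_distrib, Finset.sum_const, Finset.card_univ,
      nsmul_eq_mul, ← hk, ← Finset.sum_mul, ← Finset.mul_sum, ← Finset.mul_sum] at hsum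
    have h6 := radial_absorb (S := ∑ i, (inner ℝ (T i x) x) ^ 2) (t := t) (R := R) (k := k) (P := P)
      hc hX (hβ0 x) (hβ1 x) hss (Finset.sum_nonneg fun _ _ => sq_nonneg _) (hβR x hx)
    rw [← hD] at h6
    have h7 := mul_le_mul_of_nonneg_right h6 hu0
    linarith
  have hfu : Integrable (fun x => ‖f x‖ ^ 2) (wMeasure Ω t) :=
    (memLp_two_iff_integrable_sq_norm hf.memLp.1).1 hf.memLp
  have hTu : ∀ i, Integrable (fun x => ‖wT Ω t (T i) f x‖ ^ 2) (wMeasure Ω t) := fun i =>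
    (memLp_two_iff_integrable_sq_norm (hTf i).1).1 (hTf i)
  have hLi : Integrable (fun x => t ^ 2 * (β x * ‖x‖ ^ 2) * ‖f x‖ ^ 2) (wMeasure Ω t) :=
    integrable_compactSupport_mul
      (continuous_const.mul (hβ.continuous.mul (continuous_norm.pow 2)))
      (hβc.mul_right.mul_left) hfu
  have hSi : Integrable (fun x => ∑ i, ‖wT Ω t (T i) f x‖ ^ 2) (wMeasure Ω t) :=
    integrable_finsetSum _ fun i _ => hTu i
  -- The energies integrate to zero, so adding them to the pointwise bound costs nothing after
  -- integration.
  have hEs : Integrable (fun x => ∑ i, t * energy Ω t (T i) β f x) (wMeasure Ω t) :=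
    integrable_finsetSum _ fun i _ => (hE i).1.const_mul t
  have hE0 : ∫ x, ∑ i, t * energy Ω t (T i) β f x ∂(wMeasure Ω t) = 0 := by
    rw [integral_finsetSum _ fun i _ => (hE i).1.const_mul t]
    exact Finset.sum_eq_zero fun i _ => by rw [integral_const_mul, (hE i).2, mul_zero]
  have hineq : c / 2 * ∫ x, t ^ 2 * (β x * ‖x‖ ^ 2) * ‖f x‖ ^ 2 ∂(wMeasure Ω t) ≤
      (∑ i, ∫ x, ‖wT Ω t (T i) f x‖ ^ 2 ∂(wMeasure Ω t)) +
        D * ∫ x, ‖f x‖ ^ 2 ∂(wMeasure Ω t) := by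
    have hSD : Integrable (fun x => ∑ i, ‖wT Ω t (T i) f x‖ ^ 2 + D * ‖f x‖ ^ 2) (wMeasure Ω t) :=
      hSi.add (hfu.const_mul D)
    have h := integral_mono_ae (hLi.const_mul (c / 2)) (hSD.add hEs) (by
      filter_upwards [ae_mem_wMeasure hΩ] with x hx
      have := hpt x hx
      simp only [Pi.add_apply]
      linarith)
    rw [integral_const_mul, integral_add' hSD hEs, hE0, add_zero,
      integral_add hSi (hfu.const_mul D), integral_const_mul,
      integral_finsetSum _ fun i _ => hTu i] at h
    exact h
  have hlhs : ∫⁻ x, ENNReal.ofReal (t ^ 2 * (β x * ‖x‖ ^ 2)) * ‖f x‖ₑ ^ 2 ∂(wMeasure Ω t) =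
      ENNReal.ofReal (∫ x, t ^ 2 * (β x * ‖x‖ ^ 2) * ‖f x‖ ^ 2 ∂(wMeasure Ω t)) := by
    have hnn : ∀ x, 0 ≤ t ^ 2 * (β x * ‖x‖ ^ 2) := fun x =>
      mul_nonneg (sq_nonneg t) (mul_nonneg (hβ0 x) (sq_nonneg _))
    rw [ofReal_integral_eq_lintegral_ofReal hLi
      (Eventually.of_forall fun x => mul_nonneg (hnn x) (sq_nonneg _))]
    refine lintegral_congr fun x => ?_
    rw [ENNReal.ofReal_mul (hnn x), ENNReal.ofReal_pow (norm_nonneg _), ofReal_norm]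
  rw [hlhs]
  have hfin : ∫ x, t ^ 2 * (β x * ‖x‖ ^ 2) * ‖f x‖ ^ 2 ∂(wMeasure Ω t) ≤
      2 / c * (∑ i, ∫ x, ‖wT Ω t (T i) f x‖ ^ 2 ∂(wMeasure Ω t)) +
        2 / c * D * ∫ x, ‖f x‖ ^ 2 ∂(wMeasure Ω t) := by
    have := mul_le_mul_of_nonneg_left hineq (by positivity : 0 ≤ 2 / c)
    rw [← mul_assoc, show 2 / c * (c / 2) = 1 by field_simp, one_mul] at this
    linarith
  refine (ENNReal.ofReal_le_ofReal hfin).trans ?_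
  have hs0 : ∀ i, 0 ≤ ∫ x, ‖wT Ω t (T i) f x‖ ^ 2 ∂(wMeasure Ω t) := fun i =>
    integral_nonneg fun x => by positivity
  have hf0 : 0 ≤ ∫ x, ‖f x‖ ^ 2 ∂(wMeasure Ω t) := integral_nonneg fun x => by positivity
  rw [ENNReal.ofReal_add (mul_nonneg (by positivity) (Finset.sum_nonneg fun i _ => hs0 i))
    (mul_nonneg (by positivity) hf0), ENNReal.ofReal_mul (by positivity),
    ENNReal.ofReal_mul (by positivity), ENNReal.ofReal_sum_of_nonneg fun i _ => hs0 i,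
    ofReal_integral_norm_sq hf.memLp]
  simp only [ofReal_integral_norm_sq (hTf _)]
  rfl

end RadialEstimate

/-! ### The radial estimate up to the boundary. -/

section BoundaryStrip

variable {n : ℕ} {Ω U : Set (Cn n)} {ρ : Cn n → ℝ} {t : ℝ} {f : Cn n → ℂ}

/-- Fatou's lemma, in the form used to remove exhausting cut-offs. -/
theorem lintegral_le_of_eventually_eq {α : Type*} [MeasurableSpace α] {μ : Measure α}
    {F : α → ℝ≥0∞} {G : ℕ → α → ℝ≥0∞} (hG : ∀ j, AEMeasurable (G j) μ)
    (h : ∀ᵐ x ∂μ, ∀ᶠ j in atTop, G j x = F x) {S : ℝ≥0∞} (hS : ∀ j, ∫⁻ x, G j x ∂μ ≤ S) :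
    ∫⁻ x, F x ∂μ ≤ S := by
  calc ∫⁻ x, F x ∂μ ≤ ∫⁻ x, liminf (fun j => G j x) atTop ∂μ := by
        refine lintegral_mono_ae ?_
        filter_upwards [h] with x hx
        rw [liminf_congr hx, liminf_const]
    _ ≤ liminf (fun j => ∫⁻ x, G j x ∂μ) atTop := lintegral_liminf_le' hG
    _ ≤ liminf (fun _ => S) atTop := liminf_le_liminf (Eventually.of_forall hS)
    _ = S := liminf_const S

/-- An exhausting sequence of cut-off functions with uniformly bounded gradients. -/
theorem exists_exhausting_cutoffs (n : ℕ) : ∃ C : ℝ, 0 ≤ C ∧ ∃ κ : ℕ → Cn n → ℝ,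
    (∀ j, ContDiff ℝ ∞ (κ j)) ∧ (∀ j, HasCompactSupport (κ j)) ∧ (∀ j x, 0 ≤ κ j x) ∧
      (∀ j x, κ j x ≤ 1) ∧ (∀ x, ∀ᶠ j in atTop, κ j x = 1) ∧ ∀ j x, ‖fderiv ℝ (κ j) x‖ ≤ C := by
  obtain ⟨C, hC, h⟩ := exists_smooth_cutoff n one_pos
  choose κ h1 h2 h3 h4 h5 h6 using fun j : ℕ => h (ball 0 (j : ℝ)) measurableSet_ball
  refine ⟨C, hC, κ, h1, fun j => ?_, h2, h3, fun x => ?_, h6⟩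
  · refine HasCompactSupport.of_support_subset_isCompact
      (isCompact_closedBall (0 : Cn n) ((j : ℝ) + 1)) fun x hx => ?_
    by_contra hxb
    refine hx (h5 j x (disjoint_left.2 fun y hy hy0 => hxb ?_))
    rw [mem_ball, dist_eq_norm] at hy
    rw [mem_ball_zero_iff] at hy0
    rw [mem_closedBall_zero_iff]
    have := norm_le_norm_add_norm_sub' x y
    rw [norm_sub_rev] at this
    linarith
  · obtain ⟨N, hN⟩ := exists_nat_ge (‖x‖ + 1)
    filter_upwards [eventually_ge_atTop N] with j hj
    refine h4 j x fun y hy => ?_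
    rw [mem_ball, dist_eq_norm] at hy
    rw [mem_ball_zero_iff]
    have := norm_le_norm_add_norm_sub' y x
    have hj' : (N : ℝ) ≤ j := by exact_mod_cast hj
    linarith

variable {ι : Type*} [Fintype ι] {T : ι → Cn n → Cn n}

/-- Tangential fields that control the radial direction control the multiplication by `t x` near
the boundary. -/
theorem lintegral_boundary_radial_le (hΩ : IsOpen Ω) {m : ℕ} (hm : 1 ≤ m)
    (hρ : IsUniformDefiningFunction Ω m ρ U) {M c R δ A : ℝ} (hc : 0 < c)
    (hT : ∀ i, ContDiffOn ℝ 1 (T i) Ω) (hM0 : ∀ i, ∀ x ∈ Ω, ‖T i x‖ ≤ M)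
    (hM1 : ∀ i, ∀ x ∈ Ω, ‖fderiv ℝ (T i) x‖ ≤ M) (hδU : thickening δ (frontier Ω) ⊆ U)
    (htan : ∀ x ∈ Ω ∩ thickening δ (frontier Ω), (∀ i, fderiv ℝ ρ x (T i x) = 0) ∧
      (R ≤ ‖x‖ → c * ‖x‖ ^ 2 ≤ ∑ i, (inner ℝ (T i x) x) ^ 2))
    {b : Cn n → ℝ} (hb : ContDiff ℝ ∞ b) (hb0 : ∀ x, 0 ≤ b x) (hb1 : ∀ x, b x ≤ 1)
    (hbs : tsupport b ⊆ thickening δ (frontier Ω)) (hbA : ∀ x, ‖fderiv ℝ b x‖ ≤ A) :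
    ∃ C : ℝ≥0, ∀ t : ℝ, ∃ D : ℝ≥0, ∀ f, MemSobolev Ω t 1 f →
      ∫⁻ x, ENNReal.ofReal (t ^ 2 * (b x ^ 2 * ‖x‖ ^ 2)) * ‖f x‖ₑ ^ 2 ∂(wMeasure Ω t) ≤
        C * ∑ i, normSqL2 Ω t (wT Ω t (T i) f) + D * normSqL2 Ω t f := by
  obtain ⟨Cκ, hCκ, κ, hκ, hκc, hκ0, hκ1, hκe, hκd⟩ := exists_exhausting_cutoffs n
  have hA : 0 ≤ A := (norm_nonneg _).trans (hbA 0)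
  have hB : 0 ≤ 2 * ((Cκ + A) * |M|) := by positivity
  obtain ⟨C, hC⟩ := lintegral_radial_le hΩ (R := R) hc hB hT hM0 hM1
  refine ⟨C, fun t => ?_⟩
  obtain ⟨D, hD⟩ := hC t
  refine ⟨D, fun f hf => ?_⟩
  -- A cut-off that is a function of `ρ` alone. Its gradient is unbounded in `j`, but tangential
  -- fields annihilate it, so the bound on `T_i β` is uniform in `j`. This is why no boundary
  -- condition on `f` is needed.
  let ψ : ℕ → Cn n → ℝ := fun j x => Real.smoothTransition (-(((j : ℝ) + 1) * ρ x) - 1)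
  let β : ℕ → Cn n → ℝ := fun j x => (κ j x * b x) ^ 2 * ψ j x
  have hψ0 : ∀ j x, 0 ≤ ψ j x := fun j x => Real.smoothTransition.nonneg _
  have hψ1 : ∀ j x, ψ j x ≤ 1 := fun j x => Real.smoothTransition.le_one _
  have hθ : ∀ j, ContDiff ℝ ∞ fun x => κ j x * b x := fun j => (hκ j).mul hb
  have hθ0 : ∀ j x, 0 ≤ κ j x * b x := fun j x => mul_nonneg (hκ0 j x) (hb0 x)
  have hθ1 : ∀ j x, κ j x * b x ≤ 1 := fun j x => mul_le_one₀ (hκ1 j x) (hb0 x) (hb1 x)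
  have hβ0 : ∀ j x, 0 ≤ β j x := fun j x => mul_nonneg (sq_nonneg _) (hψ0 j x)
  have hβ1 : ∀ j x, β j x ≤ 1 := fun j x =>
    mul_le_one₀ (pow_le_one₀ (hθ0 j x) (hθ1 j x)) (hψ0 j x) (hψ1 j x)
  have hβb : ∀ j x, β j x ≠ 0 → b x ≠ 0 := fun j x h hb => h (by simp [β, hb])
  have hβts : ∀ j, tsupport (β j) ⊆ tsupport b := fun j => closure_mono fun x hx => hβb j x hx
  have hρ1 : ContDiffOn ℝ 1 ρ U := hρ.contDiffOn.of_le (by exact_mod_cast hm)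
  have hψC : ∀ j, ContDiffOn ℝ 1 (ψ j) U := fun j =>
    (Real.smoothTransition.contDiff (n := 1)).comp_contDiffOn
      ((contDiffOn_const.mul hρ1).neg.sub contDiffOn_const)
  have hβC : ∀ j, ContDiff ℝ 1 (β j) := fun j =>
    contDiff_of_tsupport_subset hρ.isOpen
      ((((hθ j).of_le (by simp)).pow 2).contDiffOn.mul (hψC j)) (((hβts j).trans hbs).trans hδU)
  have hβc : ∀ j, HasCompactSupport (β j) := fun j => (hκc j).mono fun x hx hκx => hx (by
    simp [β, hκx])
  have hβs : ∀ j, tsupport (β j) ⊆ Ω := by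
    intro j
    have hj : (0 : ℝ) < (j : ℝ) + 1 := by positivity
    have hcl : IsClosed (tsupport b ∩ ρ ⁻¹' Iic (-1 / ((j : ℝ) + 1))) :=
      (hρ1.continuousOn.mono (hbs.trans hδU)).preimage_isClosed_of_isClosed (isClosed_tsupport b)
        isClosed_Iic
    have hsub : tsupport (β j) ⊆ tsupport b ∩ ρ ⁻¹' Iic (-1 / ((j : ℝ) + 1)) := by
      refine closure_minimal (fun x hx => ⟨subset_tsupport _ (hβb j x hx), ?_⟩) hcl
      by_contra hxρ
      refine hx ?_
      have : ψ j x = 0 := by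
        refine Real.smoothTransition.zero_of_nonpos ?_
        rw [mem_preimage, mem_Iic, not_le, div_lt_iff₀ hj] at hxρ
        linarith
      simp [β, this]
    intro x hx
    refine (hρ.neg_iff x).1 ((hsub hx).2.trans_lt ?_)
    exact div_neg_of_neg_of_pos (by norm_num) hj
  have hβT : ∀ j i, ∀ x ∈ Ω,
      |fderiv ℝ (β j) x (T i x)| ≤ 2 * ((Cκ + A) * |M|) * Real.sqrt (β j x) := by
    intro j i x hx
    by_cases hxb : x ∈ tsupport b
    · have hxt := hbs hxb
      have hxU := hδU hxt
      have hd1 : HasFDerivAt (fun x => κ j x * b x) _ x :=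
        (((hκ j).differentiable (by simp)) x).hasFDerivAt.mul
          ((hb.differentiable (by simp)) x).hasFDerivAt
      have hρd : HasFDerivAt ρ (fderiv ℝ ρ x) x :=
        ((hρ1.contDiffAt (hρ.isOpen.mem_nhds hxU)).differentiableAt one_ne_zero).hasFDerivAt
      have hg : HasFDerivAt (fun x => -(((j : ℝ) + 1) * ρ x) - 1)
          (-(((j : ℝ) + 1) • fderiv ℝ ρ x)) x := (hρd.const_mul ((j : ℝ) + 1)).neg.sub_const 1
      have hst := ((Real.smoothTransition.contDiff (n := 1)).differentiable one_ne_zero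
        (-(((j : ℝ) + 1) * ρ x) - 1)).hasFDerivAt
      have hd2 := hst.comp x hg
      change HasFDerivAt (ψ j) _ x at hd2
      have hd3 : HasFDerivAt (β j) _ x := (hd1.pow 2).mul hd2
      have e : fderiv ℝ (β j) x (T i x) = 2 * (κ j x * b x) * ψ j x *
          (κ j x * fderiv ℝ b x (T i x) + b x * fderiv ℝ (κ j) x (T i x)) := by
        rw [hd3.fderiv]
        simp [(htan x ⟨hx, hxt⟩).1 i]
        ring
      -- The square in the definition of `β` serves this step: a derivative of `(κ b)²` retains one
      -- factor `κ b`, and with `ψ ≤ 1` the result is bounded by `√β`.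
      have hs : (κ j x * b x) * ψ j x ≤ Real.sqrt (β j x) := by
        refine Real.le_sqrt_of_sq_le ?_
        rw [mul_pow]
        refine mul_le_mul_of_nonneg_left ?_ (sq_nonneg _)
        rw [sq]
        exact mul_le_of_le_one_left (hψ0 j x) (hψ1 j x)
      have hM : |M| = M := abs_of_nonneg ((norm_nonneg _).trans (hM0 i x hx))
      have b1 : |fderiv ℝ b x (T i x)| ≤ A * |M| := by
        rw [hM, ← Real.norm_eq_abs]
        exact ((fderiv ℝ b x).le_opNorm _).trans (mul_le_mul (hbA x) (hM0 i x hx) (norm_nonneg _) hA)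
      have b2 : |fderiv ℝ (κ j) x (T i x)| ≤ Cκ * |M| := by
        rw [hM, ← Real.norm_eq_abs]
        exact ((fderiv ℝ (κ j) x).le_opNorm _).trans
          (mul_le_mul (hκd j x) (hM0 i x hx) (norm_nonneg _) hCκ)
      have b3 : |κ j x * fderiv ℝ b x (T i x) + b x * fderiv ℝ (κ j) x (T i x)| ≤
          (Cκ + A) * |M| := by
        refine (abs_add_le _ _).trans ?_
        rw [abs_mul, abs_mul, abs_of_nonneg (hκ0 j x), abs_of_nonneg (hb0 x)]
        have c1 := mul_le_of_le_one_left (abs_nonneg (fderiv ℝ b x (T i x))) (hκ1 j x)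
        have c2 := mul_le_of_le_one_left (abs_nonneg (fderiv ℝ (κ j) x (T i x))) (hb1 x)
        linarith
      rw [e, abs_mul, abs_mul, abs_mul, abs_two, abs_of_nonneg (hψ0 j x), abs_of_nonneg (hθ0 j x)]
      calc 2 * (κ j x * b x) * ψ j x * _ ≤
            2 * (κ j x * b x) * ψ j x * ((Cκ + A) * |M|) := by
            refine mul_le_mul_of_nonneg_left b3 ?_
            exact mul_nonneg (mul_nonneg zero_le_two (hθ0 j x)) (hψ0 j x)
        _ = 2 * ((Cκ + A) * |M|) * (κ j x * b x * ψ j x) := by ring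
        _ ≤ _ := mul_le_mul_of_nonneg_left hs hB
    · have : fderiv ℝ (β j) x = 0 := fderiv_of_notMem_tsupport ℝ fun h => hxb (hβts j h)
      rw [this, zero_apply, abs_zero]
      positivity
  refine lintegral_le_of_eventually_eq
    (G := fun j x => ENNReal.ofReal (t ^ 2 * (β j x * ‖x‖ ^ 2)) * ‖f x‖ₑ ^ 2) (fun j => ?_) ?_
    fun j => hD (β j) (hβC j) (hβc j) (hβs j) (hβ0 j) (hβ1 j) (hβT j) (fun x hx hβx =>
      (htan x ⟨hx, hbs (subset_tsupport _ (hβb j x hβx))⟩).2) f hf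
  · refine AEMeasurable.mul ?_ (hf.memLp.1.enorm.pow_const 2)
    exact (continuous_const.mul ((hβC j).continuous.mul
      (continuous_norm.pow 2))).measurable.ennreal_ofReal.aemeasurable
  · filter_upwards [ae_mem_wMeasure hΩ] with x hx
    have hρx : ρ x < 0 := (hρ.neg_iff x).2 hx
    -- Once `(j + 1) * (-ρ x) ≥ 2`, the argument of the smooth transition is at least 1.
    obtain ⟨N, hN⟩ := exists_nat_ge (2 / (-ρ x))
    filter_upwards [hκe x, eventually_ge_atTop N] with j hj hjN
    have : ψ j x = 1 := by
      refine Real.smoothTransition.one_of_one_le ?_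
      rw [div_le_iff₀ (by linarith)] at hN
      have h1 : (N : ℝ) ≤ (j : ℝ) + 1 := by
        have : (N : ℝ) ≤ j := by exact_mod_cast hjN
        linarith
      have h2 : (N : ℝ) * -ρ x ≤ ((j : ℝ) + 1) * -ρ x :=
        mul_le_mul_of_nonneg_right h1 (by linarith)
      linarith
    simp only [β, this, hj, one_mul, mul_one]

end BoundaryStrip

/-! ### Exterior and interior multiplication in coordinates. -/

section Anticommutation

variable {n q : ℕ}

theorem conj_eps (j : Fin n) (I J : Finset (Fin n)) : (starRingEnd ℂ) (eps j I J) = eps j I J := by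
  unfold eps; split_ifs <;> simp

theorem norm_eps_le (j : Fin n) (I J : Finset (Fin n)) : ‖eps j I J‖ ≤ 1 := by
  unfold eps; split_ifs <;> simp

/-- The sign of the permutation that sorts `(j, I)`. -/
noncomputable def sgn {n : ℕ} (j : Fin n) (I : Finset (Fin n)) : ℂ :=
  (-1) ^ (I.filter (fun i => i < j)).card

theorem sgn_mul_self (j : Fin n) (I : Finset (Fin n)) : sgn j I * sgn j I = 1 := by
  rw [sgn, ← mul_pow]; simp

theorem sum_eps_raise (j k : Fin n) (J J' : MultiIdx n q) :
    ∑ K : MultiIdx n (q + 1), eps j J.1 K.1 * eps k J'.1 K.1 =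
      if j ∉ J.1 ∧ k ∉ J'.1 ∧ insert j J.1 = insert k J'.1 then sgn j J.1 * sgn k J'.1 else 0 := by
  split_ifs with h
  · obtain ⟨h1, h2, h3⟩ := h
    rw [Finset.sum_eq_single
      (⟨insert j J.1, by rw [Finset.card_insert_of_notMem h1, J.2]⟩ : MultiIdx n (q + 1))]
    · rw [eps, eps, if_pos ⟨h1, rfl⟩, if_pos ⟨h2, h3.symm⟩]; rfl
    · intro K _ hK
      rw [eps, if_neg, zero_mul]
      rintro ⟨-, h⟩
      exact hK (Subtype.ext h.symm)
    · simp
  · refine Finset.sum_eq_zero fun K _ => ?_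
    unfold eps
    split_ifs with h1 h2
    · exact absurd ⟨h1.1, h2.1, h1.2.trans h2.2.symm⟩ h
    all_goals simp

/-- For `q = 0` the truncated `q - 1` is harmless: `J` is empty, so both sides vanish. -/
theorem sum_eps_lower (j k : Fin n) (J J' : MultiIdx n q) :
    ∑ I : MultiIdx n (q - 1), eps k I.1 J.1 * eps j I.1 J'.1 =
      if k ∈ J.1 ∧ j ∈ J'.1 ∧ J.1.erase k = J'.1.erase j then
        sgn k (J.1.erase k) * sgn j (J'.1.erase j) else 0 := by
  split_ifs with h
  · obtain ⟨h1, h2, h3⟩ := h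
    rw [Finset.sum_eq_single
      (⟨J.1.erase k, by rw [Finset.card_erase_of_mem h1, J.2]⟩ : MultiIdx n (q - 1))]
    · have a1 : j ∉ J.1.erase k := by rw [h3]; exact Finset.notMem_erase _ _
      have a2 : insert j (J.1.erase k) = J'.1 := by rw [h3]; exact Finset.insert_erase h2
      rw [eps, eps, if_pos ⟨Finset.notMem_erase _ _, Finset.insert_erase h1⟩, if_pos ⟨a1, a2⟩, ← h3]
      rfl
    · intro I _ hI
      rw [eps, if_neg, zero_mul]
      rintro ⟨h, h'⟩
      exact hI (Subtype.ext (show I.1 = J.1.erase k by rw [← h', Finset.erase_insert h]))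
    · simp
  · refine Finset.sum_eq_zero fun I _ => ?_
    unfold eps
    split_ifs with h1 h2
    · refine absurd ⟨h1.2 ▸ Finset.mem_insert_self _ _, h2.2 ▸ Finset.mem_insert_self _ _, ?_⟩ h
      rw [← h1.2, ← h2.2, Finset.erase_insert h1.1, Finset.erase_insert h2.1]
    all_goals simp

/-- The sign counts the elements smaller than `j`, and there is now one more. -/
theorem sgn_insert_of_lt {j k : Fin n} {I : Finset (Fin n)} (hk : k ∉ I) (h : k < j) :
    sgn j (insert k I) = -sgn j I := by
  rw [sgn, sgn, Finset.filter_insert, if_pos h, Finset.card_insert_of_notMem, pow_succ, mul_neg,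
    mul_one]
  exact fun h' => hk (Finset.mem_filter.1 h').1

theorem sgn_insert_of_not_lt {j k : Fin n} {I : Finset (Fin n)} (h : ¬k < j) :
    sgn j (insert k I) = sgn j I := by
  rw [sgn, sgn, Finset.filter_insert, if_neg h]

/-- The anticommutation relation of exterior and interior multiplication. -/
theorem sum_eps_anticomm (j k : Fin n) (J J' : MultiIdx n q) :
    (∑ K : MultiIdx n (q + 1), eps j J.1 K.1 * eps k J'.1 K.1) +
      (∑ I : MultiIdx n (q - 1), eps k I.1 J.1 * eps j I.1 J'.1) =
      if j = k ∧ J = J' then 1 else 0 := by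
  rw [sum_eps_raise, sum_eps_lower]
  by_cases hjk : j = k
  · subst hjk
    by_cases hJ : J = J'
    · subst hJ
      by_cases hj : j ∈ J.1
      · simp [hj, sgn_mul_self]
      · simp [hj, sgn_mul_self]
    · rw [if_neg, if_neg, if_neg, add_zero]
      · exact fun h => hJ h.2
      · rintro ⟨h1, h2, h3⟩
        exact hJ (Subtype.ext (by rw [← Finset.insert_erase h1, h3, Finset.insert_erase h2]))
      · rintro ⟨h1, h2, h3⟩
        exact hJ (Subtype.ext (by rw [← Finset.erase_insert h1, h3, Finset.erase_insert h2]))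
  · rw [if_neg (c := j = k ∧ J = J') fun h => hjk h.1]
    by_cases h : k ∈ J.1 ∧ j ∈ J'.1 ∧ J.1.erase k = J'.1.erase j
    · obtain ⟨h1, h2, h3⟩ := h
      -- Off the diagonal both sums have one term at most, present for the same pairs `J = I ∪ {k}`,
      -- `J' = I ∪ {j}`. Exactly one of `j < k`, `k < j` holds, so exactly one sign flips and the
      -- terms cancel.
      set I := J.1.erase k with hI
      have hkI : k ∉ I := Finset.notMem_erase _ _
      have hjI : j ∉ I := h3 ▸ Finset.notMem_erase _ _
      have hJ : J.1 = insert k I := (Finset.insert_erase h1).symm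
      have hJ' : J'.1 = insert j I := h3 ▸ (Finset.insert_erase h2).symm
      have hc : j ∉ J.1 ∧ k ∉ J'.1 ∧ insert j J.1 = insert k J'.1 := by
        rw [hJ, hJ']
        exact ⟨by simp [hjk, hjI], by simp [Ne.symm hjk, hkI], Finset.insert_comm _ _ _⟩
      rw [if_pos hc, if_pos ⟨h1, h2, h3⟩, ← h3, hJ, hJ']
      rcases lt_or_gt_of_ne hjk with hlt | hlt
      · rw [sgn_insert_of_not_lt hlt.not_gt, sgn_insert_of_lt hjI hlt]; ring
      · rw [sgn_insert_of_lt hkI hlt, sgn_insert_of_not_lt hlt.not_gt]; ring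
    · rw [if_neg h, if_neg, add_zero]
      rintro ⟨h1, h2, h3⟩
      refine h ⟨?_, ?_, ?_⟩
      · have : k ∈ insert j J.1 := h3 ▸ Finset.mem_insert_self _ _
        exact (Finset.mem_insert.1 this).resolve_left (Ne.symm hjk)
      · have : j ∈ insert k J'.1 := h3 ▸ Finset.mem_insert_self _ _
        exact (Finset.mem_insert.1 this).resolve_left hjk
      · ext i
        have := Finset.ext_iff.1 h3 i
        simp only [Finset.mem_insert] at this
        simp only [Finset.mem_erase]
        by_cases hik : i = k
        · subst hik; simp [h2]
        · by_cases hij : i = j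
          · subst hij; simp [h1]
          · simp only [hik, hij, false_or] at this
            simp [hik, hij, this]

/-- Exterior multiplication by `(w_j)`: the coefficients `∑ ε^{jJ}_K w_{jJ}`. -/
noncomputable def raise (w : Fin n → MultiIdx n q → ℂ) (K : MultiIdx n (q + 1)) : ℂ :=
  ∑ p : Fin n × MultiIdx n q, eps p.1 p.2.1 K.1 * w p.1 p.2

/-- Interior multiplication by `(w_j)`: the coefficients `∑ ε^{jI}_J w_{jJ}`. -/
noncomputable def lower (w : Fin n → MultiIdx n q → ℂ) (I : MultiIdx n (q - 1)) : ℂ :=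
  ∑ p : Fin n × MultiIdx n q, eps p.1 I.1 p.2.1 * w p.1 p.2

theorem sum_raise_mul_conj (w : Fin n → MultiIdx n q → ℂ) :
    ∑ K, raise w K * (starRingEnd ℂ) (raise w K) =
      ∑ p : Fin n × MultiIdx n q, ∑ p' : Fin n × MultiIdx n q,
        (∑ K : MultiIdx n (q + 1), eps p.1 p.2.1 K.1 * eps p'.1 p'.2.1 K.1) *
          (w p.1 p.2 * (starRingEnd ℂ) (w p'.1 p'.2)) := by
  simp only [raise, map_sum, map_mul, conj_eps, Finset.sum_mul, Finset.mul_sum]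
  rw [Finset.sum_comm]
  conv_rhs => rw [Finset.sum_comm]
  refine Finset.sum_congr rfl fun p _ => ?_
  rw [Finset.sum_comm]
  refine Finset.sum_congr rfl fun p' _ => Finset.sum_congr rfl fun K _ => ?_
  ring

/-- The first indices of `p` and `p'` are exchanged compared with `sum_raise_mul_conj`, so that the
coefficients are those of the anticommutation relation. The price is that `w` is evaluated with
exchanged indices, which is where the commutator of `L_k` and `∂̄_j` will enter. -/
theorem sum_lower_mul_conj (w : Fin n → MultiIdx n q → ℂ) :
    ∑ I, lower w I * (starRingEnd ℂ) (lower w I) =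
      ∑ p : Fin n × MultiIdx n q, ∑ p' : Fin n × MultiIdx n q,
        (∑ I : MultiIdx n (q - 1), eps p'.1 I.1 p.2.1 * eps p.1 I.1 p'.2.1) *
          (w p'.1 p.2 * (starRingEnd ℂ) (w p.1 p'.2)) := by
  have h : ∑ I, lower w I * (starRingEnd ℂ) (lower w I) =
      ∑ p : Fin n × MultiIdx n q, ∑ p' : Fin n × MultiIdx n q,
        (∑ I : MultiIdx n (q - 1), eps p.1 I.1 p.2.1 * eps p'.1 I.1 p'.2.1) *
          (w p.1 p.2 * (starRingEnd ℂ) (w p'.1 p'.2)) := by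
    simp only [lower, map_sum, map_mul, conj_eps, Finset.sum_mul, Finset.mul_sum]
    rw [Finset.sum_comm]
    conv_rhs => rw [Finset.sum_comm]
    refine Finset.sum_congr rfl fun p _ => ?_
    rw [Finset.sum_comm]
    refine Finset.sum_congr rfl fun p' _ => Finset.sum_congr rfl fun K _ => ?_
    ring
  rw [h]
  simp only [Fintype.sum_prod_type]
  rw [Finset.sum_comm]
  conv_rhs => rw [Finset.sum_comm]
  refine Finset.sum_congr rfl fun J _ => ?_
  rw [Finset.sum_comm]

/-- Consequence of the anticommutation relation for a pair of sesquilinear expressions that agree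
up to a diagonal term. -/
theorem sum_anticomm {W V : Fin n × MultiIdx n q → Fin n × MultiIdx n q → ℂ}
    {Z : MultiIdx n q → MultiIdx n q → ℂ}
    (h : ∀ p p', V p p' = W p p' + if p.1 = p'.1 then Z p.2 p'.2 else 0) :
    (∑ p, ∑ p', (∑ K : MultiIdx n (q + 1), eps p.1 p.2.1 K.1 * eps p'.1 p'.2.1 K.1) * W p p') +
      (∑ p, ∑ p', (∑ I : MultiIdx n (q - 1), eps p'.1 I.1 p.2.1 * eps p.1 I.1 p'.2.1) * V p p') =
      (∑ p, W p p) + ∑ p : Fin n × MultiIdx n q, if p.1 ∈ p.2.1 then Z p.2 p.2 else 0 := by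
  have key : ∀ p p' : Fin n × MultiIdx n q,
      (∑ K : MultiIdx n (q + 1), eps p.1 p.2.1 K.1 * eps p'.1 p'.2.1 K.1) * W p p' +
      (∑ I : MultiIdx n (q - 1), eps p'.1 I.1 p.2.1 * eps p.1 I.1 p'.2.1) * V p p' =
      (if p = p' then W p p' else 0) +
        if p = p' then (if p.1 ∈ p.2.1 then Z p.2 p.2 else 0) else 0 := by
    rintro ⟨j, J⟩ ⟨k, J'⟩
    rw [h, mul_add, ← add_assoc, ← add_mul, sum_eps_anticomm, sum_eps_lower]
    congr 1
    · simp only [Prod.mk.injEq]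
      split_ifs <;> simp
    · by_cases hjk : j = k
      · subst hjk
        by_cases hJ : J = J'
        · subst hJ
          by_cases hj : j ∈ J.1 <;> simp [hj, sgn_mul_self]
        · rw [if_neg, zero_mul, if_neg]
          · simpa using hJ
          · rintro ⟨h1, h2, h3⟩
            exact hJ (Subtype.ext (by rw [← Finset.insert_erase h1, h3, Finset.insert_erase h2]))
      · simp [hjk]
  simp only [← Finset.sum_add_distrib, key]
  simp [Finset.sum_add_distrib]

/-- Ellipticity of the principal symbol: `|N ∧ S|² + |N̄ ⌟ S|² = |N|² |S|²`. Here the two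
sesquilinear expressions agree exactly, so there is no diagonal correction. -/
theorem sum_norm_raise_lower_rankOne (N : Fin n → ℂ) (S : MultiIdx n q → ℂ) :
    ∑ K, ‖raise (fun j J => N j * S J) K‖ ^ 2 +
      ∑ I, ‖lower (fun j J => (starRingEnd ℂ) (N j) * S J) I‖ ^ 2 =
      (∑ j, ‖N j‖ ^ 2) * ∑ J, ‖S J‖ ^ 2 := by
  have e : ∀ z : ℂ, ((‖z‖ ^ 2 : ℝ) : ℂ) = z * (starRingEnd ℂ) z := fun z => by
    rw [Complex.mul_conj, Complex.normSq_eq_norm_sq]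
  rw [← Complex.ofReal_inj, Complex.ofReal_add, Complex.ofReal_sum, Complex.ofReal_sum,
    Complex.ofReal_mul, Complex.ofReal_sum, Complex.ofReal_sum]
  simp only [e]
  rw [sum_raise_mul_conj, sum_lower_mul_conj, sum_anticomm
    (W := fun p p' => (N p.1 * S p.2) * (starRingEnd ℂ) (N p'.1 * S p'.2)) (Z := fun _ _ => 0)]
  · simp only [ite_self, Finset.sum_const_zero, add_zero, Fintype.sum_prod_type,
      Finset.sum_mul_sum, map_mul]
    refine Finset.sum_congr rfl fun j _ => Finset.sum_congr rfl fun J _ => ?_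
    ring
  · intro p p'
    simp only [map_mul, Complex.conj_conj, ite_self, add_zero]
    ring

end Anticommutation

/-! ### Pointwise ellipticity at the boundary and in the interior. -/

section Pointwise

variable {n q : ℕ} {ι : Type*} [Fintype ι]

theorem norm_add_sq_le_two (a b : ℂ) : ‖a + b‖ ^ 2 ≤ 2 * ‖a‖ ^ 2 + 2 * ‖b‖ ^ 2 := by
  nlinarith [norm_add_le a b, norm_nonneg (a + b), sq_nonneg (‖a‖ - ‖b‖), norm_nonneg a,
    norm_nonneg b]

theorem norm_sub_sq_le_two (a b : ℂ) : ‖a - b‖ ^ 2 ≤ 2 * ‖a‖ ^ 2 + 2 * ‖b‖ ^ 2 := by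
  simpa [sub_eq_add_neg] using norm_add_sq_le_two a (-b)

theorem norm_sum_sq_le_card {κ : Type*} [Fintype κ] (F : κ → ℂ) :
    ‖∑ i, F i‖ ^ 2 ≤ Fintype.card κ * ∑ i, ‖F i‖ ^ 2 :=
  (pow_le_pow_left₀ (norm_nonneg _) (norm_sum_le _ _) 2).trans sq_sum_le_card_mul_sum_sq

/-- `∂̄_j` in terms of the weighted real derivatives `X` of a function with value `z` at `x`. -/
noncomputable def dzbarOf {n : ℕ} (t : ℝ) (x : Cn n) (X : Fin n × Fin 2 → ℂ) (z : ℂ) (j : Fin n) :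
    ℂ := (1 / 2) * (X (j, 0) + Complex.I * X (j, 1)) + t * zCoord j x * z

/-- `L_j^t` in terms of the weighted real derivatives. -/
noncomputable def wLOf {n : ℕ} (X : Fin n × Fin 2 → ℂ) (j : Fin n) : ℂ :=
  (1 / 2) * (X (j, 0) - Complex.I * X (j, 1))

theorem norm_zCoord_sq (j : Fin n) (x : Cn n) : ‖zCoord j x‖ ^ 2 = x (j, 0) ^ 2 + x (j, 1) ^ 2 := by
  rw [← Complex.normSq_eq_norm_sq, Complex.normSq_apply]
  simp [zCoord]; ring

theorem sum_norm_zCoord_sq (x : Cn n) : ∑ j, ‖zCoord j x‖ ^ 2 = ‖x‖ ^ 2 := by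
  simp only [norm_zCoord_sq, EuclideanSpace.norm_sq_eq, Fintype.sum_prod_type, Fin.sum_univ_two,
    Real.norm_eq_abs, sq_abs]

theorem norm_pair_sq (u v : ℂ) :
    ‖u + v‖ ^ 2 + ‖Complex.I * (u - v)‖ ^ 2 = 2 * (‖u‖ ^ 2 + ‖v‖ ^ 2) := by
  rw [norm_mul, Complex.norm_I, one_mul]
  have := parallelogram_law_with_norm ℝ u v
  linarith

/-- `X_{j,0}` and `X_{j,1}` are the sum and `i` times the difference of `L_j` and `∂̄_j - t z_j`;
the parallelogram law does the rest. -/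
theorem sum_norm_sq_le_wirtinger (t : ℝ) (x : Cn n) (X : Fin n × Fin 2 → ℂ) (z : ℂ) :
    ∑ l, ‖X l‖ ^ 2 ≤ 4 * ∑ j, (‖dzbarOf t x X z j‖ ^ 2 + ‖wLOf X j‖ ^ 2) +
      4 * (t ^ 2 * ‖x‖ ^ 2 * ‖z‖ ^ 2) := by
  rw [← sum_norm_zCoord_sq, Fintype.sum_prod_type, Finset.mul_sum Finset.univ _ (4 : ℝ),
    Finset.mul_sum, Finset.sum_mul, Finset.mul_sum, ← Finset.sum_add_distrib]
  refine Finset.sum_le_sum fun j _ => ?_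
  rw [Fin.sum_univ_two]
  have e0 : X (j, 0) = wLOf X j + (dzbarOf t x X z j - t * zCoord j x * z) := by
    simp only [wLOf, dzbarOf]; ring
  have e1 : X (j, 1) = Complex.I * (wLOf X j - (dzbarOf t x X z j - t * zCoord j x * z)) := by
    simp only [wLOf, dzbarOf]
    ring_nf
    rw [Complex.I_sq]; ring
  rw [e0, e1, norm_pair_sq]
  have h := norm_sub_sq_le_two (dzbarOf t x X z j) (t * zCoord j x * z)
  have e2 : ‖(t * zCoord j x * z : ℂ)‖ ^ 2 = t ^ 2 * ‖zCoord j x‖ ^ 2 * ‖z‖ ^ 2 := by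
    rw [norm_mul, norm_mul, Complex.norm_real, mul_pow, mul_pow, Real.norm_eq_abs, sq_abs]
  rw [e2] at h
  nlinarith [sq_nonneg ‖wLOf X j‖]

/-- `∂̄_j` lacks the weight term that its counterpart in `X` has. Expressing `T^t` through `L_j` and
`∂̄_j` therefore leaves `t z ∑ Ā_j z_j`, whose squared modulus is the left side. -/
theorem radial_le_wirtinger {M : ℝ} (t : ℝ) (x a : Cn n) (ha : ‖a‖ ≤ M) (X : Fin n × Fin 2 → ℂ)
    (z : ℂ) : t ^ 2 * ((inner ℝ a x) ^ 2 + (inner ℝ a (rotJ x)) ^ 2) * ‖z‖ ^ 2 ≤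
      2 * ‖∑ l, (a l : ℂ) * X l‖ ^ 2 +
        4 * n * M ^ 2 * ∑ j, (‖dzbarOf t x X z j‖ ^ 2 + ‖wLOf X j‖ ^ 2) := by
  set A : Fin n → ℂ := fun j => (a (j, 0) : ℂ) + Complex.I * (a (j, 1) : ℂ) with hA
  have hAn : ∀ j, ‖A j‖ ^ 2 ≤ M ^ 2 := by
    intro j
    have h1 : ‖A j‖ ^ 2 = ‖zCoord j a‖ ^ 2 := rfl
    rw [h1]
    calc ‖zCoord j a‖ ^ 2 ≤ ∑ j, ‖zCoord j a‖ ^ 2 :=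
          Finset.single_le_sum (f := fun j => ‖zCoord j a‖ ^ 2) (fun _ _ => sq_nonneg _)
            (Finset.mem_univ j)
      _ = ‖a‖ ^ 2 := sum_norm_zCoord_sq a
      _ ≤ M ^ 2 := pow_le_pow_left₀ (norm_nonneg _) ha 2
  have e1 : ∑ j, (starRingEnd ℂ) (A j) * zCoord j x =
      ((inner ℝ a x : ℝ) : ℂ) - Complex.I * ((inner ℝ a (rotJ x) : ℝ) : ℂ) := by
    simp only [PiLp.inner_apply, Fintype.sum_prod_type, Fin.sum_univ_two, rotJ_zero_coord,
      rotJ_one_coord]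
    push_cast
    rw [Finset.mul_sum, ← Finset.sum_sub_distrib]
    refine Finset.sum_congr rfl fun j _ => ?_
    simp [hA, zCoord]
    ring_nf
    rw [Complex.I_sq]; ring
  have e2 : (t * z) * ∑ j, (starRingEnd ℂ) (A j) * zCoord j x =
      ∑ j, (A j * wLOf X j + (starRingEnd ℂ) (A j) * dzbarOf t x X z j) -
        ∑ l, (a l : ℂ) * X l := by
    rw [Fintype.sum_prod_type, Finset.mul_sum, ← Finset.sum_sub_distrib]
    refine Finset.sum_congr rfl fun j _ => ?_
    simp [hA, wLOf, dzbarOf]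
    ring_nf
    rw [Complex.I_sq]; ring
  have e3 : ‖∑ j, (starRingEnd ℂ) (A j) * zCoord j x‖ ^ 2 =
      (inner ℝ a x) ^ 2 + (inner ℝ a (rotJ x)) ^ 2 := by
    rw [e1, ← Complex.normSq_eq_norm_sq, Complex.normSq_apply]
    simp; ring
  have e4 : t ^ 2 * ((inner ℝ a x) ^ 2 + (inner ℝ a (rotJ x)) ^ 2) * ‖z‖ ^ 2 =
      ‖(t * z) * ∑ j, (starRingEnd ℂ) (A j) * zCoord j x‖ ^ 2 := by
    rw [← e3, norm_mul, norm_mul, Complex.norm_real, mul_pow, mul_pow, Real.norm_eq_abs, sq_abs]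
    ring
  rw [e4, e2]
  have h1 : ‖∑ j, (A j * wLOf X j + (starRingEnd ℂ) (A j) * dzbarOf t x X z j)‖ ^ 2 ≤
      2 * n * M ^ 2 * ∑ j, (‖dzbarOf t x X z j‖ ^ 2 + ‖wLOf X j‖ ^ 2) := by
    refine (norm_sum_sq_le_card _).trans ?_
    rw [Fintype.card_fin, mul_comm (2 : ℝ), mul_assoc, mul_assoc]
    refine mul_le_mul_of_nonneg_left ?_ (Nat.cast_nonneg n)
    rw [← mul_assoc, Finset.mul_sum]
    refine Finset.sum_le_sum fun j _ => (norm_add_sq_le_two _ _).trans ?_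
    rw [norm_mul, norm_mul, RCLike.norm_conj, mul_pow, mul_pow]
    have := mul_le_mul_of_nonneg_right (hAn j) (sq_nonneg ‖wLOf X j‖)
    have := mul_le_mul_of_nonneg_right (hAn j) (sq_nonneg ‖dzbarOf t x X z j‖)
    linarith
  have h2 := norm_sub_sq_le_two
    (∑ j, (A j * wLOf X j + (starRingEnd ℂ) (A j) * dzbarOf t x X z j)) (∑ l, (a l : ℂ) * X l)
  linarith

/-- In the interior, the full gradient is controlled by `∂̄_j`, `L_j` and the fields. -/
theorem exists_interior_pointwise (n : ℕ) (ι : Type*) [Fintype ι] (M : ℝ) {c : ℝ} (hc : 0 < c) :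
    ∃ C : ℝ, 0 ≤ C ∧ ∀ (t : ℝ) (x : Cn n) (a : ι → Cn n), (∀ i, ‖a i‖ ≤ M) →
      c * ‖x‖ ^ 2 ≤ ∑ i, ((inner ℝ (a i) x) ^ 2 + (inner ℝ (a i) (rotJ x)) ^ 2) →
      ∀ (X : Fin n × Fin 2 → ℂ) (z : ℂ), ∑ l, ‖X l‖ ^ 2 ≤
        C * (∑ j, (‖dzbarOf t x X z j‖ ^ 2 + ‖wLOf X j‖ ^ 2) +
          ∑ i, ‖∑ l, (a i l : ℂ) * X l‖ ^ 2) := by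
  refine ⟨4 + 4 / c * (2 + Fintype.card ι * (4 * n * M ^ 2)), by positivity,
    fun t x a ha hx X z => ?_⟩
  have h1 := sum_norm_sq_le_wirtinger t x X z
  have h2 := Finset.sum_le_sum fun i (_ : i ∈ Finset.univ) =>
    radial_le_wirtinger t x (a i) (ha i) X z
  rw [Finset.sum_add_distrib, Finset.sum_const, Finset.card_univ, nsmul_eq_mul,
    ← Finset.mul_sum, ← Finset.sum_mul, ← Finset.mul_sum] at h2
  set S := ∑ j, (‖dzbarOf t x X z j‖ ^ 2 + ‖wLOf X j‖ ^ 2) with hS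
  set G := ∑ i, ‖∑ l, (a i l : ℂ) * X l‖ ^ 2 with hG
  have hS0 : 0 ≤ S := Finset.sum_nonneg fun j _ => by positivity
  have hG0 : 0 ≤ G := Finset.sum_nonneg fun j _ => by positivity
  have h3 : t ^ 2 * ‖x‖ ^ 2 * ‖z‖ ^ 2 ≤
      1 / c * (2 * G + Fintype.card ι * (4 * n * M ^ 2 * S)) := by
    have h4 : t ^ 2 * (c * ‖x‖ ^ 2) * ‖z‖ ^ 2 ≤
      2 * G + Fintype.card ι * (4 * n * M ^ 2 * S) := le_trans (by gcongr) h2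
    have h5 := mul_le_mul_of_nonneg_left h4 (by positivity : 0 ≤ 1 / c)
    calc _ = 1 / c * (t ^ 2 * (c * ‖x‖ ^ 2) * ‖z‖ ^ 2) := by field_simp
      _ ≤ _ := h5
  have h6 : 0 ≤ 4 * G + 4 / c * (2 * S + Fintype.card ι * (4 * n * M ^ 2) * G) := by positivity
  calc ∑ l, ‖X l‖ ^ 2 ≤ 4 * S + 4 * (1 / c * (2 * G + Fintype.card ι * (4 * n * M ^ 2 * S))) := by
        linarith
    _ ≤ 4 * S + 4 * (1 / c * (2 * G + Fintype.card ι * (4 * n * M ^ 2 * S))) +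
        (4 * G + 4 / c * (2 * S + Fintype.card ι * (4 * n * M ^ 2) * G)) :=
        le_add_of_nonneg_right h6
    _ = _ := by ring

theorem raise_add (w w' : Fin n → MultiIdx n q → ℂ) (K : MultiIdx n (q + 1)) :
    raise (fun j J => w j J + w' j J) K = raise w K + raise w' K := by
  simp only [raise, mul_add, Finset.sum_add_distrib]

theorem lower_add (w w' : Fin n → MultiIdx n q → ℂ) (I : MultiIdx n (q - 1)) :
    lower (fun j J => w j J + w' j J) I = lower w I + lower w' I := by
  simp only [lower, mul_add, Finset.sum_add_distrib]

theorem norm_raise_sq_le (w : Fin n → MultiIdx n q → ℂ) (K : MultiIdx n (q + 1)) :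
    ‖raise w K‖ ^ 2 ≤ Fintype.card (Fin n × MultiIdx n q) *
      ∑ p : Fin n × MultiIdx n q, ‖w p.1 p.2‖ ^ 2 := by
  refine (norm_sum_sq_le_card _).trans (mul_le_mul_of_nonneg_left ?_ (Nat.cast_nonneg _))
  refine Finset.sum_le_sum fun p _ => ?_
  rw [norm_mul, mul_pow]
  exact mul_le_of_le_one_left (sq_nonneg _) (pow_le_one₀ (norm_nonneg _) (norm_eps_le _ _ _))

theorem norm_lower_sq_le (w : Fin n → MultiIdx n q → ℂ) (I : MultiIdx n (q - 1)) :
    ‖lower w I‖ ^ 2 ≤ Fintype.card (Fin n × MultiIdx n q) *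
      ∑ p : Fin n × MultiIdx n q, ‖w p.1 p.2‖ ^ 2 := by
  refine (norm_sum_sq_le_card _).trans (mul_le_mul_of_nonneg_left ?_ (Nat.cast_nonneg _))
  refine Finset.sum_le_sum fun p _ => ?_
  rw [norm_mul, mul_pow]
  exact mul_le_of_le_one_left (sq_nonneg _) (pow_le_one₀ (norm_nonneg _) (norm_eps_le _ _ _))

/-- The tangential part of a complex gradient is controlled by tangential fields. -/
theorem tangential_part_le {c : ℝ} {g : Cn n} (hg : ‖g‖ = 1) {a : ι → Cn n}
    (ha : ∀ i, inner ℝ g (a i) = 0)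
    (hspan : ∀ ξ : Cn n, inner ℝ g ξ = 0 → c * ‖ξ‖ ^ 2 ≤ ∑ i, (inner ℝ (a i) ξ) ^ 2)
    (X : Fin n × Fin 2 → ℂ) :
    c * ∑ l, ‖X l - (g l : ℂ) * ∑ m, (g m : ℂ) * X m‖ ^ 2 ≤
      ∑ i, ‖∑ l, (a i l : ℂ) * X l‖ ^ 2 := by
  set S := ∑ m, (g m : ℂ) * X m with hS
  have hg2 : ∑ l, (g l) ^ 2 = 1 := by
    have := EuclideanSpace.norm_sq_eq g
    rw [hg] at this
    simpa using this.symm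
  have hag : ∀ i, ∑ l, a i l * g l = 0 := fun i => by
    have := ha i
    simpa [PiLp.inner_apply, mul_comm] using this
  -- The spanning hypothesis speaks of real vectors, so it is applied to the real and the imaginary
  -- parts separately.
  have hpart : ∀ P : ℂ →ₗ[ℝ] ℝ, c * ∑ l, (P (X l - (g l : ℂ) * S)) ^ 2 ≤
      ∑ i, (P (∑ l, (a i l : ℂ) * X l)) ^ 2 := by
    intro P
    have hP : ∀ (r : ℝ) (w : ℂ), P ((r : ℂ) * w) = r * P w := fun r w => by
      rw [← Complex.real_smul, map_smul, smul_eq_mul]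
    set ξ : Cn n := WithLp.toLp 2 fun l => P (X l - (g l : ℂ) * S) with hξ
    have hξl : ∀ l, ξ l = P (X l) - g l * P S := fun l => by
      simp only [hξ, map_sub, hP]
    have h0 : inner ℝ g ξ = 0 := by
      have : P S = ∑ l, g l * P (X l) := by rw [hS, map_sum]; simp only [hP]
      simp only [PiLp.inner_apply, hξl, RCLike.inner_apply, conj_trivial]
      calc ∑ l, (P (X l) - g l * P S) * g l = (∑ l, g l * P (X l)) - (∑ l, (g l) ^ 2) * P S := by
            rw [Finset.sum_mul, ← Finset.sum_sub_distrib]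
            exact Finset.sum_congr rfl fun l _ => by ring
        _ = 0 := by rw [hg2, ← this]; ring
    have h1 := hspan ξ h0
    have h2 : ∀ i, inner ℝ (a i) ξ = P (∑ l, (a i l : ℂ) * X l) := by
      intro i
      rw [map_sum]
      simp only [PiLp.inner_apply, hξl, RCLike.inner_apply, conj_trivial, hP]
      calc ∑ l, (P (X l) - g l * P S) * a i l =
            (∑ l, a i l * P (X l)) - (∑ l, a i l * g l) * P S := by
            rw [Finset.sum_mul, ← Finset.sum_sub_distrib]
            exact Finset.sum_congr rfl fun l _ => by ring
        _ = _ := by rw [hag]; ring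
    simp only [h2] at h1
    have h3 : ‖ξ‖ ^ 2 = ∑ l, (P (X l - (g l : ℂ) * S)) ^ 2 := by
      rw [EuclideanSpace.norm_sq_eq]
      simp [hξ]
    rwa [h3] at h1
  have hn : ∀ w : ℂ, ‖w‖ ^ 2 = (Complex.reLm w) ^ 2 + (Complex.imLm w) ^ 2 := fun w => by
    rw [← Complex.normSq_eq_norm_sq, Complex.normSq_apply]; simp; ring
  simp only [hn, Finset.sum_add_distrib, mul_add]
  exact add_le_add (hpart _) (hpart _)

theorem boundary_arith {B c RR LL TT ZZ YY SS XX : ℝ} (hc : 0 < c) (hB : 0 ≤ B) (hRR : 0 ≤ RR)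
    (hLL : 0 ≤ LL) (hTT : 0 ≤ TT) (hZZ : 0 ≤ ZZ) (hYT : YY ≤ TT / c)
    (hSS : 1 / 4 * SS ≤ 2 * RR + 2 * LL + 2 * B * (YY + 2 * ZZ)) (hX : XX ≤ 2 * SS + 2 * YY) :
    XX ≤ (16 + 32 * B + (32 * B + 2) / c) * (RR + LL + TT + ZZ) := by
  have hk : (16 * B + 2) * YY ≤ (16 * B + 2) * (TT / c) :=
    mul_le_mul_of_nonneg_left hYT (by positivity)
  have hr : 0 ≤ (32 * B + (32 * B + 2) / c) * (RR + LL) + (16 + 32 * B) * TT + 16 * B / c * TT +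
      (16 + (32 * B + 2) / c) * ZZ := by positivity
  calc XX ≤ 16 * RR + 16 * LL + (16 * B + 2) * YY + 32 * B * ZZ := by linarith
    _ ≤ 16 * RR + 16 * LL + (16 * B + 2) * (TT / c) + 32 * B * ZZ +
        ((32 * B + (32 * B + 2) / c) * (RR + LL) + (16 + 32 * B) * TT + 16 * B / c * TT +
      (16 + (32 * B + 2) / c) * ZZ) := by linarith
    _ = _ := by ring

/-- Ellipticity of the `∂̄`-system modulo tangential derivatives. -/
theorem exists_boundary_pointwise (n q : ℕ) (ι : Type*) [Fintype ι] {c : ℝ} (hc : 0 < c) :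
    ∃ C : ℝ, 0 ≤ C ∧ ∀ (t : ℝ) (x g : Cn n), ‖g‖ = 1 → ∀ a : ι → Cn n, (∀ i, inner ℝ g (a i) = 0) →
      (∀ ξ : Cn n, inner ℝ g ξ = 0 → c * ‖ξ‖ ^ 2 ≤ ∑ i, (inner ℝ (a i) ξ) ^ 2) →
      ∀ (X : MultiIdx n q → Fin n × Fin 2 → ℂ) (z : MultiIdx n q → ℂ),
        ∑ J, ∑ l, ‖X J l‖ ^ 2 ≤
          C * (∑ K, ‖raise (fun j J => dzbarOf t x (X J) (z J) j) K‖ ^ 2 +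
            ∑ I, ‖lower (fun j J => wLOf (X J) j) I‖ ^ 2 +
            ∑ i, ∑ J, ‖∑ l, (a i l : ℂ) * X J l‖ ^ 2 + t ^ 2 * ‖x‖ ^ 2 * ∑ J, ‖z J‖ ^ 2) := by
  set B : ℝ := (Fintype.card (MultiIdx n (q + 1)) + Fintype.card (MultiIdx n (q - 1))) *
    Fintype.card (Fin n × MultiIdx n q) with hB
  have hB0 : 0 ≤ B := by positivity
  refine ⟨16 + 32 * B + (32 * B + 2) / c, by positivity, fun t x g hg a ha hspan X z => ?_⟩
  -- `S` is the normal derivative and `Y` the tangential part of the gradient. The symbol of the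
  -- system acts on `S` as a rank one expression with `N_j = z_j(g) / 2`, whose squared length is
  -- 1/4; everything else is bounded by `Y` and `t |x| |z|`.
  set S : MultiIdx n q → ℂ := fun J => ∑ m, (g m : ℂ) * X J m with hS
  set Y : MultiIdx n q → Fin n × Fin 2 → ℂ := fun J l => X J l - (g l : ℂ) * S J with hY
  set N : Fin n → ℂ := fun j => (1 / 2) * zCoord j g with hN
  set e : Fin n → MultiIdx n q → ℂ := fun j J => dzbarOf t x (Y J) (z J) j with he
  set e' : Fin n → MultiIdx n q → ℂ := fun j J => wLOf (Y J) j with he'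
  have h1 : ∀ j J, dzbarOf t x (X J) (z J) j = N j * S J + e j J := fun j J => by
    simp only [he, hN, dzbarOf, hY, zCoord]; ring
  have h2 : ∀ j J, wLOf (X J) j = (starRingEnd ℂ) (N j) * S J + e' j J := fun j J => by
    simp only [he', hN, wLOf, hY, zCoord, map_mul, map_add, Complex.conj_I, Complex.conj_ofReal,
      map_div₀, map_one, map_ofNat]
    ring
  have hN2 : ∑ j, ‖N j‖ ^ 2 = 1 / 4 := by
    have : ∀ j, ‖N j‖ ^ 2 = 1 / 4 * ‖zCoord j g‖ ^ 2 := fun j => by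
      rw [hN, norm_mul, mul_pow]; norm_num
    simp only [this, ← Finset.mul_sum, sum_norm_zCoord_sq, hg]; norm_num
  set RR := ∑ K, ‖raise (fun j J => dzbarOf t x (X J) (z J) j) K‖ ^ 2 with hRR
  set LL := ∑ I, ‖lower (fun j J => wLOf (X J) j) I‖ ^ 2 with hLL
  set TT := ∑ i, ∑ J, ‖∑ l, (a i l : ℂ) * X J l‖ ^ 2 with hTT
  set ZZ := t ^ 2 * ‖x‖ ^ 2 * ∑ J, ‖z J‖ ^ 2 with hZZ
  set YY := ∑ J, ∑ l, ‖Y J l‖ ^ 2 with hYY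
  have hRR0 : 0 ≤ RR := Finset.sum_nonneg fun _ _ => sq_nonneg _
  have hLL0 : 0 ≤ LL := Finset.sum_nonneg fun _ _ => sq_nonneg _
  have hTT0 : 0 ≤ TT := Finset.sum_nonneg fun _ _ => Finset.sum_nonneg fun _ _ => sq_nonneg _
  have hZZ0 : 0 ≤ ZZ := mul_nonneg (by positivity) (Finset.sum_nonneg fun _ _ => sq_nonneg _)
  have hYT : YY ≤ TT / c := by
    rw [le_div_iff₀ hc, mul_comm, hYY, hTT, Finset.mul_sum, Finset.sum_comm]
    exact Finset.sum_le_sum fun J _ => tangential_part_le hg ha hspan (X J)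
  have hE : ∑ p : Fin n × MultiIdx n q, ‖e p.1 p.2‖ ^ 2 ≤ YY + 2 * ZZ := by
    have hp : ∀ j J, ‖e j J‖ ^ 2 ≤ (‖Y J (j, 0)‖ ^ 2 + ‖Y J (j, 1)‖ ^ 2) +
        2 * (t ^ 2 * ‖zCoord j x‖ ^ 2 * ‖z J‖ ^ 2) := by
      intro j J
      have a1 := norm_add_sq_le_two ((1 / 2) * (Y J (j, 0) + Complex.I * Y J (j, 1)))
        (t * zCoord j x * z J)
      have a2 := norm_add_sq_le_two (Y J (j, 0)) (Complex.I * Y J (j, 1))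
      rw [norm_mul Complex.I, Complex.norm_I, one_mul] at a2
      have a3 : ‖(1 / 2) * (Y J (j, 0) + Complex.I * Y J (j, 1))‖ ^ 2 =
          1 / 4 * ‖Y J (j, 0) + Complex.I * Y J (j, 1)‖ ^ 2 := by
        rw [norm_mul, mul_pow]; norm_num
      have a4 : ‖(t * zCoord j x * z J : ℂ)‖ ^ 2 = t ^ 2 * ‖zCoord j x‖ ^ 2 * ‖z J‖ ^ 2 := by
        rw [norm_mul, norm_mul, Complex.norm_real, mul_pow, mul_pow, Real.norm_eq_abs, sq_abs]
      rw [a3, a4] at a1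
      refine a1.trans ?_
      linarith
    refine (Finset.sum_le_sum fun p _ => hp p.1 p.2).trans_eq ?_
    rw [Finset.sum_add_distrib, ← Finset.mul_sum]
    congr 1
    · rw [hYY, Fintype.sum_prod_type, Finset.sum_comm]
      simp only [Fintype.sum_prod_type, Fin.sum_univ_two]
    · rw [hZZ, ← sum_norm_zCoord_sq, Fintype.sum_prod_type, mul_assoc, Finset.sum_mul_sum,
        Finset.mul_sum]
      simp only [Finset.mul_sum, mul_assoc]
  have hE' : ∑ p : Fin n × MultiIdx n q, ‖e' p.1 p.2‖ ^ 2 ≤ YY := by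
    have hp : ∀ j J, ‖e' j J‖ ^ 2 ≤ ‖Y J (j, 0)‖ ^ 2 + ‖Y J (j, 1)‖ ^ 2 := by
      intro j J
      have a2 := norm_sub_sq_le_two (Y J (j, 0)) (Complex.I * Y J (j, 1))
      rw [norm_mul Complex.I, Complex.norm_I, one_mul] at a2
      have a3 : ‖e' j J‖ ^ 2 = 1 / 4 * ‖Y J (j, 0) - Complex.I * Y J (j, 1)‖ ^ 2 := by
        change ‖wLOf (Y J) j‖ ^ 2 = _
        rw [wLOf, norm_mul, mul_pow]; norm_num
      rw [a3]
      nlinarith [sq_nonneg ‖Y J (j, 0)‖, sq_nonneg ‖Y J (j, 1)‖]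
    refine (Finset.sum_le_sum fun p _ => hp p.1 p.2).trans_eq ?_
    rw [hYY, Fintype.sum_prod_type, Finset.sum_comm]
    simp only [Fintype.sum_prod_type, Fin.sum_univ_two]
  set EE := ∑ p : Fin n × MultiIdx n q, ‖e p.1 p.2‖ ^ 2 with hEE
  set EE' := ∑ p : Fin n × MultiIdx n q, ‖e' p.1 p.2‖ ^ 2 with hEE'
  set Q := (Fintype.card (Fin n × MultiIdx n q) : ℝ) with hQ
  have hSS : 1 / 4 * ∑ J, ‖S J‖ ^ 2 ≤ 2 * RR + 2 * LL + 2 * B * (YY + 2 * ZZ) := by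
    rw [← hN2, ← sum_norm_raise_lower_rankOne]
    have b1 : ∀ K, ‖raise (fun j J => N j * S J) K‖ ^ 2 ≤
        2 * ‖raise (fun j J => dzbarOf t x (X J) (z J) j) K‖ ^ 2 + 2 * (Q * EE) := by
      intro K
      have r : raise (fun j J => N j * S J) K =
          raise (fun j J => dzbarOf t x (X J) (z J) j) K - raise e K := by
        simp only [h1, raise_add]; ring
      rw [r]
      refine (norm_sub_sq_le_two _ _).trans ?_
      have := norm_raise_sq_le e K
      linarith
    have b2 : ∀ I, ‖lower (fun j J => (starRingEnd ℂ) (N j) * S J) I‖ ^ 2 ≤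
        2 * ‖lower (fun j J => wLOf (X J) j) I‖ ^ 2 + 2 * (Q * EE') := by
      intro I
      have r : lower (fun j J => (starRingEnd ℂ) (N j) * S J) I =
          lower (fun j J => wLOf (X J) j) I - lower e' I := by
        simp only [h2, lower_add]; ring
      rw [r]
      refine (norm_sub_sq_le_two _ _).trans ?_
      have := norm_lower_sq_le e' I
      linarith
    have c1 := Finset.sum_le_sum fun K (_ : K ∈ Finset.univ) => b1 K
    have c2 := Finset.sum_le_sum fun I (_ : I ∈ Finset.univ) => b2 I
    rw [Finset.sum_add_distrib, ← Finset.mul_sum, Finset.sum_const, Finset.card_univ,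
      nsmul_eq_mul] at c1 c2
    have d1 : Fintype.card (MultiIdx n (q + 1)) * (2 * (Q * EE)) ≤
        Fintype.card (MultiIdx n (q + 1)) * (2 * (Q * (YY + 2 * ZZ))) := by gcongr
    have d2 : Fintype.card (MultiIdx n (q - 1)) * (2 * (Q * EE')) ≤
        Fintype.card (MultiIdx n (q - 1)) * (2 * (Q * (YY + 2 * ZZ))) := by
      gcongr; linarith
    have d3 : 2 * B * (YY + 2 * ZZ) = Fintype.card (MultiIdx n (q + 1)) * (2 * (Q * (YY + 2 * ZZ))) +
        Fintype.card (MultiIdx n (q - 1)) * (2 * (Q * (YY + 2 * ZZ))) := by rw [hB]; ring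
    linarith
  have hX : ∑ J, ∑ l, ‖X J l‖ ^ 2 ≤ 2 * ∑ J, ‖S J‖ ^ 2 + 2 * YY := by
    rw [hYY, Finset.mul_sum, Finset.mul_sum, ← Finset.sum_add_distrib]
    refine Finset.sum_le_sum fun J _ => ?_
    have hg2 : ∑ l, ‖(g l : ℂ) * S J‖ ^ 2 = ‖S J‖ ^ 2 := by
      have := EuclideanSpace.norm_sq_eq g
      rw [hg] at this
      simp only [norm_mul, mul_pow, ← Finset.sum_mul, Complex.norm_real]
      rw [← this]; ring
    rw [← hg2, Finset.mul_sum, Finset.mul_sum, ← Finset.sum_add_distrib]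
    refine Finset.sum_le_sum fun l _ => ?_
    have : X J l = (g l : ℂ) * S J + Y J l := by simp only [hY]; ring
    rw [this]
    exact norm_add_sq_le_two _ _
  exact boundary_arith hc hB0 hRR0 hLL0 hTT0 hZZ0 hYT hSS hX

end Pointwise

/-! ### The Kohn–Morrey–Hörmander identity for compactly supported forms. -/

section InteriorEnergy

variable {n q : ℕ} {Ω : Set (Cn n)} {t : ℝ} {F G : Cn n → ℂ} {DF DG : Fin n × Fin 2 → Cn n → ℂ}

theorem integrable_weighted_mul_conj {P Q : Cn n → ℂ} (hP : MemLp P 2 volume)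
    (hPc : HasCompactSupport P) (hQ : MemLp Q 2 volume) :
    Integrable fun x => wt t x * (P x * (starRingEnd ℂ) (Q x)) := by
  have h := integrable_mul_of_memLp_two (memLp_continuous_mul hP hPc
    (contDiff_wt (t := t)).continuous) hQ.star
  refine h.congr (Eventually.of_forall fun x => ?_)
  simp only [Pi.star_apply, RCLike.star_def]; ring

theorem CompactH1.memLp_weighted (hF : CompactH1 F DF) (l : Fin n × Fin 2) :
    MemLp (fun x => DF l x - 2 * t * (x l : ℂ) * F x) 2 volume :=
  (hF.memLp_deriv l).sub (memLp_continuous_mul hF.memLp hF.compact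
    ((contDiff_coord l).continuous.const_mul (2 * (t : ℂ))))

theorem CompactH1.compact_weighted (hF : CompactH1 F DF) (l : Fin n × Fin 2) :
    HasCompactSupport (fun x => DF l x - 2 * t * (x l : ℂ) * F x) := by
  have h : HasCompactSupport fun x : Cn n => (2 * t * (x l : ℂ)) * F x := hF.compact.mul_left
  exact (hF.compact_deriv l).sub h

theorem dzbarOf_weighted (x : Cn n) (D : Fin n × Fin 2 → ℂ) (z : ℂ) (i : Fin n) :
    dzbarOf t x (fun l => D l - 2 * t * (x l : ℂ) * z) z i =
      (1 / 2) * (D (i, 0) + Complex.I * D (i, 1)) := by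
  simp only [dzbarOf, zCoord]; ring

/-- Expands into products of real derivatives, the form in which `CompactH1.integral_weighted_comm`
applies. -/
theorem wirtinger_mul_conj (w a b c d : ℂ) : w * ((1 / 2) * (a - Complex.I * b) *
      (starRingEnd ℂ) ((1 / 2) * (c - Complex.I * d))) =
    (1 / 4) * (w * (a * (starRingEnd ℂ) c) + w * (b * (starRingEnd ℂ) d)) +
      (Complex.I / 4) * (w * (a * (starRingEnd ℂ) d) - w * (b * (starRingEnd ℂ) c)) := by
  simp only [map_mul, map_sub, Complex.conj_I, map_div₀, map_one, map_ofNat]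
  linear_combination (-w * b * (starRingEnd ℂ) d / 4) * Complex.I_sq

theorem wirtinger_bar_mul_conj (w a b c d : ℂ) : w * ((1 / 2) * (a + Complex.I * b) *
      (starRingEnd ℂ) ((1 / 2) * (c + Complex.I * d))) =
    (1 / 4) * (w * (a * (starRingEnd ℂ) c) + w * (b * (starRingEnd ℂ) d)) +
      (Complex.I / 4) * (w * (b * (starRingEnd ℂ) c) - w * (a * (starRingEnd ℂ) d)) := by
  simp only [map_mul, map_add, Complex.conj_I, map_div₀, map_one, map_ofNat]
  linear_combination (-w * b * (starRingEnd ℂ) d / 4) * Complex.I_sq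

theorem integral_wirtinger_combination {A B C D : Cn n → ℂ} (hA : Integrable A) (hB : Integrable B)
    (hC : Integrable C) (hD : Integrable D) :
    ∫ x, ((1 / 4) * (A x + D x) + (Complex.I / 4) * (B x - C x)) =
      (1 / 4) * ((∫ x, A x) + ∫ x, D x) + (Complex.I / 4) * ((∫ x, B x) - ∫ x, C x) := by
  have h1 : Integrable fun x => (1 / 4 : ℂ) * (A x + D x) := (hA.add hD).const_mul _
  have h2 : Integrable fun x => (Complex.I / 4) * (B x - C x) := (hB.sub hC).const_mul _
  rw [integral_add h1 h2, integral_const_mul, integral_const_mul, integral_add hA hD,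
    integral_sub hB hC]

/-- The commutation identity for `L_k` and `∂̄_j`. -/
theorem CompactH1.integral_wirtinger_comm (hF : CompactH1 F DF) (hG : CompactH1 G DG)
    (j k : Fin n) :
    ∫ x, wt t x * (wLOf (fun l => DF l x - 2 * t * (x l : ℂ) * F x) k *
        (starRingEnd ℂ) (wLOf (fun l => DG l x - 2 * t * (x l : ℂ) * G x) j)) =
      (∫ x, wt t x * (dzbarOf t x (fun l => DF l x - 2 * t * (x l : ℂ) * F x) (F x) j *
        (starRingEnd ℂ) (dzbarOf t x (fun l => DG l x - 2 * t * (x l : ℂ) * G x) (G x) k))) +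
      if j = k then t * ∫ x, wt t x * (F x * (starRingEnd ℂ) (G x)) else 0 := by
  have hX := fun a b => integrable_weighted_mul_conj (t := t) (hF.memLp_weighted (t := t) a)
    (hF.compact_weighted a) (hG.memLp_weighted (t := t) b)
  have hD := fun a b => integrable_weighted_mul_conj (t := t) (hF.memLp_deriv a)
    (hF.compact_deriv a) (hG.memLp_deriv b)
  have hcomm := hF.integral_weighted_comm (t := t) hG
  simp only [dzbarOf_weighted, wLOf, wirtinger_mul_conj, wirtinger_bar_mul_conj]
  refine (integral_wirtinger_combination (hX _ _) (hX _ _) (hX _ _) (hX _ _)).trans ?_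
  rw [integral_wirtinger_combination (hD _ _) (hD _ _) (hD _ _) (hD _ _), hcomm, hcomm, hcomm,
    hcomm]
  generalize ∫ x, wt t x * (F x * (starRingEnd ℂ) (G x)) = Z
  -- On the diagonal the two real commutators `2 t`, weighted by 1/4, add up to `t`; the mixed
  -- products have different real indices and contribute nothing.
  by_cases hjk : j = k
  · subst hjk
    simp only [if_true, Prod.mk.injEq, true_and, zero_ne_one, one_ne_zero, if_false, zero_mul,
      add_zero, Fin.isValue]
    ring
  · have : k ≠ j := Ne.symm hjk
    simp only [hjk, this, Prod.mk.injEq, false_and, if_false, zero_mul, add_zero]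

theorem memLp_wMeasure_of_compact {P : Cn n → ℂ} (hP : MemLp P 2 volume)
    (hPc : HasCompactSupport P) : MemLp P 2 (wMeasure Ω t) := by
  have hm : AEStronglyMeasurable P (wMeasure Ω t) :=
    hP.1.restrict.mono_ac (withDensity_absolutelyContinuous _ _)
  rw [memLp_two_iff_integrable_sq_norm hm, wMeasure,
    integrable_withDensity_iff_integrable_smul' (by fun_prop)
      (Eventually.of_forall fun x => ENNReal.ofReal_lt_top)]
  refine ((integrable_weighted_mul_conj (t := t) hP hPc hP).norm.restrict (s := Ω)).congr
    (Eventually.of_forall fun x => ?_)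
  simp only [ENNReal.toReal_ofReal (Real.exp_pos _).le, norm_mul, RCLike.norm_conj, wt,
    Complex.norm_real, Real.norm_of_nonneg (Real.exp_pos _).le, smul_eq_mul]
  ring

theorem integral_norm_sq_eq {P : Cn n → ℂ} (h0 : ∀ x ∉ Ω, P x = 0) :
    ((∫ x, ‖P x‖ ^ 2 ∂(wMeasure Ω t) : ℝ) : ℂ) = ∫ x, wt t x * (P x * (starRingEnd ℂ) (P x)) := by
  rw [← integral_wMeasure_eq (Ω := Ω) (P := fun x => P x * (starRingEnd ℂ) (P x))
    fun x hx => by simp [h0 x hx], ← integral_complex_ofReal]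
  refine integral_congr_ae (Eventually.of_forall fun x => ?_)
  simp only [Complex.mul_conj, Complex.normSq_eq_norm_sq]

theorem integral_sum_mul_conj {κ : Type*} [Fintype κ] {c : κ → ℂ}
    (hc : ∀ p, (starRingEnd ℂ) (c p) = c p) {u : κ → Cn n → ℂ}
    (hu : ∀ p p', Integrable fun x => wt t x * (u p x * (starRingEnd ℂ) (u p' x))) :
    ∫ x, wt t x * ((∑ p, c p * u p x) * (starRingEnd ℂ) (∑ p, c p * u p x)) =
      ∑ p, ∑ p', c p * c p' * ∫ x, wt t x * (u p x * (starRingEnd ℂ) (u p' x)) := by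
  have e : ∀ x, wt t x * ((∑ p, c p * u p x) * (starRingEnd ℂ) (∑ p, c p * u p x)) =
      ∑ p, ∑ p', c p * c p' * (wt t x * (u p x * (starRingEnd ℂ) (u p' x))) := by
    intro x
    rw [map_sum, Finset.sum_mul_sum, Finset.mul_sum]
    refine Finset.sum_congr rfl fun p _ => ?_
    rw [Finset.mul_sum]
    refine Finset.sum_congr rfl fun p' _ => ?_
    rw [map_mul, hc]; ring
  simp only [e]
  rw [integral_finsetSum _ fun p _ => integrable_finsetSum _ fun p' _ => (hu p p').const_mul _]
  refine Finset.sum_congr rfl fun p _ => ?_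
  rw [integral_finsetSum _ fun p' _ => (hu p p').const_mul _]
  exact Finset.sum_congr rfl fun p' _ => integral_const_mul _ _

theorem sum_swap_fst {α β M : Type*} [Fintype α] [Fintype β] [AddCommMonoid M]
    (f : α → β → α → β → M) :
    ∑ p : α × β, ∑ p' : α × β, f p.1 p.2 p'.1 p'.2 =
      ∑ p : α × β, ∑ p' : α × β, f p'.1 p.2 p.1 p'.2 := by
  simp only [Fintype.sum_prod_type]
  rw [Finset.sum_comm]
  conv_rhs => rw [Finset.sum_comm]
  refine Finset.sum_congr rfl fun J _ => ?_
  rw [Finset.sum_comm]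

theorem sum_integral_sum_mul_conj {κ κ' : Type*} [Fintype κ] [Fintype κ'] {c : κ' → κ → ℂ}
    (hc : ∀ K p, (starRingEnd ℂ) (c K p) = c K p) {u : κ → Cn n → ℂ}
    (hu : ∀ p p', Integrable fun x => wt t x * (u p x * (starRingEnd ℂ) (u p' x))) :
    ∑ K, ∫ x, wt t x * ((∑ p, c K p * u p x) * (starRingEnd ℂ) (∑ p, c K p * u p x)) =
      ∑ p, ∑ p', (∑ K, c K p * c K p') * ∫ x, wt t x * (u p x * (starRingEnd ℂ) (u p' x)) := by
  rw [Finset.sum_congr rfl fun K _ => integral_sum_mul_conj (hc K) hu, Finset.sum_comm]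
  refine Finset.sum_congr rfl fun p _ => ?_
  rw [Finset.sum_comm]
  exact Finset.sum_congr rfl fun p' _ => (Finset.sum_mul _ _ _).symm

/-- `W` and `M` stand for `‖∂̄_j F_J‖²` and `‖L_j F_J‖²`. Bounding `∑ M` by `∑ W` costs one multiple
of `|t| ∑ Z`, and bounding `2 ∑ W` by `2 A` costs two more. Absolute values are used because `t` may
have either sign. -/
theorem real_energy_bound {α β : Type*} [Fintype α] [Fintype β] [DecidableEq α]
    {s : β → Finset α} {A : ℝ} {W M : α × β → ℝ} {Z : β → ℝ} (hZ : ∀ J, 0 ≤ Z J)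
    (hWM : ∀ p, M p = W p + t * Z p.2)
    (hA : A = (∑ p, W p) + ∑ p : α × β, if p.1 ∈ s p.2 then t * Z p.2 else 0) :
    ∑ p, (W p + M p) ≤ 2 * A + 3 * Fintype.card α * |t| * ∑ J, Z J := by
  have e6 : -(Fintype.card α * |t| * ∑ J, Z J) ≤
      ∑ p : α × β, if p.1 ∈ s p.2 then t * Z p.2 else 0 := by
    have : -(Fintype.card α * |t| * ∑ J, Z J) = ∑ p : α × β, -(|t| * Z p.2) := by
      rw [Fintype.sum_prod_type]
      simp only [Finset.sum_const, Finset.card_univ, nsmul_eq_mul,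
        Finset.sum_neg_distrib, ← Finset.mul_sum, mul_neg]
      ring
    rw [this]
    refine Finset.sum_le_sum fun p _ => ?_
    have h1 := mul_le_mul_of_nonneg_right (neg_abs_le t) (hZ p.2)
    have h2 := mul_nonneg (abs_nonneg t) (hZ p.2)
    split_ifs <;> linarith
  have e7 : ∑ p, M p ≤ (∑ p, W p) + Fintype.card α * |t| * ∑ J, Z J := by
    simp only [hWM, Finset.sum_add_distrib]
    gcongr
    rw [Fintype.sum_prod_type]
    simp only [Finset.sum_const, Finset.card_univ, nsmul_eq_mul, ← Finset.mul_sum, mul_assoc]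
    refine mul_le_mul_of_nonneg_left ?_ (Nat.cast_nonneg _)
    exact mul_le_mul_of_nonneg_right (le_abs_self t) (Finset.sum_nonneg fun J _ => hZ J)
  rw [Finset.sum_add_distrib]
  linarith

theorem normSqL2_bound_of_integral {α β κ₁ κ₂ : Type*} [Fintype α] [Fintype β] [Fintype κ₁]
    [Fintype κ₂] {w m : α → Cn n → ℂ} {F : β → Cn n → ℂ} {ww : κ₁ → Cn n → ℂ}
    {mm : κ₂ → Cn n → ℂ} (hw : ∀ p, MemLp (w p) 2 (wMeasure Ω t))
    (hm : ∀ p, MemLp (m p) 2 (wMeasure Ω t)) (hF : ∀ p, MemLp (F p) 2 (wMeasure Ω t))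
    (hww : ∀ p, MemLp (ww p) 2 (wMeasure Ω t)) (hmm : ∀ p, MemLp (mm p) 2 (wMeasure Ω t))
    {a : ℝ} (ha : 0 ≤ a)
    (hfin : ∑ p, ((∫ x, ‖w p x‖ ^ 2 ∂(wMeasure Ω t)) + ∫ x, ‖m p x‖ ^ 2 ∂(wMeasure Ω t)) ≤
      2 * ((∑ K, ∫ x, ‖ww K x‖ ^ 2 ∂(wMeasure Ω t)) + ∑ I, ∫ x, ‖mm I x‖ ^ 2 ∂(wMeasure Ω t)) +
        a * ∑ J, ∫ x, ‖F J x‖ ^ 2 ∂(wMeasure Ω t)) :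
    ∑ p, (normSqL2 Ω t (w p) + normSqL2 Ω t (m p)) ≤
      2 * (∑ K, normSqL2 Ω t (ww K) + ∑ I, normSqL2 Ω t (mm I)) +
        ENNReal.ofReal a * ∑ J, normSqL2 Ω t (F J) := by
  have nn : ∀ P : Cn n → ℂ, 0 ≤ ∫ x, ‖P x‖ ^ 2 ∂(wMeasure Ω t) := fun P =>
    integral_nonneg fun x => sq_nonneg _
  have hfin' := ENNReal.ofReal_le_ofReal hfin
  rw [ENNReal.ofReal_sum_of_nonneg fun p _ => add_nonneg (nn _) (nn _),
    ENNReal.ofReal_add (mul_nonneg zero_le_two (add_nonneg (Finset.sum_nonneg fun _ _ => nn _)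
      (Finset.sum_nonneg fun _ _ => nn _))) (mul_nonneg ha
        (Finset.sum_nonneg fun _ _ => nn _)), ENNReal.ofReal_mul zero_le_two,
    ENNReal.ofReal_mul ha, ENNReal.ofReal_add (Finset.sum_nonneg fun _ _ => nn _)
      (Finset.sum_nonneg fun _ _ => nn _), ENNReal.ofReal_sum_of_nonneg fun _ _ => nn _,
    ENNReal.ofReal_sum_of_nonneg fun _ _ => nn _, ENNReal.ofReal_sum_of_nonneg fun _ _ => nn _]
    at hfin'
  simp only [ENNReal.ofReal_add (nn _) (nn _), ofReal_integral_norm_sq (hF _),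
    ofReal_integral_norm_sq (hww _), ofReal_integral_norm_sq (hmm _),
    ofReal_integral_norm_sq (hw _), ofReal_integral_norm_sq (hm _), ENNReal.ofReal_ofNat] at hfin'
  exact hfin'

/-- The integrated form of the anticommutation relations, for families of coefficients whose
first derivatives satisfy the commutation relations. -/
theorem energy_identity_of_comm {F : MultiIdx n q → Cn n → ℂ}
    {w m : Fin n → MultiIdx n q → Cn n → ℂ}
    (hF0 : ∀ J, ∀ x ∉ Ω, F J x = 0) (hw0 : ∀ j J, ∀ x ∉ Ω, w j J x = 0)
    (hm0 : ∀ j J, ∀ x ∉ Ω, m j J x = 0)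
    (hwi : ∀ p p' : Fin n × MultiIdx n q,
      Integrable fun x => wt t x * (w p.1 p.2 x * (starRingEnd ℂ) (w p'.1 p'.2 x)))
    (hmi : ∀ p p' : Fin n × MultiIdx n q,
      Integrable fun x => wt t x * (m p.1 p.2 x * (starRingEnd ℂ) (m p'.1 p'.2 x)))
    (hcomm : ∀ (j k : Fin n) (J J' : MultiIdx n q),
      ∫ x, wt t x * (m k J x * (starRingEnd ℂ) (m j J' x)) =
        (∫ x, wt t x * (w j J x * (starRingEnd ℂ) (w k J' x))) +
          if j = k then t * ∫ x, wt t x * (F J x * (starRingEnd ℂ) (F J' x)) else 0) :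
    (∑ K, ∫ x, ‖raise (fun j J => w j J x) K‖ ^ 2 ∂(wMeasure Ω t)) +
        ∑ I, ∫ x, ‖lower (fun j J => m j J x) I‖ ^ 2 ∂(wMeasure Ω t) =
      (∑ p : Fin n × MultiIdx n q, ∫ x, ‖w p.1 p.2 x‖ ^ 2 ∂(wMeasure Ω t)) +
        ∑ p : Fin n × MultiIdx n q,
          if p.1 ∈ p.2.1 then t * ∫ x, ‖F p.2 x‖ ^ 2 ∂(wMeasure Ω t) else 0 := by
  have e1 : ((∑ K, ∫ x, ‖raise (fun j J => w j J x) K‖ ^ 2 ∂(wMeasure Ω t) : ℝ) : ℂ) =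
      ∑ p : Fin n × MultiIdx n q, ∑ p' : Fin n × MultiIdx n q,
        (∑ K : MultiIdx n (q + 1), eps p.1 p.2.1 K.1 * eps p'.1 p'.2.1 K.1) *
          ∫ x, wt t x * (w p.1 p.2 x * (starRingEnd ℂ) (w p'.1 p'.2 x)) := by
    rw [Complex.ofReal_sum, ← sum_integral_sum_mul_conj
      (c := fun (K : MultiIdx n (q + 1)) (p : Fin n × MultiIdx n q) => eps p.1 p.2.1 K.1)
      (u := fun p x => w p.1 p.2 x) (fun K p => conj_eps _ _ _) hwi]
    refine Finset.sum_congr rfl fun K _ => ?_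
    exact integral_norm_sq_eq (P := fun x => raise (fun j J => w j J x) K)
      fun x hx => by simp [raise, hw0 _ _ x hx]
  have e2 : ((∑ I, ∫ x, ‖lower (fun j J => m j J x) I‖ ^ 2 ∂(wMeasure Ω t) : ℝ) : ℂ) =
      ∑ p : Fin n × MultiIdx n q, ∑ p' : Fin n × MultiIdx n q,
        (∑ I : MultiIdx n (q - 1), eps p'.1 I.1 p.2.1 * eps p.1 I.1 p'.2.1) *
          ∫ x, wt t x * (m p'.1 p.2 x * (starRingEnd ℂ) (m p.1 p'.2 x)) := by
    rw [Complex.ofReal_sum, ← sum_swap_fst fun j J k J' =>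
      (∑ I : MultiIdx n (q - 1), eps j I.1 J.1 * eps k I.1 J'.1) *
          ∫ x, wt t x * (m j J x * (starRingEnd ℂ) (m k J' x)), ← sum_integral_sum_mul_conj
      (c := fun (I : MultiIdx n (q - 1)) (p : Fin n × MultiIdx n q) => eps p.1 I.1 p.2.1)
      (u := fun p x => m p.1 p.2 x) (fun K p => conj_eps _ _ _) hmi]
    refine Finset.sum_congr rfl fun I _ => ?_
    exact integral_norm_sq_eq (P := fun x => lower (fun j J => m j J x) I)
      fun x hx => by simp [lower, hm0 _ _ x hx]
  have e3 := sum_anticomm (n := n) (q := q)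
    (W := fun p p' => ∫ x, wt t x * (w p.1 p.2 x * (starRingEnd ℂ) (w p'.1 p'.2 x)))
    (V := fun p p' => ∫ x, wt t x * (m p'.1 p.2 x * (starRingEnd ℂ) (m p.1 p'.2 x)))
    (Z := fun J J' => t * ∫ x, wt t x * (F J x * (starRingEnd ℂ) (F J' x)))
    fun p p' => hcomm p.1 p'.1 p.2 p'.2
  rw [← e1, ← e2] at e3
  simp only [← integral_norm_sq_eq (hw0 _ _), ← integral_norm_sq_eq (hF0 _)] at e3
  rw [← Complex.ofReal_inj, Complex.ofReal_add, e3, Complex.ofReal_add, Complex.ofReal_sum,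
    Complex.ofReal_sum]
  congr 1
  refine Finset.sum_congr rfl fun p _ => ?_
  split_ifs <;> simp

theorem CompactH1.memLp_dzbarOf (hF : CompactH1 F DF) (j : Fin n) :
    MemLp (fun x => dzbarOf t x (fun l => DF l x - 2 * t * (x l : ℂ) * F x) (F x) j) 2 volume ∧
      HasCompactSupport
        (fun x => dzbarOf t x (fun l => DF l x - 2 * t * (x l : ℂ) * F x) (F x) j) := by
  have e : (fun x => dzbarOf t x (fun l => DF l x - 2 * t * (x l : ℂ) * F x) (F x) j) =
      fun x => (1 / 2) * (DF (j, 0) x + Complex.I * DF (j, 1) x) := by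
    ext x; exact dzbarOf_weighted x (fun l => DF l x) _ _
  rw [e]
  refine ⟨((hF.memLp_deriv _).add ((hF.memLp_deriv _).const_mul _)).const_mul _, ?_⟩
  have h1 : HasCompactSupport fun x => Complex.I * DF (j, 1) x := (hF.compact_deriv _).mul_left
  have h2 : HasCompactSupport fun x => DF (j, 0) x + Complex.I * DF (j, 1) x :=
    (hF.compact_deriv _).add h1
  exact h2.mul_left

theorem CompactH1.memLp_wLOf (hF : CompactH1 F DF) (j : Fin n) :
    MemLp (fun x => wLOf (fun l => DF l x - 2 * t * (x l : ℂ) * F x) j) 2 volume ∧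
      HasCompactSupport (fun x => wLOf (fun l => DF l x - 2 * t * (x l : ℂ) * F x) j) := by
  refine ⟨((hF.memLp_weighted (t := t) _).sub
    ((hF.memLp_weighted (t := t) _).const_mul _)).const_mul _, ?_⟩
  have h1 : HasCompactSupport fun x => Complex.I *
      (DF (j, 1) x - 2 * t * (x (j, 1) : ℂ) * F x) := (hF.compact_weighted _).mul_left
  have h2 : HasCompactSupport fun x => (DF (j, 0) x - 2 * t * (x (j, 0) : ℂ) * F x) - Complex.I *
      (DF (j, 1) x - 2 * t * (x (j, 1) : ℂ) * F x) := (hF.compact_weighted (t := t) (j, 0)).sub h1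
  exact h2.mul_left

/-- The Kohn–Morrey–Hörmander formula for compactly supported forms. -/
theorem kohn_morrey {F : MultiIdx n q → Cn n → ℂ} {DF : MultiIdx n q → Fin n × Fin 2 → Cn n → ℂ}
    (h : ∀ J, CompactH1 (F J) (DF J)) (hF0 : ∀ J, ∀ x ∉ Ω, F J x = 0)
    (hD0 : ∀ J l, ∀ x ∉ Ω, DF J l x = 0) {w m : Fin n → MultiIdx n q → Cn n → ℂ}
    (hw : w = fun j J x => dzbarOf t x (fun l => DF J l x - 2 * t * (x l : ℂ) * F J x) (F J x) j)
    (hm : m = fun j J x => wLOf (fun l => DF J l x - 2 * t * (x l : ℂ) * F J x) j) :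
    ∑ p : Fin n × MultiIdx n q, (normSqL2 Ω t (w p.1 p.2) + normSqL2 Ω t (m p.1 p.2)) ≤
      2 * (∑ K, normSqL2 Ω t (fun x => raise (fun j J => w j J x) K) +
        ∑ I, normSqL2 Ω t (fun x => lower (fun j J => m j J x) I)) +
      ENNReal.ofReal (3 * n * |t|) * ∑ J, normSqL2 Ω t (F J) := by
  have hwL : ∀ j J, MemLp (w j J) 2 volume ∧ HasCompactSupport (w j J) := fun j J => by
    rw [hw]; exact (h J).memLp_dzbarOf j
  have hmL : ∀ j J, MemLp (m j J) 2 volume ∧ HasCompactSupport (m j J) := fun j J => by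
    rw [hm]; exact (h J).memLp_wLOf j
  have hw0 : ∀ j J, ∀ x ∉ Ω, w j J x = 0 := fun j J x hx => by
    rw [hw]; simp [dzbarOf, hF0 J x hx, hD0 J _ x hx]
  have hm0 : ∀ j J, ∀ x ∉ Ω, m j J x = 0 := fun j J x hx => by
    rw [hm]; simp [wLOf, hF0 J x hx, hD0 J _ x hx]
  have hμ : ∀ {P : Cn n → ℂ}, MemLp P 2 volume ∧ HasCompactSupport P → MemLp P 2 (wMeasure Ω t) :=
    fun hP => memLp_wMeasure_of_compact hP.1 hP.2
  have hcomm : ∀ (j k : Fin n) (J J' : MultiIdx n q),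
      ∫ x, wt t x * (m k J x * (starRingEnd ℂ) (m j J' x)) =
        (∫ x, wt t x * (w j J x * (starRingEnd ℂ) (w k J' x))) +
          if j = k then t * ∫ x, wt t x * (F J x * (starRingEnd ℂ) (F J' x)) else 0 := by
    intro j k J J'
    rw [hm, hw]
    exact (h J).integral_wirtinger_comm (h J') j k
  clear hw hm
  -- The diagonal case of the commutation identity: `‖L_j F_J‖² = ‖∂̄_j F_J‖² + t ‖F_J‖²`.
  have e4 : ∀ p : Fin n × MultiIdx n q, ∫ x, ‖m p.1 p.2 x‖ ^ 2 ∂(wMeasure Ω t) =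
      (∫ x, ‖w p.1 p.2 x‖ ^ 2 ∂(wMeasure Ω t)) + t * ∫ x, ‖F p.2 x‖ ^ 2 ∂(wMeasure Ω t) := by
    intro p
    have := hcomm p.1 p.1 p.2 p.2
    rw [← integral_norm_sq_eq (hw0 _ _), ← integral_norm_sq_eq (hm0 _ _),
      ← integral_norm_sq_eq (hF0 _), if_pos rfl] at this
    exact_mod_cast this
  have hwwL : ∀ K, MemLp (fun x => raise (fun j J => w j J x) K) 2 (wMeasure Ω t) := fun K => by
    unfold raise
    exact memLp_finsetSum _ fun p _ => (hμ (hwL p.1 p.2)).const_mul _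
  have hmmL : ∀ K, MemLp (fun x => lower (fun j J => m j J x) K) 2 (wMeasure Ω t) := fun K => by
    unfold lower
    exact memLp_finsetSum _ fun p _ => (hμ (hmL p.1 p.2)).const_mul _
  have h5 := energy_identity_of_comm hF0 hw0 hm0
    (fun p p' => integrable_weighted_mul_conj (hwL p.1 p.2).1 (hwL p.1 p.2).2 (hwL p'.1 p'.2).1)
    (fun p p' => integrable_weighted_mul_conj (hmL p.1 p.2).1 (hmL p.1 p.2).2 (hmL p'.1 p'.2).1)
    hcomm
  have h6 := real_energy_bound (t := t) (s := fun J : MultiIdx n q => J.1)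
    (W := fun p => ∫ x, ‖w p.1 p.2 x‖ ^ 2 ∂(wMeasure Ω t))
    (M := fun p => ∫ x, ‖m p.1 p.2 x‖ ^ 2 ∂(wMeasure Ω t))
    (Z := fun J => ∫ x, ‖F J x‖ ^ 2 ∂(wMeasure Ω t))
    (fun J => integral_nonneg fun x => sq_nonneg ‖F J x‖) e4 h5
  rw [Fintype.card_fin] at h6
  exact normSqL2_bound_of_integral (w := fun p : Fin n × MultiIdx n q => w p.1 p.2)
    (m := fun p : Fin n × MultiIdx n q => m p.1 p.2) (fun p => hμ (hwL p.1 p.2))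
    (fun p => hμ (hmL p.1 p.2)) (fun J => hμ ⟨(h J).memLp, (h J).compact⟩) hwwL hmmL
    (by positivity) h6

end InteriorEnergy

/-! ### Integrating pointwise bounds. -/

section PointwiseToIntegral

variable {n : ℕ} {Ω : Set (Cn n)} {t : ℝ} {α β γ κ : Type*} [Fintype α] [Fintype β] [Fintype γ]
  [Fintype κ]

theorem normSqL2_eq_lintegral_ofReal (f : Cn n → ℂ) :
    normSqL2 Ω t f = ∫⁻ x, ENNReal.ofReal (‖f x‖ ^ 2) ∂(wMeasure Ω t) :=
  lintegral_congr fun x => by rw [ENNReal.ofReal_pow (norm_nonneg _), ofReal_norm]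

theorem lintegral_ofReal_sum_norm_sq {P : α → Cn n → ℂ}
    (hP : ∀ i, AEStronglyMeasurable (P i) (wMeasure Ω t)) :
    ∫⁻ x, ENNReal.ofReal (∑ i, ‖P i x‖ ^ 2) ∂(wMeasure Ω t) = ∑ i, normSqL2 Ω t (P i) := by
  simp only [normSqL2_eq_lintegral_ofReal]
  rw [← lintegral_finsetSum' _ fun i _ => ((hP i).norm.aemeasurable.pow_const 2).ennreal_ofReal]
  exact lintegral_congr fun x => ENNReal.ofReal_sum_of_nonneg fun i _ => sq_nonneg _

theorem aemeasurable_ofReal_sum_norm_sq {P : α → Cn n → ℂ}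
    (hP : ∀ i, AEStronglyMeasurable (P i) (wMeasure Ω t)) :
    AEMeasurable (fun x => ENNReal.ofReal (∑ i, ‖P i x‖ ^ 2)) (wMeasure Ω t) :=
  (Finset.aemeasurable_fun_sum _ fun i _ =>
    (hP i).norm.aemeasurable.pow_const 2).ennreal_ofReal

theorem sum_norm_sq_nonneg (P : α → Cn n → ℂ) (x : Cn n) : 0 ≤ ∑ i, ‖P i x‖ ^ 2 :=
  Finset.sum_nonneg fun _ _ => sq_nonneg _

/-- Integration of a pointwise bound by three families of squares. -/
theorem lintegral_ofReal_le_of_pointwise {g : Cn n → ℝ} {P : α → Cn n → ℂ} {Q : β → Cn n → ℂ}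
    {R : γ → Cn n → ℂ} {a b c : ℝ} (ha : 0 ≤ a) (hb : 0 ≤ b) (hc : 0 ≤ c)
    (hP : ∀ i, AEStronglyMeasurable (P i) (wMeasure Ω t))
    (hQ : ∀ i, AEStronglyMeasurable (Q i) (wMeasure Ω t))
    (hR : ∀ i, AEStronglyMeasurable (R i) (wMeasure Ω t))
    (h : ∀ᵐ x ∂(wMeasure Ω t), g x ≤ a * ∑ i, ‖P i x‖ ^ 2 + b * ∑ i, ‖Q i x‖ ^ 2 +
      c * ∑ i, ‖R i x‖ ^ 2) :
    ∫⁻ x, ENNReal.ofReal (g x) ∂(wMeasure Ω t) ≤ ENNReal.ofReal a * ∑ i, normSqL2 Ω t (P i) +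
      ENNReal.ofReal b * ∑ i, normSqL2 Ω t (Q i) + ENNReal.ofReal c * ∑ i, normSqL2 Ω t (R i) := by
  rw [← lintegral_ofReal_sum_norm_sq hP, ← lintegral_ofReal_sum_norm_sq hQ,
    ← lintegral_ofReal_sum_norm_sq hR, ← lintegral_const_mul'' _ (aemeasurable_ofReal_sum_norm_sq hP),
    ← lintegral_const_mul'' _ (aemeasurable_ofReal_sum_norm_sq hQ), ← lintegral_const_mul'' _ (aemeasurable_ofReal_sum_norm_sq hR),
    ← lintegral_add_left' ((aemeasurable_ofReal_sum_norm_sq hP).const_mul _),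
    ← lintegral_add_right' _ ((aemeasurable_ofReal_sum_norm_sq hR).const_mul _)]
  refine lintegral_mono_ae ?_
  filter_upwards [h] with x hx
  refine (ENNReal.ofReal_le_ofReal hx).trans_eq ?_
  rw [ENNReal.ofReal_add (add_nonneg (mul_nonneg ha (sum_norm_sq_nonneg _ _)) (mul_nonneg hb (sum_norm_sq_nonneg _ _)))
    (mul_nonneg hc (sum_norm_sq_nonneg _ _)), ENNReal.ofReal_add (mul_nonneg ha (sum_norm_sq_nonneg _ _)) (mul_nonneg hb (sum_norm_sq_nonneg _ _)),
    ENNReal.ofReal_mul ha, ENNReal.ofReal_mul hb, ENNReal.ofReal_mul hc]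

end PointwiseToIntegral

/-! ### Algebra of localization: errors are of order zero. -/

section CutoffAlgebra

variable {n q : ℕ} {ι : Type*} [Fintype ι] {t A M : ℝ} {x : Cn n}

theorem dzbarOf_cutoff (θ : ℂ) (τ V : Fin n × Fin 2 → ℂ) (z : ℂ) (j : Fin n) :
    dzbarOf t x (fun l => θ * V l + τ l * z) (θ * z) j =
      θ * dzbarOf t x V z j + (1 / 2) * (τ (j, 0) + Complex.I * τ (j, 1)) * z := by
  simp only [dzbarOf]; ring

theorem wLOf_cutoff (θ : ℂ) (τ V : Fin n × Fin 2 → ℂ) (z : ℂ) (j : Fin n) :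
    wLOf (fun l => θ * V l + τ l * z) j =
      θ * wLOf V j + (1 / 2) * (τ (j, 0) - Complex.I * τ (j, 1)) * z := by
  simp only [wLOf]; ring

theorem norm_half_add_I_mul_le {a b : ℂ} (ha : ‖a‖ ≤ A) (hb : ‖b‖ ≤ A) :
    ‖(1 / 2) * (a + Complex.I * b)‖ ≤ A ∧ ‖(1 / 2) * (a - Complex.I * b)‖ ≤ A := by
  have h1 := norm_add_le a (Complex.I * b)
  have h2 := norm_sub_le a (Complex.I * b)
  rw [norm_mul Complex.I, Complex.norm_I, one_mul] at h1 h2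
  constructor <;> (rw [norm_mul]; norm_num; linarith)

theorem norm_mul_sq_le {a z : ℂ} (ha : ‖a‖ ≤ A) : ‖a * z‖ ^ 2 ≤ A ^ 2 * ‖z‖ ^ 2 := by
  rw [norm_mul, mul_pow]
  gcongr

/-- Cutting off adds only the derivative of the cut-off times `z`, so the error is a multiple of `∑
‖z J‖²`. -/
theorem sum_norm_raise_cutoff_le {θ : ℂ} (hθ : ‖θ‖ ≤ 1) {e : Fin n → ℂ} (he : ∀ j, ‖e j‖ ≤ A)
    (w : Fin n → MultiIdx n q → ℂ) (z : MultiIdx n q → ℂ) :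
    ∑ K, ‖raise (fun j J => θ * w j J + e j * z J) K‖ ^ 2 ≤ 2 * ∑ K, ‖raise w K‖ ^ 2 +
      (Fintype.card (MultiIdx n (q + 1)) * (2 * (Fintype.card (Fin n × MultiIdx n q) *
        (n * A ^ 2)))) * ∑ J, ‖z J‖ ^ 2 := by
  have hK : ∀ K, ‖raise (fun j J => θ * w j J + e j * z J) K‖ ^ 2 ≤ 2 * ‖raise w K‖ ^ 2 +
      2 * (Fintype.card (Fin n × MultiIdx n q) * (n * A ^ 2)) * ∑ J, ‖z J‖ ^ 2 := by
    intro K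
    rw [raise_add]
    refine (norm_add_sq_le_two _ _).trans ?_
    have h1 : raise (fun j J => θ * w j J) K = θ * raise w K := by
      simp only [raise, Finset.mul_sum]
      exact Finset.sum_congr rfl fun p _ => by ring
    have h2 := norm_mul_sq_le (z := raise w K) hθ
    have h3 := norm_raise_sq_le (fun j J => e j * z J) K
    have h4 : ∑ p : Fin n × MultiIdx n q, ‖e p.1 * z p.2‖ ^ 2 ≤ n * A ^ 2 * ∑ J, ‖z J‖ ^ 2 := by
      refine (Finset.sum_le_sum fun p _ => norm_mul_sq_le (he p.1)).trans_eq ?_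
      rw [Fintype.sum_prod_type]
      simp [← Finset.mul_sum, mul_assoc]
    have h5 := h3.trans (mul_le_mul_of_nonneg_left h4 (Nat.cast_nonneg _))
    rw [h1]
    linarith
  refine (Finset.sum_le_sum fun K _ => hK K).trans_eq ?_
  rw [Finset.sum_add_distrib, ← Finset.mul_sum, Finset.sum_const, Finset.card_univ, nsmul_eq_mul]
  ring

theorem sum_norm_lower_cutoff_le {θ : ℂ} (hθ : ‖θ‖ ≤ 1) {e : Fin n → ℂ} (he : ∀ j, ‖e j‖ ≤ A)
    (w : Fin n → MultiIdx n q → ℂ) (z : MultiIdx n q → ℂ) :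
    ∑ I, ‖lower (fun j J => θ * w j J + e j * z J) I‖ ^ 2 ≤ 2 * ∑ I, ‖lower w I‖ ^ 2 +
      (Fintype.card (MultiIdx n (q - 1)) * (2 * (Fintype.card (Fin n × MultiIdx n q) *
        (n * A ^ 2)))) * ∑ J, ‖z J‖ ^ 2 := by
  have hK : ∀ I, ‖lower (fun j J => θ * w j J + e j * z J) I‖ ^ 2 ≤ 2 * ‖lower w I‖ ^ 2 +
      2 * (Fintype.card (Fin n × MultiIdx n q) * (n * A ^ 2)) * ∑ J, ‖z J‖ ^ 2 := by
    intro I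
    rw [lower_add]
    refine (norm_add_sq_le_two _ _).trans ?_
    have h1 : lower (fun j J => θ * w j J) I = θ * lower w I := by
      simp only [lower, Finset.mul_sum]
      exact Finset.sum_congr rfl fun p _ => by ring
    have h2 := norm_mul_sq_le (z := lower w I) hθ
    have h3 := norm_lower_sq_le (fun j J => e j * z J) I
    have h4 : ∑ p : Fin n × MultiIdx n q, ‖e p.1 * z p.2‖ ^ 2 ≤ n * A ^ 2 * ∑ J, ‖z J‖ ^ 2 := by
      refine (Finset.sum_le_sum fun p _ => norm_mul_sq_le (he p.1)).trans_eq ?_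
      rw [Fintype.sum_prod_type]
      simp [← Finset.mul_sum, mul_assoc]
    have h5 := h3.trans (mul_le_mul_of_nonneg_left h4 (Nat.cast_nonneg _))
    rw [h1]
    linarith
  refine (Finset.sum_le_sum fun K _ => hK K).trans_eq ?_
  rw [Finset.sum_add_distrib, ← Finset.mul_sum, Finset.sum_const, Finset.card_univ, nsmul_eq_mul]
  ring

/-- Solves the Leibniz rule for `θ V`. -/
theorem cutoff_sq_norm_sq_le {θ : ℂ} {τ V : ℂ} {z : ℂ} (hτ : ‖τ‖ ≤ A) :
    ‖θ‖ ^ 2 * ‖V‖ ^ 2 ≤ 2 * ‖θ * V + τ * z‖ ^ 2 + 2 * A ^ 2 * ‖z‖ ^ 2 := by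
  have h := norm_sub_sq_le_two (θ * V + τ * z) (τ * z)
  rw [add_sub_cancel_right, norm_mul θ, mul_pow] at h
  have := norm_mul_sq_le (z := z) hτ
  linarith

theorem norm_field_cutoff_sq_le {θ : ℂ} (hθ : ‖θ‖ ≤ 1) {a : Cn n} {τ V : Fin n × Fin 2 → ℂ} {z : ℂ}
    (hτ : ‖∑ l, (a l : ℂ) * τ l‖ ≤ A) :
    ‖∑ l, (a l : ℂ) * (θ * V l + τ l * z)‖ ^ 2 ≤
      2 * ‖∑ l, (a l : ℂ) * V l‖ ^ 2 + 2 * A ^ 2 * ‖z‖ ^ 2 := by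
  have e : ∑ l, (a l : ℂ) * (θ * V l + τ l * z) =
      θ * (∑ l, (a l : ℂ) * V l) + (∑ l, (a l : ℂ) * τ l) * z := by
    rw [Finset.mul_sum, Finset.sum_mul, ← Finset.sum_add_distrib]
    exact Finset.sum_congr rfl fun l _ => by ring
  rw [e]
  have h1 := norm_add_sq_le_two (θ * ∑ l, (a l : ℂ) * V l) ((∑ l, (a l : ℂ) * τ l) * z)
  have h2 := norm_mul_sq_le (z := z) hτ
  have h3 := norm_mul_sq_le (z := ∑ l, (a l : ℂ) * V l) hθ
  linarith

/-- The pointwise part of the interior estimate after localization. -/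
theorem interior_cutoff_pointwise {C : ℝ} (hC : 0 ≤ C) {a : ι → Cn n}
    (h : ∀ (X : Fin n × Fin 2 → ℂ) (z : ℂ), ∑ l, ‖X l‖ ^ 2 ≤
        C * (∑ j, (‖dzbarOf t x X z j‖ ^ 2 + ‖wLOf X j‖ ^ 2) +
          ∑ i, ‖∑ l, (a i l : ℂ) * X l‖ ^ 2))
    {θ : ℂ} (hθ : ‖θ‖ ≤ 1) {τ : Fin n × Fin 2 → ℂ} (hτ : ∀ l, ‖τ l‖ ≤ A)
    (hτa : ∀ i, ‖∑ l, (a i l : ℂ) * τ l‖ ≤ M) (V : Fin n × Fin 2 → ℂ) (z : ℂ) :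
    ‖θ‖ ^ 2 * ∑ l, ‖V l‖ ^ 2 ≤
      2 * C * (∑ j, (‖dzbarOf t x (fun l => θ * V l + τ l * z) (θ * z) j‖ ^ 2 +
        ‖wLOf (fun l => θ * V l + τ l * z) j‖ ^ 2)) +
      4 * C * ∑ i, ‖∑ l, (a i l : ℂ) * V l‖ ^ 2 +
      (4 * C * (Fintype.card ι * M ^ 2) + 4 * n * A ^ 2) * ‖z‖ ^ 2 := by
  have h1 := h (fun l => θ * V l + τ l * z) (θ * z)
  have h2 : ‖θ‖ ^ 2 * ∑ l, ‖V l‖ ^ 2 ≤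
      2 * ∑ l, ‖θ * V l + τ l * z‖ ^ 2 + 4 * n * A ^ 2 * ‖z‖ ^ 2 := by
    rw [Finset.mul_sum]
    refine (Finset.sum_le_sum fun l _ => cutoff_sq_norm_sq_le (z := z) (hτ l)).trans_eq ?_
    rw [Finset.sum_add_distrib, ← Finset.mul_sum, Finset.sum_const, Finset.card_univ,
      Fintype.card_prod, Fintype.card_fin, Fintype.card_fin, nsmul_eq_mul]
    push_cast; ring
  have h3 : ∑ i, ‖∑ l, (a i l : ℂ) * (θ * V l + τ l * z)‖ ^ 2 ≤
      2 * ∑ i, ‖∑ l, (a i l : ℂ) * V l‖ ^ 2 + Fintype.card ι * (2 * M ^ 2 * ‖z‖ ^ 2) := by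
    refine (Finset.sum_le_sum fun i _ => norm_field_cutoff_sq_le hθ (V := V) (z := z)
      (hτa i)).trans_eq ?_
    rw [Finset.sum_add_distrib, ← Finset.mul_sum, Finset.sum_const, Finset.card_univ, nsmul_eq_mul]
  have h4 := mul_le_mul_of_nonneg_left h3 hC
  rw [mul_add] at h1
  linarith

end CutoffAlgebra

/-! ### The first order estimate in the interior. -/

section InteriorEstimate

variable {n q : ℕ} {Ω U : Set (Cn n)} {t : ℝ} {ι : Type*} [Fintype ι] {T : ι → Cn n → Cn n}

/-- `∂̄_j v_J`, in terms of the weighted derivatives. -/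
noncomputable def dzbarW (Ω : Set (Cn n)) (t : ℝ) (v : Form n q) (x : Cn n) (j : Fin n)
    (J : MultiIdx n q) : ℂ := dzbarOf t x (fun l => wX Ω t l (v J) x) (v J x) j

/-- `L_j v_J`, in terms of the weighted derivatives. -/
noncomputable def wLW (Ω : Set (Cn n)) (t : ℝ) (v : Form n q) (x : Cn n) (j : Fin n)
    (J : MultiIdx n q) : ℂ := wLOf (fun l => wX Ω t l (v J) x) j

theorem norm_pd_le {θ : Cn n → ℝ} {A : ℝ} {x : Cn n} (h : ‖fderiv ℝ θ x‖ ≤ A)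
    (l : Fin n × Fin 2) : ‖((pd l θ x : ℝ) : ℂ)‖ ≤ A := by
  rw [Complex.norm_real]
  refine ((fderiv ℝ θ x).le_opNorm _).trans ?_
  simpa using h

theorem norm_sum_mul_pd_le {θ : Cn n → ℝ} {A M : ℝ} {x a : Cn n} (h : ‖fderiv ℝ θ x‖ ≤ A)
    (ha : ‖a‖ ≤ M) : ‖∑ l, (a l : ℂ) * ((pd l θ x : ℝ) : ℂ)‖ ≤ A * M := by
  have e : ∑ l, (a l : ℂ) * ((pd l θ x : ℝ) : ℂ) = ((fderiv ℝ θ x a : ℝ) : ℂ) := by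
    have ha' : a = ∑ l, a l • EuclideanSpace.single l (1 : ℝ) := by
      ext l
      simp [Pi.single_apply]
    conv_rhs => rw [ha']
    rw [map_sum]
    push_cast
    refine Finset.sum_congr rfl fun l _ => ?_
    rw [map_smul, smul_eq_mul, Complex.ofReal_mul]
  rw [e, Complex.norm_real]
  exact ((fderiv ℝ θ x).le_opNorm _).trans (mul_le_mul h ha (norm_nonneg _)
    ((norm_nonneg _).trans h))

variable {v : Form n q}

theorem continuous_zCoord (j : Fin n) : Continuous (zCoord (n := n) j) := by
  unfold zCoord; fun_prop

theorem aestronglyMeasurable_dzbarW (hv : ∀ J, MemSobolev Ω t 1 (v J)) (j : Fin n)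
    (J : MultiIdx n q) : AEStronglyMeasurable (fun x => dzbarW Ω t v x j J) (wMeasure Ω t) := by
  have h0 := ((hv J).wX (j, 0)).memLp.1
  have h1 := ((hv J).wX (j, 1)).memLp.1
  exact ((h0.add (h1.const_mul _)).const_mul _).add
    (((continuous_zCoord j).aestronglyMeasurable.const_mul _).mul (hv J).memLp.1)

theorem aestronglyMeasurable_wLW (hv : ∀ J, MemSobolev Ω t 1 (v J)) (j : Fin n)
    (J : MultiIdx n q) : AEStronglyMeasurable (fun x => wLW Ω t v x j J) (wMeasure Ω t) := by
  have h0 := ((hv J).wX (j, 0)).memLp.1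
  have h1 := ((hv J).wX (j, 1)).memLp.1
  exact (h0.sub (h1.const_mul _)).const_mul _

theorem aestronglyMeasurable_raise {w : Cn n → Fin n → MultiIdx n q → ℂ} {μ : Measure (Cn n)}
    (hw : ∀ j J, AEStronglyMeasurable (fun x => w x j J) μ) (K : MultiIdx n (q + 1)) :
    AEStronglyMeasurable (fun x => raise (w x) K) μ := by
  unfold raise
  exact Finset.aestronglyMeasurable_fun_sum _ fun p _ => (hw _ _).const_mul _

theorem aestronglyMeasurable_lower {w : Cn n → Fin n → MultiIdx n q → ℂ} {μ : Measure (Cn n)}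
    (hw : ∀ j J, AEStronglyMeasurable (fun x => w x j J) μ) (I : MultiIdx n (q - 1)) :
    AEStronglyMeasurable (fun x => lower (w x) I) μ := by
  unfold lower
  exact Finset.aestronglyMeasurable_fun_sum _ fun p _ => (hw _ _).const_mul _

theorem continuous_pd {θ : Cn n → ℝ} (hθ : ContDiff ℝ ∞ θ) (l : Fin n × Fin 2) :
    Continuous (fun x => pd l θ x) := by
  unfold pd
  exact (hθ.continuous_fderiv (by simp)).clm_apply continuous_const

/-- The Kohn–Morrey–Hörmander estimate for a localized form. -/
theorem sum_normSqL2_cutoff_le (hΩ : IsOpen Ω) {A : ℝ} {θ : Cn n → ℝ} (hθ : ContDiff ℝ ∞ θ)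
    (hθc : HasCompactSupport θ) (hθs : tsupport θ ⊆ Ω) (h0 : ∀ x, 0 ≤ θ x) (h1 : ∀ x, θ x ≤ 1)
    (hA : ∀ x, ‖fderiv ℝ θ x‖ ≤ A) (hv : ∀ J, MemSobolev Ω t 1 (v J))
    {Y : MultiIdx n q → Cn n → Fin n × Fin 2 → ℂ}
    (hY : Y = fun J x l => (θ x : ℂ) * wX Ω t l (v J) x + ((pd l θ x : ℝ) : ℂ) * v J x) :
    ∑ p : Fin n × MultiIdx n q,
        (normSqL2 Ω t (fun x => dzbarOf t x (Y p.2 x) ((θ x : ℂ) * v p.2 x) p.1) +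
          normSqL2 Ω t (fun x => wLOf (Y p.2 x) p.1)) ≤
      4 * (∑ K, normSqL2 Ω t (fun x => raise (dzbarW Ω t v x) K) +
        ∑ I, normSqL2 Ω t (fun x => lower (wLW Ω t v x) I)) +
      ENNReal.ofReal (2 * ((Fintype.card (MultiIdx n (q + 1)) + Fintype.card (MultiIdx n (q - 1))) *
        (2 * (Fintype.card (Fin n × MultiIdx n q) * (n * A ^ 2)))) + 3 * n * |t|) *
        ∑ J, normSqL2 Ω t (v J) := by
  have hθ' : ContDiff ℝ 1 (fun x => ((θ x : ℝ) : ℂ)) :=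
    Complex.ofRealCLM.contDiff.comp (hθ.of_le (by exact_mod_cast le_top))
  have hsupp : tsupport (fun x => ((θ x : ℝ) : ℂ)) ⊆ tsupport θ :=
    closure_mono fun x hx => by simpa using hx
  have hc' : HasCompactSupport (fun x => ((θ x : ℝ) : ℂ)) :=
    hθc.of_isClosed_subset (isClosed_tsupport _) hsupp
  have hpd : ∀ l x, pd l (fun x => ((θ x : ℝ) : ℂ)) x = ((pd l θ x : ℝ) : ℂ) := fun l x =>
    pd_ofReal (hθ.differentiable (by simp) x)
  have hx0 : ∀ x ∉ Ω, θ x = 0 ∧ ∀ l, pd l θ x = 0 := fun x hx =>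
    ⟨image_eq_zero_of_notMem_tsupport fun h => hx (hθs h),
      fun l => pd_eq_zero_of_notMem fun h => hx (hθs h)⟩
  have hθn : ∀ x, ‖((θ x : ℝ) : ℂ)‖ ≤ 1 := fun x => by
    rw [Complex.norm_real, Real.norm_of_nonneg (h0 x)]; exact h1 x
  have hkm := kohn_morrey (Ω := Ω) (t := t)
    (F := fun J x => (θ x : ℂ) * v J x)
    (DF := fun J l x => (θ x : ℂ) * weakDeriv Ω l (v J) x + ((pd l θ x : ℝ) : ℂ) * v J x)
    (fun J => by
      have := (hv J).compactH1 hΩ hθ' hc' (hsupp.trans hθs)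
      simpa only [hpd] using this)
    (fun J x hx => by simp [(hx0 x hx).1])
    (fun J l x hx => by simp [(hx0 x hx).1, (hx0 x hx).2])
    (w := fun j J x => dzbarOf t x (Y J x) ((θ x : ℂ) * v J x) j)
    (m := fun j J x => wLOf (Y J x) j)
    (by
      funext j J x
      congr 1
      funext l
      simp only [hY, wX]; ring)
    (by
      funext j J x
      congr 1
      funext l
      simp only [hY, wX]; ring)
  refine hkm.trans ?_
  have mθ : AEStronglyMeasurable (fun x => ((θ x : ℝ) : ℂ)) (wMeasure Ω t) :=
    hθ'.continuous.aestronglyMeasurable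
  have mpd : ∀ l, AEStronglyMeasurable (fun x => ((pd l θ x : ℝ) : ℂ)) (wMeasure Ω t) := fun l =>
    (Complex.continuous_ofReal.comp (continuous_pd hθ l)).aestronglyMeasurable
  have mv : ∀ J, AEStronglyMeasurable (v J) (wMeasure Ω t) := fun J => (hv J).memLp.1
  have mw := aestronglyMeasurable_dzbarW hv
  have mm := aestronglyMeasurable_wLW hv
  have b1 : ∀ x j, ‖(1 / 2) * (((pd (j, 0) θ x : ℝ) : ℂ) + Complex.I * ((pd (j, 1) θ x : ℝ) : ℂ))‖
      ≤ A := fun x j => (norm_half_add_I_mul_le (norm_pd_le (hA x) _) (norm_pd_le (hA x) _)).1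
  have b2 : ∀ x j, ‖(1 / 2) * (((pd (j, 0) θ x : ℝ) : ℂ) - Complex.I * ((pd (j, 1) θ x : ℝ) : ℂ))‖
      ≤ A := fun x j => (norm_half_add_I_mul_le (norm_pd_le (hA x) _) (norm_pd_le (hA x) _)).2
  have e1 : ∀ x j J, dzbarOf t x (Y J x) ((θ x : ℂ) * v J x) j =
      (θ x : ℂ) * dzbarW Ω t v x j J + (1 / 2) *
        (((pd (j, 0) θ x : ℝ) : ℂ) + Complex.I * ((pd (j, 1) θ x : ℝ) : ℂ)) * v J x := by
    intro x j J
    rw [hY]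
    exact dzbarOf_cutoff _ (fun l => ((pd l θ x : ℝ) : ℂ)) _ _ j
  have e2 : ∀ x j J, wLOf (Y J x) j = (θ x : ℂ) * wLW Ω t v x j J + (1 / 2) *
        (((pd (j, 0) θ x : ℝ) : ℂ) - Complex.I * ((pd (j, 1) θ x : ℝ) : ℂ)) * v J x := by
    intro x j J
    rw [hY]
    exact wLOf_cutoff _ (fun l => ((pd l θ x : ℝ) : ℂ)) _ _ j
  have m1 : ∀ j J, AEStronglyMeasurable (fun x => dzbarOf t x (Y J x) ((θ x : ℂ) * v J x) j)
      (wMeasure Ω t) := by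
    intro j J
    simp only [e1]
    exact (mθ.mul (mw j J)).add ((((mpd _).add ((mpd _).const_mul _)).const_mul _).mul (mv J))
  have m2 : ∀ j J, AEStronglyMeasurable (fun x => wLOf (Y J x) j) (wMeasure Ω t) := by
    intro j J
    simp only [e2]
    exact (mθ.mul (mm j J)).add ((((mpd _).sub ((mpd _).const_mul _)).const_mul _).mul (mv J))
  -- Only two of the three families of `lintegral_ofReal_le_of_pointwise` are needed; the middle one
  -- is indexed by `Empty`, with constant 0.
  have r1 : ∑ K, normSqL2 Ω t (fun x => raise
      (fun j J => dzbarOf t x (Y J x) ((θ x : ℂ) * v J x) j) K) ≤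
      ENNReal.ofReal 2 * ∑ K, normSqL2 Ω t (fun x => raise (dzbarW Ω t v x) K) +
        ENNReal.ofReal 0 * ∑ K : Empty, normSqL2 Ω t 0 +
        ENNReal.ofReal (Fintype.card (MultiIdx n (q + 1)) *
        (2 * (Fintype.card (Fin n × MultiIdx n q) * (n * A ^ 2)))) * ∑ J, normSqL2 Ω t (v J) := by
    refine (lintegral_ofReal_sum_norm_sq fun K =>
      aestronglyMeasurable_raise m1 K).symm.trans_le ?_
    refine lintegral_ofReal_le_of_pointwise zero_le_two le_rfl (by positivity)
      (fun K => aestronglyMeasurable_raise mw K) (fun K => K.elim) mv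
      (Eventually.of_forall fun x => ?_)
    simp only [zero_mul, add_zero, e1]
    exact sum_norm_raise_cutoff_le (hθn x) (b1 x) _ _
  have r2 : ∑ I, normSqL2 Ω t (fun x => lower (fun j J => wLOf (Y J x) j) I) ≤
      ENNReal.ofReal 2 * ∑ I, normSqL2 Ω t (fun x => lower (wLW Ω t v x) I) +
        ENNReal.ofReal 0 * ∑ K : Empty, normSqL2 Ω t 0 +
        ENNReal.ofReal (Fintype.card (MultiIdx n (q - 1)) *
        (2 * (Fintype.card (Fin n × MultiIdx n q) * (n * A ^ 2)))) * ∑ J, normSqL2 Ω t (v J) := by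
    refine (lintegral_ofReal_sum_norm_sq fun K =>
      aestronglyMeasurable_lower m2 K).symm.trans_le ?_
    refine lintegral_ofReal_le_of_pointwise zero_le_two le_rfl (by positivity)
      (fun K => aestronglyMeasurable_lower mm K) (fun K => K.elim) mv
      (Eventually.of_forall fun x => ?_)
    simp only [zero_mul, add_zero, e2]
    exact sum_norm_lower_cutoff_le (hθn x) (b2 x) _ _
  have r3 : ∑ J, normSqL2 Ω t (fun x => (θ x : ℂ) * v J x) ≤ ∑ J, normSqL2 Ω t (v J) := by
    refine Finset.sum_le_sum fun J _ => lintegral_mono fun x => ?_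
    rw [enorm_mul, mul_pow]
    refine mul_le_of_le_one_left' (pow_le_one' ?_ 2)
    rw [← ofReal_norm]
    exact ENNReal.ofReal_le_one.2 (hθn x)
  rw [ENNReal.ofReal_zero, zero_mul, add_zero, ENNReal.ofReal_ofNat] at r1 r2
  rw [add_mul (Fintype.card (MultiIdx n (q + 1)) : ℝ), ENNReal.ofReal_add (by positivity)
    (by positivity), ENNReal.ofReal_mul zero_le_two, ENNReal.ofReal_add (by positivity)
    (by positivity), ENNReal.ofReal_ofNat]
  calc _ ≤ 2 * ((2 * ∑ K, normSqL2 Ω t (fun x => raise (dzbarW Ω t v x) K) + _) + (2 *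
      ∑ I, normSqL2 Ω t (fun x => lower (wLW Ω t v x) I) + _)) + ENNReal.ofReal (3 * n * |t|) *
      ∑ J, normSqL2 Ω t (v J) := by gcongr
    _ = _ := by ring

/-- Combines the pointwise control of the gradient by `∂̄_j`, `L_j` and the fields with the
Kohn–Morrey–Hörmander bound for `θ v`. The constants depend on `θ` only through `A`, so exhausting
cut-offs may be inserted. -/
theorem lintegral_interior_cutoff_le (hΩ : IsOpen Ω) {A M C : ℝ} (hC : 0 ≤ C)
    (hM : ∀ i, ∀ x ∈ Ω, ‖T i x‖ ≤ M) (hT : ∀ i l, BddC Ω 0 (coef (T i) l))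
    (hpt : ∀ x ∈ Ω, ∀ (X : Fin n × Fin 2 → ℂ) (z : ℂ), ∑ l, ‖X l‖ ^ 2 ≤
      C * (∑ j, (‖dzbarOf t x X z j‖ ^ 2 + ‖wLOf X j‖ ^ 2) +
        ∑ i, ‖∑ l, (T i x l : ℂ) * X l‖ ^ 2))
    {θ : Cn n → ℝ} (hθ : ContDiff ℝ ∞ θ)
    (hθc : HasCompactSupport θ) (hθs : tsupport θ ⊆ Ω) (h0 : ∀ x, 0 ≤ θ x) (h1 : ∀ x, θ x ≤ 1)
    (hA : ∀ x, ‖fderiv ℝ θ x‖ ≤ A) (hv : ∀ J, MemSobolev Ω t 1 (v J)) :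
    ∫⁻ x, ENNReal.ofReal (θ x ^ 2 * ∑ J, ∑ l, ‖wX Ω t l (v J) x‖ ^ 2) ∂(wMeasure Ω t) ≤
      ENNReal.ofReal (2 * C) * (4 * (∑ K, normSqL2 Ω t (fun x => raise (dzbarW Ω t v x) K) +
        ∑ I, normSqL2 Ω t (fun x => lower (wLW Ω t v x) I)) +
      ENNReal.ofReal (2 * ((Fintype.card (MultiIdx n (q + 1)) + Fintype.card (MultiIdx n (q - 1))) *
        (2 * (Fintype.card (Fin n × MultiIdx n q) * (n * A ^ 2)))) + 3 * n * |t|) *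
        ∑ J, normSqL2 Ω t (v J)) +
      ENNReal.ofReal (4 * C) * ∑ p : ι × MultiIdx n q, normSqL2 Ω t (wT Ω t (T p.1) (v p.2)) +
      ENNReal.ofReal (4 * C * (Fintype.card ι * (A * M) ^ 2) + 4 * n * A ^ 2) *
        ∑ J, normSqL2 Ω t (v J) := by
  have hkm := sum_normSqL2_cutoff_le hΩ hθ hθc hθs h0 h1 hA hv rfl
  set Y : MultiIdx n q → Cn n → Fin n × Fin 2 → ℂ :=
    fun J x l => (θ x : ℂ) * wX Ω t l (v J) x + ((pd l θ x : ℝ) : ℂ) * v J x with hY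
  have mθ : AEStronglyMeasurable (fun x => ((θ x : ℝ) : ℂ)) (wMeasure Ω t) :=
    (Complex.continuous_ofReal.comp hθ.continuous).aestronglyMeasurable
  have mpd : ∀ l, AEStronglyMeasurable (fun x => ((pd l θ x : ℝ) : ℂ)) (wMeasure Ω t) := fun l =>
    (Complex.continuous_ofReal.comp (continuous_pd hθ l)).aestronglyMeasurable
  have mv : ∀ J, AEStronglyMeasurable (v J) (wMeasure Ω t) := fun J => (hv J).memLp.1
  have mY : ∀ J l, AEStronglyMeasurable (fun x => Y J x l) (wMeasure Ω t) := fun J l =>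
    (mθ.mul ((hv J).wX l).memLp.1).add ((mpd l).mul (mv J))
  have m1 : ∀ p : Fin n × MultiIdx n q, AEStronglyMeasurable
      (fun x => dzbarOf t x (Y p.2 x) ((θ x : ℂ) * v p.2 x) p.1) (wMeasure Ω t) := fun p =>
    (((mY _ _).add ((mY _ _).const_mul _)).const_mul _).add
      (((continuous_zCoord _).aestronglyMeasurable.const_mul _).mul (mθ.mul (mv _)))
  have m2 : ∀ p : Fin n × MultiIdx n q, AEStronglyMeasurable
      (fun x => wLOf (Y p.2 x) p.1) (wMeasure Ω t) := fun p =>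
    ((mY _ _).sub ((mY _ _).const_mul _)).const_mul _
  have m3 : ∀ p : ι × MultiIdx n q, AEStronglyMeasurable (wT Ω t (T p.1) (v p.2))
      (wMeasure Ω t) := fun p => (memSobolev_wT hΩ (hT p.1) (hv p.2)).memLp.1
  have hmain := lintegral_ofReal_le_of_pointwise (Ω := Ω) (t := t)
    (g := fun x => θ x ^ 2 * ∑ J, ∑ l, ‖wX Ω t l (v J) x‖ ^ 2)
    (P := Sum.elim (fun (p : Fin n × MultiIdx n q) x =>
      dzbarOf t x (Y p.2 x) ((θ x : ℂ) * v p.2 x) p.1)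
      (fun (p : Fin n × MultiIdx n q) x => wLOf (Y p.2 x) p.1))
    (Q := fun p : ι × MultiIdx n q => wT Ω t (T p.1) (v p.2)) (R := v)
    (a := 2 * C) (b := 4 * C) (c := 4 * C * (Fintype.card ι * (A * M) ^ 2) + 4 * n * A ^ 2)
    (by positivity) (by positivity) (by positivity)
    (fun p => by rcases p with p | p; exacts [m1 p, m2 p]) m3 mv (by
      filter_upwards [ae_mem_wMeasure hΩ] with x hx
      have hθn : ‖((θ x : ℝ) : ℂ)‖ ≤ 1 := by
        rw [Complex.norm_real, Real.norm_of_nonneg (h0 x)]; exact h1 x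
      have h := fun J => interior_cutoff_pointwise hC (hpt x hx) hθn (norm_pd_le (hA x))
        (fun i => norm_sum_mul_pd_le (hA x) (hM i x hx)) (fun l => wX Ω t l (v J) x) (v J x)
      have h' := Finset.sum_le_sum fun J (_ : J ∈ Finset.univ) => h J
      rw [Complex.norm_real, Real.norm_of_nonneg (h0 x), ← Finset.mul_sum] at h'
      refine h'.trans_eq ?_
      rw [Finset.sum_add_distrib, Finset.sum_add_distrib, ← Finset.mul_sum, ← Finset.mul_sum,
        ← Finset.mul_sum, Fintype.sum_sum_type, Fintype.sum_prod_type_right (γ := ℝ),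
        Fintype.sum_prod_type_right (γ := ℝ), Fintype.sum_prod_type_right (γ := ℝ),
        ← Finset.sum_add_distrib]
      simp only [← Finset.sum_add_distrib]
      rfl)
  refine hmain.trans ?_
  rw [Fintype.sum_sum_type]
  simp only [Sum.elim_inl, Sum.elim_inr]
  rw [← Finset.sum_add_distrib]
  gcongr

/-- The function `b` keeps away from the boundary but need not have compact support, so it is
multiplied by exhausting cut-offs `κ j`, whose gradients are bounded uniformly in `j`. All
dependence on `t` sits in front of `‖v‖²`. -/
theorem exists_interior_estimate (hΩ : IsOpen Ω) {A M c : ℝ} (hc : 0 < c)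
    (hM : ∀ i, ∀ x ∈ Ω, ‖T i x‖ ≤ M) (hT : ∀ i l, BddC Ω 0 (coef (T i) l))
    (hrad : ∀ x ∈ Ω,
      c * ‖x‖ ^ 2 ≤ ∑ i, ((inner ℝ (T i x) x) ^ 2 + (inner ℝ (T i x) (rotJ x)) ^ 2))
    {b : Cn n → ℝ} (hb : ContDiff ℝ ∞ b) (hbs : tsupport b ⊆ Ω) (h0 : ∀ x, 0 ≤ b x)
    (h1 : ∀ x, b x ≤ 1) (hA : ∀ x, ‖fderiv ℝ b x‖ ≤ A) :
    ∃ C : ℝ≥0, ∀ t : ℝ, ∃ D : ℝ≥0, ∀ v : Form n q, (∀ J, MemSobolev Ω t 1 (v J)) →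
      ∫⁻ x, ENNReal.ofReal (b x ^ 2 * ∑ J, ∑ l, ‖wX Ω t l (v J) x‖ ^ 2) ∂(wMeasure Ω t) ≤
        C * (∑ K, normSqL2 Ω t (fun x => raise (dzbarW Ω t v x) K) +
          ∑ I, normSqL2 Ω t (fun x => lower (wLW Ω t v x) I) +
          ∑ p : ι × MultiIdx n q, normSqL2 Ω t (wT Ω t (T p.1) (v p.2))) +
        D * ∑ J, normSqL2 Ω t (v J) := by
  obtain ⟨C, hC, hpt⟩ := exists_interior_pointwise n ι M hc
  obtain ⟨B, hB, κ, hκ, hκc, hκ0, hκ1, hκe, hκB⟩ := exists_exhausting_cutoffs n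
  refine ⟨(8 * C).toNNReal, fun t => ?_⟩
  obtain ⟨d, hd⟩ : ∃ d : ℝ, d = 2 * ((Fintype.card (MultiIdx n (q + 1)) +
      Fintype.card (MultiIdx n (q - 1))) * (2 * (Fintype.card (Fin n × MultiIdx n q) *
        (n * (B + A) ^ 2)))) + 3 * n * |t| := ⟨_, rfl⟩
  obtain ⟨e, he⟩ : ∃ e : ℝ, e = 4 * C * (Fintype.card ι * ((B + A) * M) ^ 2) +
      4 * n * (B + A) ^ 2 := ⟨_, rfl⟩
  refine ⟨(2 * C).toNNReal * d.toNNReal + e.toNNReal, fun v hv => ?_⟩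
  refine lintegral_le_of_eventually_eq
    (G := fun j x => ENNReal.ofReal ((κ j x * b x) ^ 2 * ∑ J, ∑ l, ‖wX Ω t l (v J) x‖ ^ 2))
    (fun j => ?_) (Eventually.of_forall fun x => ?_) fun j => ?_
  · refine AEMeasurable.ennreal_ofReal (AEMeasurable.mul
      (((hκ j).continuous.mul hb.continuous).pow 2).aemeasurable ?_)
    exact Finset.aemeasurable_fun_sum _ fun J _ => Finset.aemeasurable_fun_sum _ fun l _ =>
      ((hv J).wX l).memLp.1.norm.aemeasurable.pow_const 2
  · filter_upwards [hκe x] with j hj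
    rw [hj, one_mul]
  · have hsub : tsupport (fun x => κ j x * b x) ⊆ tsupport b :=
      closure_mono fun x hx => right_ne_zero_of_mul hx
    have hd1 : ∀ x, ‖fderiv ℝ (fun x => κ j x * b x) x‖ ≤ B + A := by
      intro x
      have hb' := hb.differentiable (by simp) x
      have hκ' := (hκ j).differentiable (by simp) x
      rw [fderiv_fun_mul hκ' hb']
      refine (norm_add_le _ _).trans ?_
      rw [norm_smul, norm_smul, Real.norm_of_nonneg (hκ0 j x), Real.norm_of_nonneg (h0 x),
        add_comm B A]
      exact add_le_add ((mul_le_of_le_one_left (norm_nonneg _) (hκ1 j x)).trans (hA x))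
        ((mul_le_of_le_one_left (norm_nonneg _) (h1 x)).trans (hκB j x))
    have h := lintegral_interior_cutoff_le (t := t) hΩ hC hM hT
      (fun x hx => hpt t x (fun i => T i x) (fun i => hM i x hx) (hrad x hx))
      ((hκ j).mul hb) ((hκc j).mul_right) (hsub.trans hbs)
      (fun x => mul_nonneg (hκ0 j x) (h0 x)) (fun x => mul_le_one₀ (hκ1 j x) (h0 x) (h1 x)) hd1 hv
    rw [← hd, ← he] at h
    refine h.trans ?_
    have c8 : ENNReal.ofReal (2 * C) * 4 = ENNReal.ofReal (8 * C) := by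
      rw [← ENNReal.ofReal_ofNat, ← ENNReal.ofReal_mul (by positivity)]
      congr 1; ring
    have c4 : ENNReal.ofReal (4 * C) ≤ ENNReal.ofReal (8 * C) :=
      ENNReal.ofReal_le_ofReal (by linarith)
    push_cast
    change _ ≤ ENNReal.ofReal (8 * C) * _ + (ENNReal.ofReal (2 * C) * ENNReal.ofReal d +
      ENNReal.ofReal e) * _
    rw [mul_add (ENNReal.ofReal (2 * C)), ← mul_assoc, c8, mul_add (ENNReal.ofReal (8 * C)) (_ + _)]
    refine (add_le_add_left (add_le_add_right (mul_le_mul_left c4 _) _) _).trans_eq ?_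
    ring

end InteriorEstimate

/-! ### The first order estimate on the whole domain. -/

section BaseEstimate

variable {n q : ℕ} {Ω U : Set (Cn n)} {ρ : Cn n → ℝ} {ι : Type*} [Fintype ι]
  {T : ι → Cn n → Cn n}

/-- A ball around `z` that misses the boundary is connected, so it cannot leave `Ω`. -/
theorem mem_of_dist_lt_of_notMem_thickening (hΩ : IsOpen Ω) {x z : Cn n} {r : ℝ} (hz : z ∈ Ω)
    (hzt : z ∉ thickening r (frontier Ω)) (hxz : dist x z < r) : x ∈ Ω := by
  have hf : ∀ w ∈ ball z r, w ∉ frontier Ω := fun w hw hwf =>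
    hzt (mem_thickening_iff.2 ⟨w, hwf, by rw [dist_comm]; exact hw⟩)
  have hsub : ball z r ⊆ Ω ∪ (closure Ω)ᶜ := fun w hw => by
    by_contra h
    rw [mem_union, not_or, mem_compl_iff, not_not] at h
    exact hf w hw (hΩ.frontier_eq ▸ ⟨h.2, h.1⟩)
  by_contra hx
  obtain ⟨w, -, hw1, hw2⟩ := (convex_ball z r).isPreconnected Ω (closure Ω)ᶜ hΩ
    isClosed_closure.isOpen_compl hsub ⟨z, mem_ball_self (dist_nonneg.trans_lt hxz), hz⟩
    ⟨x, hxz, (hsub hxz).resolve_left hx⟩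
  exact hw2 (subset_closure hw1)

/-- A cut-off function near the boundary, and one for the interior. -/
theorem exists_boundary_interior_cutoffs (hΩ : IsOpen Ω) {δ : ℝ} (hδ : 0 < δ) :
    ∃ (A : ℝ) (b₁ b₂ : Cn n → ℝ), ContDiff ℝ ∞ b₁ ∧ ContDiff ℝ ∞ b₂ ∧
      (∀ x, 0 ≤ b₁ x) ∧ (∀ x, 0 ≤ b₂ x) ∧ (∀ x, b₁ x ≤ 1) ∧ (∀ x, b₂ x ≤ 1) ∧
      tsupport b₁ ⊆ thickening δ (frontier Ω) ∧ tsupport b₂ ⊆ Ω ∧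
      (∀ x, ‖fderiv ℝ b₁ x‖ ≤ A) ∧ (∀ x, ‖fderiv ℝ b₂ x‖ ≤ A) ∧
      ∀ x ∈ Ω, 1 ≤ b₁ x ^ 2 + b₂ x ^ 2 := by
  -- Smoothing acts at scale `d`. The first function is 1 within `3 d` of the boundary and supported
  -- within `6 d` of it; the second is 1 on the rest of `Ω` and supported in `Ω`.
  obtain ⟨d, rfl⟩ : ∃ d, δ = 6 * d := ⟨δ / 6, by ring⟩
  have hd : 0 < d := by linarith
  obtain ⟨A, -, h⟩ := exists_smooth_cutoff n hd
  obtain ⟨b₁, s1, p1, q1, o1, z1, f1⟩ := h (thickening (4 * d) (frontier Ω))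
    isOpen_thickening.measurableSet
  obtain ⟨b₂, s2, p2, q2, o2, z2, f2⟩ := h (Ω \ thickening (2 * d) (frontier Ω))
    (hΩ.measurableSet.diff isOpen_thickening.measurableSet)
  have key : ∀ {b : Cn n → ℝ} {S : Set (Cn n)}, (∀ x, Disjoint (ball x d) S → b x = 0) →
      ∀ x ∈ tsupport b, ∃ z ∈ S, dist x z < 2 * d := by
    intro b S hz x hx
    obtain ⟨y, hy, hxy⟩ := Metric.mem_closure_iff.1 hx d hd
    obtain ⟨z, hzb, hzS⟩ := not_disjoint_iff.1 fun hdis => hy (hz y hdis)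
    refine ⟨z, hzS, ?_⟩
    have := dist_triangle x y z
    rw [mem_ball, dist_comm] at hzb
    linarith
  refine ⟨A, b₁, b₂, s1, s2, p1, p2, q1, q2, fun x hx => ?_, fun x hx => ?_, f1, f2,
    fun x hx => ?_⟩
  · obtain ⟨z, hz, hxz⟩ := key z1 x hx
    obtain ⟨w, hw, hzw⟩ := mem_thickening_iff.1 hz
    refine mem_thickening_iff.2 ⟨w, hw, ?_⟩
    have := dist_triangle x z w
    linarith
  · obtain ⟨z, hz, hxz⟩ := key z2 x hx
    exact mem_of_dist_lt_of_notMem_thickening hΩ hz.1 hz.2 hxz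
  · by_cases hxt : x ∈ thickening (3 * d) (frontier Ω)
    · have : b₁ x = 1 := o1 x fun y hy => by
        obtain ⟨w, hw, hxw⟩ := mem_thickening_iff.1 hxt
        refine mem_thickening_iff.2 ⟨w, hw, ?_⟩
        have := dist_triangle y x w
        rw [mem_ball] at hy
        linarith
      rw [this]
      linarith [sq_nonneg (b₂ x)]
    · have : b₂ x = 1 := o2 x fun y hy => by
        rw [mem_ball] at hy
        refine ⟨mem_of_dist_lt_of_notMem_thickening hΩ hx hxt (by linarith), fun hyt => hxt ?_⟩
        obtain ⟨w, hw, hyw⟩ := mem_thickening_iff.1 hyt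
        refine mem_thickening_iff.2 ⟨w, hw, ?_⟩
        have := dist_triangle x y w
        rw [dist_comm] at hy
        linarith
      rw [this]
      linarith [sq_nonneg (b₁ x)]

theorem exists_unit_normal {L : Cn n →L[ℝ] ℝ} (hL : L ≠ 0) :
    ∃ g : Cn n, ‖g‖ = 1 ∧ ∀ ξ, inner ℝ g ξ = 0 ↔ L ξ = 0 := by
  have hn : ‖L‖ ≠ 0 := norm_ne_zero_iff.2 hL
  refine ⟨‖L‖⁻¹ • (InnerProductSpace.toDual ℝ (Cn n)).symm L, ?_, fun ξ => ?_⟩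
  · rw [norm_smul, LinearIsometryEquiv.norm_map, norm_inv, norm_norm, inv_mul_cancel₀ hn]
  · rw [real_inner_smul_left, InnerProductSpace.toDual_symm_apply, mul_eq_zero,
      or_iff_right (inv_ne_zero hn)]

/-- `exists_boundary_pointwise` with the unit normal of the level set of `ρ`, multiplied by `b²` and
integrated. Its error `t² b² |x|² |v|²` is what `lintegral_boundary_radial_le` bounds by tangential
derivatives. -/
theorem exists_boundary_estimate (hΩ : IsOpen Ω) {m : ℕ} (hm : 1 ≤ m)
    (hρ : IsUniformDefiningFunction Ω m ρ U) {M c R δ A : ℝ} (hc : 0 < c)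
    (hT : ∀ i, ContDiffOn ℝ 1 (T i) Ω) (hTb : ∀ i l, BddC Ω 0 (coef (T i) l))
    (hM0 : ∀ i, ∀ x ∈ Ω, ‖T i x‖ ≤ M)
    (hM1 : ∀ i, ∀ x ∈ Ω, ‖fderiv ℝ (T i) x‖ ≤ M) (hδU : thickening δ (frontier Ω) ⊆ U)
    (htan : ∀ x ∈ Ω ∩ thickening δ (frontier Ω), fderiv ℝ ρ x ≠ 0 ∧
      (∀ i, fderiv ℝ ρ x (T i x) = 0) ∧
      (∀ ξ, fderiv ℝ ρ x ξ = 0 → c * ‖ξ‖ ^ 2 ≤ ∑ i, (inner ℝ (T i x) ξ) ^ 2) ∧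
      (R ≤ ‖x‖ → c * ‖x‖ ^ 2 ≤ ∑ i, (inner ℝ (T i x) x) ^ 2))
    {b : Cn n → ℝ} (hb : ContDiff ℝ ∞ b) (h0 : ∀ x, 0 ≤ b x)
    (h1 : ∀ x, b x ≤ 1) (hbs : tsupport b ⊆ thickening δ (frontier Ω))
    (hA : ∀ x, ‖fderiv ℝ b x‖ ≤ A) :
    ∃ C : ℝ≥0, ∀ t : ℝ, ∃ D : ℝ≥0, ∀ v : Form n q, (∀ J, MemSobolev Ω t 1 (v J)) →
      ∫⁻ x, ENNReal.ofReal (b x ^ 2 * ∑ J, ∑ l, ‖wX Ω t l (v J) x‖ ^ 2) ∂(wMeasure Ω t) ≤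
        C * (∑ K, normSqL2 Ω t (fun x => raise (dzbarW Ω t v x) K) +
          ∑ I, normSqL2 Ω t (fun x => lower (wLW Ω t v x) I) +
          ∑ p : ι × MultiIdx n q, normSqL2 Ω t (wT Ω t (T p.1) (v p.2))) +
        D * ∑ J, normSqL2 Ω t (v J) := by
  obtain ⟨C, hC, hpt⟩ := exists_boundary_pointwise n q ι hc
  obtain ⟨C', hrad⟩ := lintegral_boundary_radial_le hΩ hm hρ hc hT hM0 hM1 hδU
    (fun x hx => ⟨(htan x hx).2.1, (htan x hx).2.2.2⟩) hb h0 h1 hbs hA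
  refine ⟨C.toNNReal + C.toNNReal * C', fun t => ?_⟩
  obtain ⟨D', hD'⟩ := hrad t
  refine ⟨C.toNNReal * D', fun v hv => ?_⟩
  have mv : ∀ J, AEStronglyMeasurable (v J) (wMeasure Ω t) := fun J => (hv J).memLp.1
  have hmain := lintegral_ofReal_le_of_pointwise (Ω := Ω) (t := t)
    (g := fun x => b x ^ 2 * ∑ J, ∑ l, ‖wX Ω t l (v J) x‖ ^ 2)
    (P := Sum.elim (fun K x => raise (dzbarW Ω t v x) K) (fun I x => lower (wLW Ω t v x) I))
    (Q := fun p : ι × MultiIdx n q => wT Ω t (T p.1) (v p.2))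
    -- The error keeps its factor `b`; without it the radial estimate would not apply.
    (R := fun J x => ((t * (b x * ‖x‖) : ℝ) : ℂ) * v J x)
    (a := C) (b := C) (c := C) hC hC hC
    (fun p => by
      rcases p with p | p
      · exact aestronglyMeasurable_raise (aestronglyMeasurable_dzbarW hv) p
      · exact aestronglyMeasurable_lower (aestronglyMeasurable_wLW hv) p)
    (fun p => (memSobolev_wT hΩ (hTb p.1) (hv p.2)).memLp.1)
    (fun J => (Complex.continuous_ofReal.comp
      (continuous_const.mul (hb.continuous.mul continuous_norm))).aestronglyMeasurable.mul (mv J))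
    (by
      filter_upwards [ae_mem_wMeasure hΩ] with x hx
      rw [Fintype.sum_sum_type]
      simp only [Sum.elim_inl, Sum.elim_inr]
      have nP : 0 ≤ ∑ K, ‖raise (dzbarW Ω t v x) K‖ ^ 2 + ∑ I, ‖lower (wLW Ω t v x) I‖ ^ 2 := by
        positivity
      have nQ : 0 ≤ ∑ p : ι × MultiIdx n q, ‖wT Ω t (T p.1) (v p.2) x‖ ^ 2 := by positivity
      have eR : ∑ J, ‖((t * (b x * ‖x‖) : ℝ) : ℂ) * v J x‖ ^ 2 =
          b x ^ 2 * (t ^ 2 * ‖x‖ ^ 2 * ∑ J, ‖v J x‖ ^ 2) := by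
        simp only [norm_mul, Complex.norm_real, mul_pow, Real.norm_eq_abs, sq_abs,
          ← Finset.mul_sum, abs_norm]
        ring
      rw [eR]
      by_cases hxs : x ∈ tsupport b
      · obtain ⟨t1, t2, t3, -⟩ := htan x ⟨hx, hbs hxs⟩
        obtain ⟨g, hg, hgL⟩ := exists_unit_normal t1
        have h := hpt t x g hg (fun i => T i x) (fun i => (hgL _).2 (t2 i))
          (fun ξ hξ => t3 ξ ((hgL ξ).1 hξ)) (fun J l => wX Ω t l (v J) x) (fun J => v J x)
        have h2 := mul_le_mul_of_nonneg_left h (sq_nonneg (b x))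
        have hb2 : b x ^ 2 ≤ 1 := pow_le_one₀ (h0 x) (h1 x)
        have h3 := mul_le_mul_of_nonneg_right hb2 (mul_nonneg hC nP)
        have h4 := mul_le_mul_of_nonneg_right hb2 (mul_nonneg hC nQ)
        have e5 : ∑ p : ι × MultiIdx n q, ‖wT Ω t (T p.1) (v p.2) x‖ ^ 2 =
          ∑ i, ∑ J, ‖∑ l, (T i x l : ℂ) * wX Ω t l (v J) x‖ ^ 2 := Fintype.sum_prod_type _
        have e6 : (fun j J => dzbarOf t x (fun l => wX Ω t l (v J) x) (v J x) j) =
          dzbarW Ω t v x := rfl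
        have e7 : (fun j J => wLOf (fun l => wX Ω t l (v J) x) j) = wLW Ω t v x := rfl
        rw [← e5, e6, e7] at h2
        refine h2.trans ?_
        linarith
      · have : b x = 0 := image_eq_zero_of_notMem_tsupport hxs
        rw [this]
        have := mul_nonneg hC nP
        have := mul_nonneg hC nQ
        simp only [ne_eq, OfNat.ofNat_ne_zero, not_false_eq_true, zero_pow, zero_mul, mul_zero,
          add_zero]
        linarith)
  refine hmain.trans ?_
  rw [Fintype.sum_sum_type]
  simp only [Sum.elim_inl, Sum.elim_inr]
  have hR : ∑ J, normSqL2 Ω t (fun x => ((t * (b x * ‖x‖) : ℝ) : ℂ) * v J x) ≤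
      C' * ∑ p : ι × MultiIdx n q, normSqL2 Ω t (wT Ω t (T p.1) (v p.2)) +
        D' * ∑ J, normSqL2 Ω t (v J) := by
    rw [Fintype.sum_prod_type_right, Finset.mul_sum, Finset.mul_sum, ← Finset.sum_add_distrib]
    refine Finset.sum_le_sum fun J _ => le_trans (le_of_eq ?_) (hD' (v J) (hv J))
    refine lintegral_congr fun x => ?_
    rw [enorm_mul, mul_pow]
    congr 1
    rw [← ofReal_norm, ← ENNReal.ofReal_pow (norm_nonneg _), Complex.norm_real,
      Real.norm_eq_abs, sq_abs]
    congr 1; ring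
  change ENNReal.ofReal C * _ + ENNReal.ofReal C * _ + _ ≤ _
  refine (add_le_add_right (mul_le_mul_right hR _) _).trans ?_
  push_cast
  change _ ≤ (ENNReal.ofReal C + ENNReal.ofReal C * C') * _ + ENNReal.ofReal C * D' * _
  generalize ∑ p : ι × MultiIdx n q, normSqL2 Ω t (wT Ω t (T p.1) (v p.2)) = Q
  generalize ∑ J, normSqL2 Ω t (v J) = Z
  generalize ∑ K, normSqL2 Ω t (fun x => raise (dzbarW Ω t v x) K) +
    ∑ I, normSqL2 Ω t (fun x => lower (wLW Ω t v x) I) = P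
  refine le_trans le_self_add (b := _ + ENNReal.ofReal C * C' * P) (le_of_eq ?_)
  ring

/-- The full first order norm is controlled by `∂̄`, `ϑ` and the tangential derivatives. -/
theorem exists_first_order_estimate (hΩ : IsOpen Ω) {m p : ℕ} (hm : 2 ≤ m) (hp : 1 ≤ p)
    (hρ : IsUniformDefiningFunction Ω m ρ U) (hnr : AsymptoticallyNonradial Ω ρ)
    (hT : IsTangentialGradient Ω p ρ U T) (q : ℕ) :
    ∃ C : ℝ≥0, ∀ t : ℝ, ∃ D : ℝ≥0, ∀ v : Form n q, (∀ J, MemSobolev Ω t 1 (v J)) →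
      ∑ J, ∑ l, normSqL2 Ω t (wX Ω t l (v J)) ≤
        C * (∑ K, normSqL2 Ω t (fun x => raise (dzbarW Ω t v x) K) +
          ∑ I, normSqL2 Ω t (fun x => lower (wLW Ω t v x) I) +
          ∑ p : ι × MultiIdx n q, normSqL2 Ω t (wT Ω t (T p.1) (v p.2))) +
        D * ∑ J, normSqL2 Ω t (v J) := by
  obtain ⟨δ, c, R, hδ, hc, -, hδU, htan⟩ := exists_boundary_neighborhood hm hρ hnr hT
  obtain ⟨c', hc', hrad⟩ := hT.exists_radial_bound
  obtain ⟨M, hM⟩ := hT.bounded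
  obtain ⟨A, b₁, b₂, s1, s2, p1, p2, q1, q2, u1, u2, f1, f2, hsum⟩ :=
    exists_boundary_interior_cutoffs hΩ hδ
  have hTb : ∀ i l, BddC Ω 0 (coef (T i) l) := fun i l =>
    (bddC_coef hΩ (hT.contDiffOn i) (hM i)).mono (Nat.zero_le _)
  have hM0 : ∀ i, ∀ x ∈ Ω, ‖T i x‖ ≤ M := fun i x hx => by
    simpa [norm_iteratedFDeriv_zero] using hM i 0 (Nat.zero_le _) x hx
  have hM1 : ∀ i, ∀ x ∈ Ω, ‖fderiv ℝ (T i) x‖ ≤ M := fun i x hx => by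
    simpa [norm_iteratedFDeriv_one] using hM i 1 hp x hx
  obtain ⟨C₁, h₁⟩ := exists_boundary_estimate (q := q) hΩ (one_le_two.trans hm) hρ hc
    (fun i => (hT.contDiffOn i).of_le (by exact_mod_cast hp)) hTb hM0 hM1 hδU htan s1 p1 q1 u1 f1
  obtain ⟨C₂, h₂⟩ := exists_interior_estimate (q := q) hΩ hc' hM0 hTb hrad s2 u2 p2 q2 f2
  refine ⟨C₁ + C₂, fun t => ?_⟩
  obtain ⟨D₁, h₁⟩ := h₁ t
  obtain ⟨D₂, h₂⟩ := h₂ t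
  refine ⟨D₁ + D₂, fun v hv => ?_⟩
  have hmeas : AEMeasurable (fun x => ENNReal.ofReal
      (b₁ x ^ 2 * ∑ J, ∑ l, ‖wX Ω t l (v J) x‖ ^ 2)) (wMeasure Ω t) := by
    refine AEMeasurable.ennreal_ofReal (AEMeasurable.mul (s1.continuous.pow 2).aemeasurable ?_)
    exact Finset.aemeasurable_fun_sum _ fun J _ => Finset.aemeasurable_fun_sum _ fun l _ =>
      ((hv J).wX l).memLp.1.norm.aemeasurable.pow_const 2
  -- The squares of the two cut-offs sum to at least 1 on `Ω`.
  have hsplit : ∑ J, ∑ l, normSqL2 Ω t (wX Ω t l (v J)) ≤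
      ∫⁻ x, ENNReal.ofReal (b₁ x ^ 2 * ∑ J, ∑ l, ‖wX Ω t l (v J) x‖ ^ 2) ∂(wMeasure Ω t) +
      ∫⁻ x, ENNReal.ofReal (b₂ x ^ 2 * ∑ J, ∑ l, ‖wX Ω t l (v J) x‖ ^ 2) ∂(wMeasure Ω t) := by
    rw [← lintegral_add_left' hmeas, ← Fintype.sum_prod_type'
      (f := fun J l => normSqL2 Ω t (wX Ω t l (v J))), ← lintegral_ofReal_sum_norm_sq
      (P := fun p : MultiIdx n q × (Fin n × Fin 2) => wX Ω t p.2 (v p.1))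
      fun p => ((hv p.1).wX p.2).memLp.1]
    refine lintegral_mono_ae ?_
    filter_upwards [ae_mem_wMeasure hΩ] with x hx
    have nn : 0 ≤ ∑ J, ∑ l, ‖wX Ω t l (v J) x‖ ^ 2 := by positivity
    rw [← ENNReal.ofReal_add (mul_nonneg (sq_nonneg _) nn) (mul_nonneg (sq_nonneg _) nn),
      ← add_mul, Fintype.sum_prod_type]
    exact ENNReal.ofReal_le_ofReal (le_mul_of_one_le_left nn (hsum x hx))
  refine (hsplit.trans (add_le_add (h₁ v hv) (h₂ v hv))).trans_eq ?_
  push_cast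
  ring

end BaseEstimate

/-! ### `∂̄` and `ϑ^t` as a first order system. -/

section DbarSystem

variable {n q : ℕ} {Ω : Set (Cn n)} {t : ℝ} {v : Form n q}

/-- The coefficients of the first order system `(∂̄, ϑ)`. -/
noncomputable def dbarCoef (n q : ℕ) : MultiIdx n (q + 1) ⊕ MultiIdx n (q - 1) → MultiIdx n q →
    Fin n × Fin 2 → ℂ
  | .inl K, J, l => (if l.2 = 0 then 1 / 2 else Complex.I / 2) * eps l.1 J.1 K.1
  | .inr I, J, l => (if l.2 = 0 then -1 / 2 else Complex.I / 2) * eps l.1 I.1 J.1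

/-- The zero order coefficients of the system `(∂̄, ϑ)`. -/
noncomputable def dbarCoefZero (n q : ℕ) : MultiIdx n (q + 1) ⊕ MultiIdx n (q - 1) → MultiIdx n q →
    Fin n × Fin 2 → ℂ
  | .inl K, J, l => (if l.2 = 0 then 1 else Complex.I) * eps l.1 J.1 K.1
  | .inr _, _, _ => 0

theorem firstOrder_inl (K : MultiIdx n (q + 1)) :
    firstOrder Ω t (dbarCoef n q) (dbarCoefZero n q) v (.inl K) =
      fun x => raise (dzbarW Ω t v x) K := by
  funext x
  simp only [firstOrder, raise, Fintype.sum_prod_type, Fin.sum_univ_two, dbarCoef, dbarCoefZero]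
  rw [Finset.sum_comm]
  refine Finset.sum_congr rfl fun j _ => Finset.sum_congr rfl fun J _ => ?_
  simp only [dzbarW, dzbarOf, zCoord, if_true, one_ne_zero, if_false]
  ring

theorem firstOrder_inr (I : MultiIdx n (q - 1)) :
    firstOrder Ω t (dbarCoef n q) (dbarCoefZero n q) v (.inr I) =
      fun x => -lower (wLW Ω t v x) I := by
  funext x
  simp only [firstOrder, lower, Fintype.sum_prod_type, Fin.sum_univ_two, dbarCoef, dbarCoefZero]
  rw [Finset.sum_comm]
  simp only [← Finset.sum_neg_distrib]
  refine Finset.sum_congr rfl fun j _ => Finset.sum_congr rfl fun J _ => ?_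
  simp only [wLW, wLOf, if_true, one_ne_zero, if_false]
  ring

/-- `∂̄` carries no weight, so the identity holds for every `t`: the terms `t z_j` compensate those
hidden in the `X_l`. -/
theorem dbar_eq_raise (K : MultiIdx n (q + 1)) :
    dbar Ω v K = fun x => raise (dzbarW Ω t v x) K := by
  funext x
  simp only [dbar, raise, Fintype.sum_prod_type]
  rw [Finset.sum_comm]
  refine Finset.sum_congr rfl fun j _ => Finset.sum_congr rfl fun J _ => ?_
  simp only [dzbar, dzbarW, dzbarOf, zCoord, weakDeriv_eq_wX (t := t)]
  ring

theorem wL_eq (j : Fin n) (f : Cn n → ℂ) (x : Cn n) :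
    wL Ω t j f x = wLOf (fun l => wX Ω t l f x) j := by
  simp only [wL, dz, wLOf, zCoord, weakDeriv_eq_wX (t := t), map_add, map_mul, Complex.conj_I,
    Complex.conj_ofReal]
  ring

/-- Only almost everywhere: `ϑ^t` differentiates the contracted coefficients, and the chosen weak
derivative of a linear combination is the combination of the chosen ones only up to a null set. -/
theorem vartheta_ae_eq (hΩ : IsOpen Ω) (hv : ∀ J, Wloc Ω 1 (v J)) (I : MultiIdx n (q - 1)) :
    vartheta Ω t v I =ᵐ[volume.restrict Ω] fun x => -lower (wLW Ω t v x) I := by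
  have h1 : ∀ j l, wX Ω t l (contract v j I.1) =ᵐ[volume.restrict Ω]
      fun x => ∑ J, eps j I.1 J.1 * wX Ω t l (v J) x := by
    intro j l
    have h2 := wX_sum (t := t) (l := l) hΩ (Finset.univ : Finset (MultiIdx n q))
      (F := fun J x => eps j I.1 J.1 * v J x) fun J _ => (hv J).const_mul hΩ _
    refine h2.trans ?_
    filter_upwards [ae_all_iff.2 fun J => wX_const_mul (t := t) (l := l) hΩ (hv J)
      (eps j I.1 J.1)] with x hx
    exact Finset.sum_congr rfl fun J _ => hx J
  filter_upwards [ae_all_iff.2 fun j => ae_all_iff.2 fun l => h1 j l] with x hx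
  simp only [vartheta, lower, wL_eq, Fintype.sum_prod_type, wLOf, wLW, hx, Finset.mul_sum,
    ← Finset.sum_sub_distrib]
  congr 1
  refine Finset.sum_congr rfl fun j _ => Finset.sum_congr rfl fun J _ => ?_
  ring

theorem famNormSq_firstOrder {k : ℕ} (hΩ : IsOpen Ω) (hv : ∀ J, Wloc Ω 1 (v J)) :
    famNormSq Ω t k (firstOrder Ω t (dbarCoef n q) (dbarCoefZero n q) v) =
      ∑ K, recNormSq Ω t k (dbar Ω v K) + ∑ I, recNormSq Ω t k (vartheta Ω t v I) := by
  rw [famNormSq, Fintype.sum_sum_type]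
  congr 1
  · exact Finset.sum_congr rfl fun K _ => by rw [firstOrder_inl, dbar_eq_raise]
  · refine Finset.sum_congr rfl fun I _ => ?_
    rw [firstOrder_inr]
    exact recNormSq_congr (vartheta_ae_eq hΩ hv I).symm

theorem wloc_dbar {k : ℕ} (hΩ : IsOpen Ω) (hv : ∀ J, Wloc Ω (k + 1) (v J))
    (K : MultiIdx n (q + 1)) : Wloc Ω k (dbar Ω v K) := by
  -- Any value of `t` would do.
  rw [dbar_eq_raise (t := 0), ← firstOrder_inl]
  exact wloc_firstOrder hΩ hv _

theorem wloc_vartheta {k : ℕ} (hΩ : IsOpen Ω) (hv : ∀ J, Wloc Ω (k + 1) (v J))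
    (I : MultiIdx n (q - 1)) : Wloc Ω k (vartheta Ω t v I) := by
  refine Wloc.congr ?_ (vartheta_ae_eq hΩ (fun J => (hv J).mono (Nat.le_add_left 1 k)) I).symm
  rw [← firstOrder_inr]
  exact wloc_firstOrder hΩ hv _

variable {U : Set (Cn n)} {ρ : Cn n → ℝ} {ι : Type*} [Fintype ι] {T : ι → Cn n → Cn n}

/-- The base case, in the form that the induction over the order expects. -/
theorem exists_first_order_system_estimate (hΩ : IsOpen Ω) {m p : ℕ} (hm : 2 ≤ m) (hp : 1 ≤ p)
    (hρ : IsUniformDefiningFunction Ω m ρ U) (hnr : AsymptoticallyNonradial Ω ρ)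
    (hT : IsTangentialGradient Ω p ρ U T) (q : ℕ) :
    ∃ C : ℝ≥0, ∀ t : ℝ, ∃ D : ℝ≥0, ∀ v : Form n q, (∀ J, MemSobolev Ω t 1 (v J)) →
      famNormSq Ω t 1 v ≤
        C * (famNormSq Ω t 0 (firstOrder Ω t (dbarCoef n q) (dbarCoefZero n q) v) +
          ∑ i, famNormSq Ω t 0 (fun J => wT Ω t (T i) (v J))) + D * famNormSq Ω t 0 v := by
  obtain ⟨C, h⟩ := exists_first_order_estimate hΩ hm hp hρ hnr hT q
  refine ⟨C, fun t => ?_⟩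
  obtain ⟨D, h⟩ := h t
  refine ⟨1 + D, fun v hv => ?_⟩
  have e1 : famNormSq Ω t 1 v =
      ∑ J, normSqL2 Ω t (v J) + ∑ J, ∑ l, normSqL2 Ω t (wX Ω t l (v J)) := by
    simp only [famNormSq, recNormSq, Finset.sum_add_distrib]
  have e2 : famNormSq Ω t 0 (firstOrder Ω t (dbarCoef n q) (dbarCoefZero n q) v) =
      ∑ K, normSqL2 Ω t (fun x => raise (dzbarW Ω t v x) K) +
        ∑ I, normSqL2 Ω t (fun x => lower (wLW Ω t v x) I) := by
    simp only [famNormSq, recNormSq, Fintype.sum_sum_type, firstOrder_inl, firstOrder_inr,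
      normSqL2, enorm_neg]
  have e3 : ∑ i, famNormSq Ω t 0 (fun J => wT Ω t (T i) (v J)) =
      ∑ p : ι × MultiIdx n q, normSqL2 Ω t (wT Ω t (T p.1) (v p.2)) := by
    simp only [famNormSq, recNormSq, Fintype.sum_prod_type]
  have e4 : famNormSq Ω t 0 v = ∑ J, normSqL2 Ω t (v J) := by
    simp only [famNormSq, recNormSq]
  rw [e1, e2, e3, e4]
  refine (add_le_add_right (h v hv) _).trans_eq ?_
  push_cast
  ring

end DbarSystem

end WeightedDbar

/-! ### The estimate of order `k`. -/

theorem proposition4p9 {n m k q : ℕ} (hm : 3 ≤ m) (hk : 1 ≤ k) (hkm : k + 1 ≤ m)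
    (Ω : Set (WeightedDbar.Cn n)) (hΩ : IsOpen Ω) (hΩc : IsConnected Ω)
    (ρ : WeightedDbar.Cn n → ℝ) (U : Set (WeightedDbar.Cn n))
    (hρ : WeightedDbar.IsUniformDefiningFunction Ω m ρ U)
    (hnr : WeightedDbar.AsymptoticallyNonradial Ω ρ)
    {ι : Type*} [Fintype ι] (T : ι → WeightedDbar.Cn n → WeightedDbar.Cn n)
    (hT : WeightedDbar.IsTangentialGradient Ω (m - 1) ρ U T) :
    ∃ Ck : ℝ≥0, 0 < Ck ∧ ∀ t : ℝ, ∃ Ctk : ℝ≥0, 0 < Ctk ∧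
      ∀ v : WeightedDbar.Form n q, WeightedDbar.FormMemSobolev Ω t k v →
        WeightedDbar.formNormSqSobolev Ω t k v ≤
          (Ck : ℝ≥0∞) * (WeightedDbar.formNormSqSobolev Ω t (k - 1) (WeightedDbar.dbar Ω v) +
            WeightedDbar.formNormSqSobolev Ω t (k - 1) (WeightedDbar.vartheta Ω t v) +
            WeightedDbar.formNormSqTangential Ω t T k v) +
          (Ctk : ℝ≥0∞) * WeightedDbar.formNormSqSobolev Ω t (k - 1) v := by
  open WeightedDbar in
  obtain ⟨k, rfl⟩ : ∃ k', k = k' + 1 := ⟨k - 1, by omega⟩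
  obtain ⟨M, hM⟩ := hT.bounded
  have hbase := exists_first_order_system_estimate hΩ (m := m) (p := m - 1) (by omega) (by omega)
    hρ hnr hT q
  obtain ⟨C₀, h₀⟩ := famNormSq_le_tangential hΩ
    (fun i l => bddC_coef hΩ (hT.contDiffOn i) (hM i)) hbase k (by omega)
  obtain ⟨C₁, h₁⟩ := normSqSobolev_le n (k + 1)
  obtain ⟨C₂, h₂⟩ := recNormSq_le n k
  -- `C₁` and `C₂` translate between the word norms and the multi-index norms; the tangential term
  -- needs no `C₂`, and `C₂ + 1` bounds both factors. The final `+ 1` makes the constant positive.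
  refine ⟨C₁ * C₀ * (C₂ + 1) + 1, by positivity, fun t => ?_⟩
  obtain ⟨D₀, h₀⟩ := h₀ t
  refine ⟨C₁ * D₀ * C₂ + 1, by positivity, fun v hv => ?_⟩
  have hw : ∀ J, Wloc Ω (k + 1) (v J) := fun J => (hv J).wloc hΩ
  have h₀ := h₀ v hv
  rw [famNormSq_firstOrder hΩ fun J => (hw J).mono (Nat.le_add_left 1 k)] at h₀
  have hsum : ∀ {r : ℕ} {u : Form n r}, (∀ J, Wloc Ω k (u J)) →
      ∑ J, recNormSq Ω t k (u J) ≤ C₂ * formNormSqSobolev Ω t k u := fun hu => by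
    rw [formNormSqSobolev, Finset.mul_sum]
    exact Finset.sum_le_sum fun J _ => h₂ Ω hΩ t _ (hu J)
  have hd := hsum (wloc_dbar hΩ hw)
  have hϑ := hsum (wloc_vartheta (t := t) hΩ hw)
  have hz := hsum fun J => (hw J).of_succ
  rw [Nat.add_sub_cancel]
  calc formNormSqSobolev Ω t (k + 1) v ≤ C₁ * famNormSq Ω t (k + 1) v := by
        rw [formNormSqSobolev, famNormSq, Finset.mul_sum]
        exact Finset.sum_le_sum fun J _ => h₁ Ω t _
    _ ≤ C₁ * (C₀ * (C₂ * formNormSqSobolev Ω t k (dbar Ω v) +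
          C₂ * formNormSqSobolev Ω t k (vartheta Ω t v) +
          formNormSqTangential Ω t T (k + 1) v) + D₀ * (C₂ * formNormSqSobolev Ω t k v)) := by
        gcongr
        refine h₀.trans ?_
        unfold formNormSqTangential
        gcongr
        exact hz
    _ ≤ _ := by
        push_cast
        generalize formNormSqSobolev Ω t k (dbar Ω v) = a
        generalize formNormSqSobolev Ω t k (vartheta Ω t v) = b
        generalize formNormSqTangential Ω t T (k + 1) v = c
        generalize formNormSqSobolev Ω t k v = e
        -- The second summand is the slack by which the chosen constants exceed the needed ones; in
        -- `ℝ≥0∞` it is added rather than subtracted.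
        have h : C₁ * (C₀ * (C₂ * a + C₂ * b + c) + D₀ * (C₂ * e)) +
            ((a + b + c) + C₁ * C₀ * (a + b) + C₁ * C₀ * C₂ * c + e) =
            (C₁ * C₀ * (C₂ + 1) + 1) * (a + b + c) + (C₁ * D₀ * C₂ + 1) * e := by ring
        exact le_self_add.trans_eq h
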